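/- \textbf{Definitions.} Let $\Lambda$ be the algebra of symmetric functions in $x_1,x_2,\dots$ over $\mathbb{Q}(q,t)$. For a partition $\mu$ (with Young diagram drawn in the French convention and conjugate $\mu^t$) let $$\tilde H_\mu=\sum_{\sigma:\mu\to\mathbb{N}_+}q^{\mathrm{inv}(\sigma)}\,t^{\mathrm{maj}(\sigma)}\,\prod_{\square\in\mu}x_{\sigma(\square)}$$ be the transformed Macdonald polynomial. Here $\mathrm{Des}(\sigma)$ is the set of boxes $\square\in\mu$ with $\sigma(\square)>\sigma(\square')$ for the box $\square'\in\mu$ immediately below $\square$; $\mathrm{maj}(\sigma)=\sum_{\square\in\mathrm{Des}(\sigma)}(\mathrm{leg}(\square)+1)$; and $\mathrm{inv}(\sigma)=\#\mathrm{Inv}(\sigma)-\sum_{\square\in\mathrm{Des}(\sigma)}\mathrm{arm}(\square)$, where $\mathrm{Inv}(\sigma)$ is the set of pairs $(\square,\square')$ of boxes with $\sigma(\square)>\sigma(\square')$ that attack each other (they are in the same row, or in consecutive rows with the upper box strictly to the right of the lower one) and such that $\square$ precedes $\square'$ when the diagram is read row by row from top to bottom, left to right in each row. For partitions $\lambda^1,\dots,\lambda^r$,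 $r\ge1$, let $\lambda^B:=\bigoplus_{b\in B}\lambda^b$ be the coordinatewise sum and $$\kappa(\lambda^1,\dots,\lambda^r):=\frac{1}{(q-1)^{r-1}}\sum_{\pi}(-1)^{\#\pi-1}(\#\pi-1)!\prod_{B\in\pi}\tilde H_{\lambda^B},$$ the sum running over all set partitions $\pi$ of $\{1,\dots,r\}$. The \emph{fully colored Macdonald polynomial} of a partition $\mu$ is $$\bar H_\mu:=\kappa\big(1^{\mu^t_1},1^{\mu^t_2},\dots,1^{\mu^t_{\mu_1}}\big),\qquad \bar H_\emptyset:=1 .$$ For $f\in\Lambda$, let $f[\mathbf{X}(t-1)]$ be the result of writing $f$ as a polynomial in the power sums $p_k$, $k\ge1$, with coefficients in $\mathbb{Q}(q,t)$ and replacing each $p_k$ by $(t^k-1)p_k$. Let $\lambda\le\mu$ denote the dominance order on partitions of the same size. For positive integers $a_2,\dots,a_n$ ($n\ge1$) put $$P_{a_2,\dots,a_n}(q):=\sum_{T}\ \prod_{1<i\le n}[\delta_T(i)]_q,\qquad [k]_q:=1+q+\cdots+q^{k-1},$$ where $T$ runs over the increasing trees on $\{1,\dots,n\}$ (trees rooted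 at $1$ in which every vertex is larger than its proper ancestors) and $\delta_T(i)$ is the sum of $a_j$ over all descendants $j$ of $i$, including $i$ itself (so $P=1$ for $n=1$). \textbf{Theorem.} (1) Every $\bar H_\mu$ belongs to $\Lambda$, and the family $(\bar H_\mu)_\mu$, indexed by all partitions $\mu$, is a linear basis of $\Lambda$ over $\mathbb{Q}(q,t)$. (2) For every partition $\mu$ there are coefficients $c_\lambda\in\mathbb{Q}(q,t)$ with $$\bar H_\mu[\mathbf{X}(t-1)]=\sum_{\lambda\le\mu}c_\lambda\,s_\lambda,\qquad c_\mu\neq0,\qquad c_\mu=(-1)^{|\mu|}P_{\mu^t_2,\dots,\mu^t_{\mu_1}}(q)+t\,R(q,t)$$ for some polynomial $R\in\mathbb{Z}[q,t]$ (for $\mu=\emptyset$ the polynomial $P$ is $1$). -/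

import Mathlib

open Finset

namespace Macdonald

noncomputable section

/-! ### The ground field and the algebra of symmetric functions -/

/-- The field `ℚ(q,t)` of rational functions in two variables. -/
abbrev QT : Type := FractionRing (MvPolynomial (Fin 2) ℚ)

/-- The variable `q`. -/
def q : QT := algebraMap (MvPolynomial (Fin 2) ℚ) QT (MvPolynomial.X 0)

/-- The variable `t`. -/
def t : QT := algebraMap (MvPolynomial (Fin 2) ℚ) QT (MvPolynomial.X 1)

/-- Formal power series over `ℚ(q,t)` in countably many variables `x_0, x_1, x_2, …`. -/
abbrev PS : Type := MvPowerSeries ℕ QT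

/-- The algebra `Λ` of symmetric functions over `ℚ(q,t)`: the formal power series of bounded
degree that are invariant under all permutations of the variables. -/
def SymFun : Subalgebra QT PS where
  carrier := {f | (∀ e : Equiv.Perm ℕ, MvPowerSeries.renameEquiv QT e f = f) ∧
    ∃ N : ℕ, ∀ α : ℕ →₀ ℕ, MvPowerSeries.coeff α f ≠ 0 → α.degree ≤ N}
  mul_mem' := by
    rintro f g ⟨hf, N, hN⟩ ⟨hg, M, hM⟩
    refine ⟨fun e => by rw [map_mul, hf, hg], N + M, fun α hα => ?_⟩
    classical
    rw [MvPowerSeries.coeff_mul] at hα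
    obtain ⟨p, hp, hne⟩ := Finset.exists_ne_zero_of_sum_ne_zero hα
    rw [Finset.HasAntidiagonal.mem_antidiagonal] at hp
    rw [← hp, map_add]
    exact add_le_add (hN _ (left_ne_zero_of_mul hne)) (hM _ (right_ne_zero_of_mul hne))
  add_mem' := by
    rintro f g ⟨hf, N, hN⟩ ⟨hg, M, hM⟩
    refine ⟨fun e => by rw [map_add, hf, hg], max N M, fun α hα => ?_⟩
    by_cases h : MvPowerSeries.coeff α f = 0
    · have h2 : MvPowerSeries.coeff α g ≠ 0 := by
        intro h2
        exact hα (by rw [map_add, h, h2, add_zero])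
      exact le_max_of_le_right (hM _ h2)
    · exact le_max_of_le_left (hN _ h)
  algebraMap_mem' := by
    intro r
    refine ⟨fun e => by rw [AlgEquiv.commutes], 0, fun α hα => ?_⟩
    classical
    rw [MvPowerSeries.algebraMap_apply, MvPowerSeries.coeff_C] at hα
    have h0 : α = 0 := by
      by_contra h
      exact hα (by simp [h])
    simp [h0]

/-! ### Power sums, Schur functions, plethysm -/

/-- The power sum `p_k = ∑_i x_i ^ k` (used for `k ≥ 1` only). -/
def powerSum (k : ℕ) : PS := by
  classical
  exact fun α => if ∃ i, α = Finsupp.single i k then 1 else 0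

/-- The weight of a semistandard tableau: the exponent of the monomial `x ^ T`. -/
def tableauWeight {lam : YoungDiagram} (T : SemistandardYoungTableau lam) : ℕ →₀ ℕ :=
  ∑ c ∈ lam.cells, Finsupp.single (T c.1 c.2) 1

/-- The Schur function `s_λ = ∑_T x ^ T`, over all semistandard tableaux `T` of shape `λ`. -/
def schur (lam : YoungDiagram) : PS :=
  fun α => (Nat.card {T : SemistandardYoungTableau lam // tableauWeight T = α} : QT)

/-- `g = f[A]`, where `A` is an alphabet with `p_k[A] = pA k` for `k ≥ 1`: expand `f` as a
polynomial `F` in the power sums `p_1, p_2, …` (the variable `X k` of `F` stands for `p_{k+1}`) and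
replace every `p_k` by `p_k[A]`, without touching the coefficients of `F`. -/
def IsPlethysm (pA : ℕ → PS) (f g : PS) : Prop :=
  ∃ F : MvPolynomial ℕ QT, MvPolynomial.aeval (fun k => powerSum (k + 1)) F = f ∧
    MvPolynomial.aeval (fun k => pA (k + 1)) F = g

/-- The values `p_k[X(t-1)] = (t ^ k - 1) p_k` for the alphabet `X(t-1) = (x_0 + x_1 + ⋯)(t-1)`. -/
def alphabetXt (k : ℕ) : PS := (t ^ k - 1) • powerSum k

/-- Dominance order on partitions of the same size (`rowLen i` is the part `λ_{i+1}`). -/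
def DominatedBy (lam mu : YoungDiagram) : Prop :=
  lam.card = mu.card ∧
    ∀ k : ℕ, ∑ i ∈ range k, lam.rowLen i ≤ ∑ i ∈ range k, mu.rowLen i

/-! ### Macdonald polynomials

The cell `(r, c)` of a diagram lies in row `r` and column `c`, counted from `0`. Diagrams are
drawn in the French convention: row `0` is the bottom row and row `r + 1` lies above row `r`. -/

/-- The fillings of the diagram `μ` by natural numbers of weight `α`, i.e. with `x ^ σ = x ^ α`. -/
def fillings (mu : YoungDiagram) (α : ℕ →₀ ℕ) : Finset (mu.cells → ℕ) :=
  (Fintype.piFinset fun _ => α.support).filter fun σ => ∑ c, Finsupp.single (σ c) 1 = α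

section Statistics

variable {mu : YoungDiagram}

/-- The arm length of a cell. -/
def arm (c : mu.cells) : ℕ := mu.rowLen c.1.1 - (c.1.2 + 1)

/-- The leg length of a cell. -/
def leg (c : mu.cells) : ℕ := mu.colLen c.1.2 - (c.1.1 + 1)

/-- The cell `c` lies immediately above the cell `d`. -/
def IsAbove (c d : mu.cells) : Prop := c.1.1 = d.1.1 + 1 ∧ c.1.2 = d.1.2

/-- Two cells attack each other if they are distinct cells of one row, or lie in consecutive rows,
the upper one strictly to the right of the lower one. -/
def Attack (c d : mu.cells) : Prop :=
  (c ≠ d ∧ c.1.1 = d.1.1) ∨ (c.1.1 = d.1.1 + 1 ∧ d.1.2 < c.1.2) ∨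
    (d.1.1 = c.1.1 + 1 ∧ c.1.2 < d.1.2)

/-- The cell `c` precedes `d` in the reading order: row by row from top to bottom, and from left to
right in each row. -/
def Precedes (c d : mu.cells) : Prop := d.1.1 < c.1.1 ∨ (c.1.1 = d.1.1 ∧ c.1.2 < d.1.2)

open Classical in
/-- The descent set of a filling. -/
def descents (σ : mu.cells → ℕ) : Finset mu.cells :=
  univ.filter fun c => ∃ d, IsAbove c d ∧ σ d < σ c

/-- The major index of a filling. -/
def maj (σ : mu.cells → ℕ) : ℕ := ∑ c ∈ descents σ, (leg c + 1)

open Classical in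
/-- The set of inversions of a filling. -/
def inversions (σ : mu.cells → ℕ) : Finset (mu.cells × mu.cells) :=
  univ.filter fun p => Attack p.1 p.2 ∧ Precedes p.1 p.2 ∧ σ p.2 < σ p.1

/-- The statistic `inv` of a filling, as an integer. -/
def inv (σ : mu.cells → ℕ) : ℤ := (#(inversions σ) : ℤ) - ∑ c ∈ descents σ, (arm c : ℤ)

end Statistics

/-- The (transformed) Macdonald polynomial `H̃_μ = ∑_σ q ^ inv(σ) t ^ maj(σ) x ^ σ`, over all
fillings `σ` of `μ`. -/
def macdonaldH (mu : YoungDiagram) : PS :=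
  fun α => ∑ σ ∈ fillings mu α, q ^ inv σ * t ^ maj σ

/-! ### Macdonald cumulants -/

/-- The partition `⊕_{b ∈ B} λ^b`, obtained by adding the parts coordinatewise. -/
def oplus {ι : Type*} (B : Finset ι) (lam : ι → YoungDiagram) : YoungDiagram where
  cells := (range (∑ b ∈ B, (lam b).colLen 0) ×ˢ range (∑ b ∈ B, (lam b).rowLen 0)).filter
    fun c => c.2 < ∑ b ∈ B, (lam b).rowLen c.1
  isLowerSet := by
    rintro ⟨i, j⟩ ⟨i', j'⟩ ⟨hi, hj⟩ h
    simp only [coe_filter, mem_product, mem_range, Set.mem_ofPred_eq] at h ⊢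
    have hi' : i' ≤ i := hi
    have hj' : j' ≤ j := hj
    exact ⟨⟨hi'.trans_lt h.1.1, hj'.trans_lt h.1.2⟩, (hj'.trans_lt h.2).trans_le
      (sum_le_sum fun b _ => (lam b).rowLen_anti _ _ hi')⟩

theorem mem_oplus {ι : Type*} (B : Finset ι) (lam : ι → YoungDiagram) (c : ℕ × ℕ) :
    c ∈ oplus B lam ↔ c.2 < ∑ b ∈ B, (lam b).rowLen c.1 := by
  rw [← YoungDiagram.mem_cells]
  simp only [oplus, mem_filter, mem_product, mem_range, and_iff_right_iff_imp]
  intro h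
  refine ⟨?_, h.trans_le (sum_le_sum fun b _ => (lam b).rowLen_anti _ _ (Nat.zero_le _))⟩
  obtain ⟨b, hb, hne⟩ := Finset.exists_ne_zero_of_sum_ne_zero (Nat.ne_zero_of_lt h)
  have h1 : (c.1, 0) ∈ lam b := YoungDiagram.mem_iff_lt_rowLen.2 (Nat.pos_of_ne_zero hne)
  exact (YoungDiagram.mem_iff_lt_colLen.1 h1).trans_le
    (single_le_sum (f := fun b => (lam b).colLen 0) (fun _ _ => Nat.zero_le _) hb)

theorem rowLen_oplus {ι : Type*} (B : Finset ι) (lam : ι → YoungDiagram) (i : ℕ) :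
    (oplus B lam).rowLen i = ∑ b ∈ B, (lam b).rowLen i :=
  eq_of_forall_lt_iff fun j => by rw [← YoungDiagram.mem_iff_lt_rowLen, mem_oplus]

/-- The joint cumulant of a family indexed by the subsets of `{1, …, r}`: the sum over all set
partitions `π` of `{1, …, r}` of `(-1) ^ (#π - 1) (#π - 1)! ∏_{B ∈ π} u_B`. -/
def jointCumulant {r : ℕ} (u : Finset (Fin r) → PS) : PS :=
  ∑ π : Finpartition (univ : Finset (Fin r)),
    ((-1) ^ (#π.parts - 1) * ((#π.parts - 1).factorial : PS)) * ∏ B ∈ π.parts, u B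

/-- The Macdonald cumulant `κ(λ^1, …, λ^r)`. For `r = 0` (only the empty set partition) it is `1`,
see `macdonaldCumulant_zero`. -/
def macdonaldCumulant {r : ℕ} (lam : Fin r → YoungDiagram) : PS :=
  ((q - 1) ^ (r - 1))⁻¹ • jointCumulant fun B => macdonaldH (oplus B lam)

theorem macdonaldCumulant_zero (lam : Fin 0 → YoungDiagram) : macdonaldCumulant lam = 1 := by
  have h : ∀ π : Finpartition (univ : Finset (Fin 0)), π.parts = ∅ := fun π => by
    rw [Finpartition.parts_eq_empty_iff]; rfl
  have hs : Subsingleton (Finpartition (univ : Finset (Fin 0))) :=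
    ⟨fun π ρ => Finpartition.ext (by rw [h, h])⟩
  rw [macdonaldCumulant, jointCumulant, Fintype.sum_subsingleton _ ⊥]
  simp [h]

/-- The one-column partition `1^k`. -/
def column (k : ℕ) : YoungDiagram where
  cells := range k ×ˢ {0}
  isLowerSet := by
    rintro ⟨i, j⟩ ⟨i', j'⟩ ⟨hi, hj⟩ h
    simp only [coe_product, Set.mem_prod, mem_coe, mem_range, mem_singleton] at h ⊢
    have hi' : i' ≤ i := hi
    have hj' : j' ≤ j := hj
    omega

/-- The fully colored Macdonald polynomial `H̄_μ`: the cumulant of the columns of `μ`. The number of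
columns is `μ_1 = rowLen 0`, and `colLen j` is the length of the `(j+1)`-st column. -/
def fullyColored (mu : YoungDiagram) : PS :=
  macdonaldCumulant fun j : Fin (mu.rowLen 0) => column (mu.colLen j)

/-! ### The increasing-tree polynomial -/

section Trees

variable {m : ℕ}

/-- In the tree `T` with root `0`, the vertex `j` is a descendant of `i` or equal to `i`: the vertex
`i` lies on the path from `j` to the root. -/
def IsDescendant (T : SimpleGraph (Fin (m + 1))) (i j : Fin (m + 1)) : Prop :=
  ∃ w : T.Walk j 0, w.IsPath ∧ i ∈ w.support

/-- `T` is a tree without inversions: every vertex is larger than its proper ancestors. -/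
def IsIncreasingTree (T : SimpleGraph (Fin (m + 1))) : Prop :=
  T.IsTree ∧ ∀ i j, IsDescendant T i j → i ≤ j

end Trees

/-- The polynomial `[k]_q = 1 + q + ⋯ + q ^ (k-1)`. -/
def qInt (k : ℕ) : Polynomial ℤ := ∑ e ∈ range k, Polynomial.X ^ e

open Classical in
/-- The polynomial `∑_T ∏_v [δ_T(v)]_q`, where `T` runs over the increasing trees on the vertices
`0, 1, …, m` with root `0`, where `v` runs over the vertices other than the root, and where
`δ_T(v)` is the sum of `a j` over the descendants `j` of `v`, including `v`. -/
def treePoly (m : ℕ) (a : ℕ → ℕ) : Polynomial ℤ :=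
  ∑ T : SimpleGraph (Fin (m + 1)) with IsIncreasingTree T,
    ∏ v : Fin m, qInt (∑ j : Fin (m + 1) with IsDescendant T v.succ j, a j)

end

end Macdonald

open Macdonald

/-! The plethysm `X(t-1)` makes Macdonald polynomials triangular. The coefficient of `x ^ e` in
`H̃_μ[X(t-1)]` vanishes unless `e` is dominated by `μ`, and the coefficient of `x ^ μ` is the
product of `t ^ (leg + 1) - q ^ arm` over the cells (`coeff_plethysm_macdonaldH_ne_zero`,
`coeff_plethysm_macdonaldH_self`). The reason is a superization formula (`coeff_aeval_alphabetXt`):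
this coefficient is a sum over signed fillings. If the absolute value in some cell is smaller than
the row index of that cell, flipping the sign of one well-chosen cell cancels the terms in pairs
(`sum_superRel_eq_zero`). The formula itself comes from evaluating `H̃_μ` on the alphabets `X(t+N)`,
`N` a natural number. The result is polynomial in `N`, and its value at `N = -1` is found by
combinatorial reciprocity (`exists_polynomial_sum_boxFunctions`).

Dominance is compatible with addition of partitions. Hence all products in the cumulant defining
`H̄_μ` are supported below `μ`, and their coefficients at `μ` multiply. The leading coefficient of
`H̄_μ[X(t-1)]` is thus `(q - 1) ^ (1 - r)` times the cumulant of the arm-leg products, `r` being the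
number of columns (`exists_plethysm_fullyColored`).

This scalar cumulant is computed in two steps. First, an arm-leg product factors over the columns
`j`, and each factor is a combination of multiplicative functions of the set of later columns,
congruent to `1` modulo `q - 1`. Such families have cumulants divisible by `(q - 1) ^ (r - 1)`,
already over `ℤ[q,t]` (`pow_dvd_cumulant`), so the leading coefficient is an integer polynomial.
Second, at `t = 0` the product becomes a sign times a monomial over pairs of columns. Merging the
last column into an earlier one gives a recursion for the cumulants (`cumulant_pairWeight_insert`),
and deleting the last leaf gives the same recursion for increasing trees (`treePoly_succ`). The tree
polynomial is positive at `q = 1`, so the leading coefficient is not zero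
(`leadingCoefficient_spec`).

That `H̃_μ` is symmetric is reduced to fillings by two letters (`twoLetter_comm`): in the reading
order, the weight of an inversion depends only on the distance of the cells, except at one critical
distance, where pairs can be resolved one at a time.

Triangularity with nonzero diagonal yields linear independence, because the plethysm does not depend
on the chosen power sum expression. Spanning follows by comparing dimensions with the span of the
Schur functions of bounded degree, and the Schur expansion of the plethysm by triangularity of the
Schur functions themselves. -/

namespace Macdonald

/-! ### Cumulants and their recursion -/

section Cumulant

variable {ι R : Type*} [DecidableEq ι] [CommRing R]

/-- The cumulant of a family indexed by finite sets, as a sum over set partitions. -/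
def cumulant (u : Finset ι → R) (A : Finset ι) : R :=
  ∑ π : Finpartition A,
    ((-1) ^ (#π.parts - 1) * ((#π.parts - 1).factorial : R)) * ∏ B ∈ π.parts, u B

/-- The set of all set partitions of `A`, as sets of blocks. -/
def setPartitions (A : Finset ι) : Finset (Finset (Finset ι)) :=
  univ.image fun π : Finpartition A => π.parts

theorem mem_setPartitions {A : Finset ι} {p : Finset (Finset ι)} :
    p ∈ setPartitions A ↔ ∅ ∉ p ∧ (p : Set (Finset ι)).PairwiseDisjoint id ∧ p.sup id = A := by
  constructor
  · intro h
    obtain ⟨π, -, rfl⟩ := mem_image.1 h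
    exact ⟨π.bot_notMem, π.disjoint, π.sup_parts⟩
  · rintro ⟨h1, h2, h3⟩
    exact mem_image.2 ⟨⟨p, supIndep_iff_pairwiseDisjoint.2 h2, h3, h1⟩, mem_univ _, rfl⟩

theorem cumulant_eq_sum_setPartitions (u : Finset ι → R) (A : Finset ι) :
    cumulant u A = ∑ p ∈ setPartitions A,
      ((-1) ^ (#p - 1) * ((#p - 1).factorial : R)) * ∏ B ∈ p, u B := by
  rw [setPartitions, sum_image]
  · rfl
  · intro π _ ρ _ h
    exact Finpartition.ext h

theorem card_filter_notMem_of_mem_setPartitions {A : Finset ι} {a : ι} (ha : a ∈ A)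
    {p : Finset (Finset ι)} (hp : p ∈ setPartitions A) : #{D ∈ p | a ∉ D} = #p - 1 := by
  obtain ⟨h1, h2, h3⟩ := mem_setPartitions.1 hp
  rw [← h3, mem_sup] at ha
  obtain ⟨B, hB, haB⟩ := ha
  have : {D ∈ p | a ∉ D} = p.erase B := by
    ext D
    simp only [mem_filter, mem_erase]
    constructor
    · rintro ⟨hD, haD⟩
      exact ⟨fun h => haD (h ▸ haB), hD⟩
    · rintro ⟨hne, hD⟩
      exact ⟨hD, fun haD => (disjoint_left.1 (h2 hD hB hne)) haD haB⟩
  rw [this, card_erase_of_mem hB]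

theorem setPartitions_extend {A C : Finset ι} (hC : C ⊆ A) (hne : C ≠ A) {p : Finset (Finset ι)}
    (hp : p ∈ setPartitions C) : A \ C ∉ p ∧ insert (A \ C) p ∈ setPartitions A := by
  obtain ⟨h1, h2, h3⟩ := mem_setPartitions.1 hp
  have hd : (A \ C).Nonempty := by
    rw [sdiff_nonempty]
    exact fun h => hne (hC.antisymm h)
  have hsub : ∀ D ∈ p, D ⊆ C := fun D hD => h3 ▸ le_sup (f := id) hD
  have hdis : ∀ D ∈ p, Disjoint (A \ C) D := fun D hD =>
    disjoint_sdiff_self_left.mono_right (hsub D hD)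
  refine ⟨fun h => hd.ne_empty (disjoint_self.1 (hdis _ h)), mem_setPartitions.2 ⟨?_, ?_, ?_⟩⟩
  · rw [mem_insert, not_or]
    exact ⟨hd.ne_empty.symm, h1⟩
  · rw [coe_insert]
    exact h2.insert fun D hD _ => hdis D hD
  · rw [sup_insert, h3]
    exact sdiff_union_of_subset hC

theorem setPartitions_erase {A D : Finset ι} {p : Finset (Finset ι)} (hp : p ∈ setPartitions A)
    (hD : D ∈ p) : D.Nonempty ∧ D ⊆ A ∧ p.erase D ∈ setPartitions (A \ D) := by
  obtain ⟨h1, h2, h3⟩ := mem_setPartitions.1 hp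
  have hsub : D ⊆ A := h3 ▸ le_sup (f := id) hD
  refine ⟨nonempty_iff_ne_empty.2 fun h => h1 (h ▸ hD), hsub, mem_setPartitions.2 ⟨?_, ?_, ?_⟩⟩
  · exact fun h => h1 (mem_of_mem_erase h)
  · exact h2.subset (by simp)
  · rw [← h3]
    ext x
    simp only [mem_sup, mem_sdiff, mem_erase, id]
    constructor
    · rintro ⟨E, ⟨hne, hE⟩, hx⟩
      exact ⟨⟨E, hE, hx⟩, fun hxD => disjoint_left.1 (h2 hE hD hne) hx hxD⟩
    · rintro ⟨⟨E, hE, hx⟩, hxD⟩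
      exact ⟨E, ⟨fun h => hxD (h ▸ hx), hE⟩, hx⟩

/-- The cumulants of `u` solve the recursion of connected components. -/
theorem sum_cumulant_mul (u : Finset ι → R) (h0 : u ∅ = 1) {A : Finset ι} {a : ι} (ha : a ∈ A) :
    ∑ C ∈ A.powerset with a ∈ C, cumulant u C * u (A \ C) = u A := by
  set c : ℕ → R := fun m => (-1) ^ (m - 1) * ((m - 1).factorial : R) with hc
  have hcum : ∀ C, cumulant u C = ∑ p ∈ setPartitions C, c (#p) * ∏ B ∈ p, u B :=
    cumulant_eq_sum_setPartitions u
  have hsplit : ∑ C ∈ A.powerset with a ∈ C, cumulant u C * u (A \ C) = cumulant u A +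
      ∑ C ∈ A.powerset with a ∈ C ∧ C ≠ A, cumulant u C * u (A \ C) := by
    have : A ∈ A.powerset.filter (a ∈ ·) := by simp [ha]
    rw [← add_sum_erase _ _ this, sdiff_self, bot_eq_empty, h0, mul_one]
    congr 2
    ext C
    simp only [mem_erase, mem_filter]
    tauto
  -- A partition of `C` together with the extra block `A \ C` is a partition of `A` with a marked
  -- block that avoids `a`.
  have hsum : ∑ C ∈ A.powerset with a ∈ C ∧ C ≠ A, cumulant u C * u (A \ C) =
      ∑ p ∈ setPartitions A, ∑ D ∈ p with a ∉ D, c (#p - 1) * ∏ B ∈ p, u B := by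
    simp_rw [hcum, sum_mul]
    rw [sum_sigma', sum_sigma']
    refine sum_bij' (fun x _ => ⟨insert (A \ x.1) x.2, A \ x.1⟩)
      (fun y _ => ⟨A \ y.2, y.1.erase y.2⟩) ?_ ?_ ?_ ?_ ?_
    · rintro ⟨C, p⟩ h
      simp only [mem_sigma, mem_filter, mem_powerset] at h ⊢
      obtain ⟨⟨hC, haC, hne⟩, hp⟩ := h
      exact ⟨(setPartitions_extend hC hne hp).2, mem_insert_self _ _, by simp [haC]⟩
    · rintro ⟨p, D⟩ h
      simp only [mem_sigma, mem_filter, mem_powerset] at h ⊢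
      obtain ⟨hp, hD, haD⟩ := h
      obtain ⟨h1, h2, h3⟩ := setPartitions_erase hp hD
      refine ⟨⟨sdiff_subset, by simp [ha, haD], fun h => ?_⟩, h3⟩
      obtain ⟨x, hx⟩ := h1
      have hx' := h2 hx
      rw [← h] at hx'
      exact (mem_sdiff.1 hx').2 hx
    · rintro ⟨C, p⟩ h
      simp only [mem_sigma, mem_filter, mem_powerset] at h ⊢
      obtain ⟨⟨hC, haC, hne⟩, hp⟩ := h
      rw [Finset.sdiff_sdiff_eq_self hC, erase_insert (setPartitions_extend hC hne hp).1]
    · rintro ⟨p, D⟩ h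
      simp only [mem_sigma, mem_filter] at h ⊢
      obtain ⟨hp, hD, haD⟩ := h
      rw [Finset.sdiff_sdiff_eq_self (setPartitions_erase hp hD).2.1, insert_erase hD]
    · rintro ⟨C, p⟩ h
      simp only [mem_sigma, mem_filter, mem_powerset] at h ⊢
      obtain ⟨⟨hC, haC, hne⟩, hp⟩ := h
      have h1 := (setPartitions_extend hC hne hp).1
      rw [card_insert_of_notMem h1, prod_insert h1, Nat.add_sub_cancel]
      ring
  rw [hsplit, hsum, hcum, ← sum_add_distrib]
  have hA : ({A} : Finset (Finset ι)) ∈ setPartitions A := by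
    rw [mem_setPartitions]
    have hne : A ≠ ∅ := ne_empty_of_mem ha
    simp [hne.symm]
  rw [sum_eq_single_of_mem _ hA]
  · have : ({A} : Finset (Finset ι)).filter (a ∉ ·) = ∅ := by
      simp [filter_eq_empty_iff, ha]
    simp [this, hc]
  · intro p hp hne
    have hcard := card_filter_notMem_of_mem_setPartitions ha hp
    rw [sum_const, hcard, nsmul_eq_mul, ← mul_assoc, ← add_mul]
    -- A partition with `m ≥ 2` blocks has `m - 1` blocks avoiding `a`, and its total coefficient
    -- cancels by `(m - 1)! = (m - 1) (m - 2)!` with opposite signs. Only the one-block partition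
    -- survives.
    suffices h : c #p + ((#p - 1 : ℕ) : R) * c (#p - 1) = 0 by rw [h, zero_mul]
    obtain ⟨h1, h2, h3⟩ := mem_setPartitions.1 hp
    have hp2 : 2 ≤ #p := by
      by_contra hlt
      interval_cases h : #p
      · rw [card_eq_zero] at h
        subst h
        simp only [sup_empty] at h3
        rw [← h3] at ha
        exact absurd ha (notMem_empty a)
      · obtain ⟨B, rfl⟩ := card_eq_one.1 h
        simp only [sup_singleton, id] at h3
        exact hne (by rw [h3])
    obtain ⟨m, hm⟩ := Nat.exists_eq_add_of_le hp2
    rw [hm]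
    simp only [hc, show 2 + m - 1 = m + 1 by omega, show m + 1 - 1 = m by omega,
      Nat.factorial_succ, pow_succ]
    push_cast
    ring

theorem cumulant_map {R' : Type*} [CommRing R'] (f : R →+* R') (u : Finset ι → R) (A : Finset ι) :
    cumulant (fun B => f (u B)) A = f (cumulant u A) := by
  simp [cumulant, map_sum, map_prod]

/-- A family is determined by its products with `u` under subset convolution. -/
theorem eq_of_subset_convolution (u : Finset ι → R) (h0 : u ∅ = 1) (f g : Finset ι → R)
    (P : Finset ι → Prop) (hP : ∀ ⦃S T⦄, T ⊆ S → P S → P T)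
    (h : ∀ S, P S → ∑ C ∈ S.powerset, f C * u (S \ C) = ∑ C ∈ S.powerset, g C * u (S \ C)) :
    ∀ S, P S → f S = g S := by
  intro S
  induction S using Finset.strongInduction with
  | H S ih =>
    intro hS
    have := h S hS
    rw [← add_sum_erase _ _ (mem_powerset_self S), ← add_sum_erase _ _ (mem_powerset_self S),
      sdiff_self, bot_eq_empty, h0, mul_one, mul_one] at this
    rw [sum_congr rfl fun C hC => ?_] at this
    · exact add_right_cancel this
    · have hC' := mem_erase.1 hC
      have hsub := mem_powerset.1 hC'.2
      rw [ih C (hsub.ssubset_of_ne hC'.1) (hP hsub hS)]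

end Cumulant

end Macdonald

namespace Macdonald

/-! ### Deconvolution and divisibility of cumulants -/

section Cumulant

variable {ι R : Type*} [DecidableEq ι] [CommRing R]

theorem sum_powerset_sdiff_assoc (F : Finset ι → Finset ι → Finset ι → R) (S : Finset ι)
    (P : Finset ι → Prop) [DecidablePred P] :
    ∑ C ∈ S.powerset, ∑ E ∈ C.powerset with P E, F E (C \ E) (S \ C) =
      ∑ E ∈ S.powerset with P E, ∑ C ∈ (S \ E).powerset, F E C ((S \ E) \ C) := by
  rw [sum_sigma', sum_sigma']
  refine sum_bij' (fun x _ => ⟨x.2, x.1 \ x.2⟩) (fun x _ => ⟨x.1 ∪ x.2, x.1⟩) ?_ ?_ ?_ ?_ ?_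
  · rintro ⟨C, E⟩ h
    simp only [mem_sigma, mem_filter, mem_powerset] at h ⊢
    exact ⟨⟨h.2.1.trans h.1, h.2.2⟩, sdiff_subset_sdiff h.1 le_rfl⟩
  · rintro ⟨E, C⟩ h
    simp only [mem_sigma, mem_filter, mem_powerset] at h ⊢
    exact ⟨union_subset h.1.1 (h.2.trans sdiff_subset), subset_union_left, h.1.2⟩
  · rintro ⟨C, E⟩ h
    simp only [mem_sigma, mem_filter, mem_powerset] at h
    simp [union_sdiff_of_subset h.2.1]
  · rintro ⟨E, C⟩ h
    simp only [mem_sigma, mem_filter, mem_powerset] at h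
    have : Disjoint E C := (disjoint_sdiff_self_left.mono_left h.2).symm
    simp [union_sdiff_cancel_left this]
  · rintro ⟨C, E⟩ h
    simp only [mem_sigma, mem_filter, mem_powerset] at h
    congr 1
    ext x
    simp only [mem_sdiff]
    have := @h.2.1 x
    tauto

theorem sum_powerset_insert_mem {a : ι} {S : Finset ι} (ha : a ∉ S) (F : Finset ι → R) :
    ∑ C ∈ (insert a S).powerset with a ∈ C, F C = ∑ C ∈ S.powerset, F (insert a C) := by
  refine (sum_bij' (fun C _ => insert a C) (fun C _ => C.erase a) ?_ ?_ ?_ ?_ ?_).symm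
  · intro C hC
    simp only [mem_filter, mem_powerset] at hC ⊢
    exact ⟨insert_subset_insert a hC, mem_insert_self _ _⟩
  · intro C hC
    simp only [mem_filter, mem_powerset] at hC ⊢
    rw [← erase_insert ha]
    exact erase_subset_erase a hC.1
  · intro C hC
    exact erase_insert fun h => ha (mem_powerset.1 hC h)
  · intro C hC
    exact insert_erase (mem_filter.1 hC).2
  · intro C hC
    rfl

/-- In this form the recursion says that `C ↦ κ(C ∪ {a})` is the quotient of `S ↦ u (S ∪ {a})` by
`u` under subset convolution. All later formulas for cumulants identify this quotient by uniqueness.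
-/
theorem sum_cumulant_insert_mul (u : Finset ι → R) (h0 : u ∅ = 1) {a : ι} {S : Finset ι}
    (ha : a ∉ S) : ∑ C ∈ S.powerset, cumulant u (insert a C) * u (S \ C) = u (insert a S) := by
  rw [← sum_cumulant_mul u h0 (mem_insert_self a S), sum_powerset_insert_mem ha]
  refine sum_congr rfl fun C hC => ?_
  congr 2
  rw [insert_sdiff_insert]
  ext x
  simp only [mem_sdiff, mem_insert]
  refine ⟨fun h => ⟨h.1, fun h' => ?_⟩, fun h => ⟨h.1, fun h' => h.2 (Or.inr h')⟩⟩
  rcases h' with rfl | h'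
  · exact ha h.1
  · exact h.2 h'

/-- The solution `f` of the subset convolution equation `f * u = v`. -/
def deconv (u v : Finset ι → R) (S : Finset ι) : R :=
  v S - ∑ C ∈ S.powerset.attach, if _ : C.1 ≠ S then deconv u v C.1 * u (S \ C.1) else 0
termination_by #S
decreasing_by exact card_lt_card ((mem_powerset.1 C.2).ssubset_of_ne ‹_›)

theorem sum_deconv_mul (u v : Finset ι → R) (h0 : u ∅ = 1) (S : Finset ι) :
    ∑ C ∈ S.powerset, deconv u v C * u (S \ C) = v S := by
  rw [← add_sum_erase _ _ (mem_powerset_self S), sdiff_self, bot_eq_empty, h0, mul_one]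
  rw [deconv]
  simp only [dite_eq_ite]
  rw [sum_attach S.powerset fun C => if C ≠ S then deconv u v C * u (S \ C) else 0]
  rw [← add_sum_erase _ _ (mem_powerset_self S), if_neg (by simp), zero_add]
  rw [sum_congr rfl fun C hC => if_pos (mem_erase.1 hC).1, sub_add_cancel]

variable (u : Finset ι → R) (x : ι → R)

/-- The cumulants of the product of `u` with the multiplicative function of `x`, relative to
those of `u`. -/
theorem deconv_eq_sum (h0 : u ∅ = 1) {S : Finset ι} {s : ι} (hs : s ∈ S) :
    deconv u (fun B => (∏ k ∈ B, x k) * u B) S =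
      ∑ C ∈ S.powerset with s ∈ C, (∏ k ∈ C, x k - 1) * cumulant u C *
        deconv u (fun B => (∏ k ∈ B, x k) * u B) (S \ C) := by
  set f := deconv u (fun B => (∏ k ∈ B, x k) * u B) with hf
  have hspec : ∀ S, ∑ C ∈ S.powerset, f C * u (S \ C) = (∏ k ∈ S, x k) * u S :=
    sum_deconv_mul u _ h0
  set g : Finset ι → R := fun S => ∑ C ∈ S.powerset with s ∈ C,
    (∏ k ∈ C, x k - 1) * cumulant u C * f (S \ C) with hg
  -- Formally `u` is the exponential of its cumulants, so the quotient is the exponential of `(∏ x -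
  -- 1) κ`; the claim is its derivative at `s`. It is proved by checking that the right side solves
  -- the same convolution equation.
  have key := eq_of_subset_convolution u h0 f (fun S => if s ∈ S then g S else f S) (fun _ => True)
    (fun _ _ _ _ => trivial) ?_ S trivial
  · rwa [if_pos hs] at key
  intro S _
  by_cases hsS : s ∈ S
  swap
  · refine sum_congr rfl fun C hC => ?_
    rw [if_neg fun h => hsS (mem_powerset.1 hC h)]
  have h1 : ∑ C ∈ S.powerset, g C * u (S \ C) =
      ∑ E ∈ S.powerset with s ∈ E, (∏ k ∈ E, x k - 1) * cumulant u E *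
        ((∏ k ∈ S \ E, x k) * u (S \ E)) := by
    simp_rw [hg, sum_mul]
    rw [sum_powerset_sdiff_assoc
      (fun E C D => (∏ k ∈ E, x k - 1) * cumulant u E * f C * u D) S (s ∈ ·)]
    refine sum_congr rfl fun E hE => ?_
    rw [← hspec, mul_sum]
    exact sum_congr rfl fun C hC => by ring
  have h2 : ∑ C ∈ S.powerset with s ∉ C, f C * u (S \ C) =
      ∑ E ∈ S.powerset with s ∈ E, cumulant u E * ((∏ k ∈ S \ E, x k) * u (S \ E)) := by
    have : ∀ C ∈ S.powerset.filter (s ∉ ·), f C * u (S \ C) =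
        ∑ E ∈ (S \ C).powerset with s ∈ E, f C * (cumulant u E * u ((S \ C) \ E)) := by
      intro C hC
      rw [← mul_sum, sum_cumulant_mul u h0 (mem_sdiff.2 ⟨hsS, (mem_filter.1 hC).2⟩)]
    rw [sum_congr rfl this]
    have h3 : ∀ E ∈ S.powerset.filter (s ∈ ·),
        cumulant u E * ((∏ k ∈ S \ E, x k) * u (S \ E)) =
          ∑ C ∈ (S \ E).powerset, f C * (cumulant u E * u ((S \ E) \ C)) := by
      intro E hE
      rw [← hspec, mul_sum]
      exact sum_congr rfl fun C hC => by ring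
    rw [sum_congr rfl h3]
    refine sum_comm' (t' := S.powerset.filter (s ∈ ·)) (s' := fun E => (S \ E).powerset) ?_ |>.trans
      (sum_congr rfl fun E hE => sum_congr rfl fun C hC => ?_)
    · intro C E
      simp only [mem_filter, mem_powerset, subset_sdiff]
      constructor
      · rintro ⟨⟨h1, h2⟩, ⟨h3, h4⟩, h5⟩
        exact ⟨⟨h1, h4.symm⟩, h3, h5⟩
      · rintro ⟨⟨h1, h2⟩, h3, h4⟩
        exact ⟨⟨h1, fun h => disjoint_left.1 h2 h h4⟩, ⟨h3, h2.symm⟩, h4⟩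
    · rw [sdiff_right_comm]
  have h3 : ∑ C ∈ S.powerset, (if s ∈ C then g C else f C) * u (S \ C) =
      ∑ C ∈ S.powerset, g C * u (S \ C) + ∑ C ∈ S.powerset with s ∉ C, f C * u (S \ C) := by
    rw [sum_filter, ← sum_add_distrib]
    refine sum_congr rfl fun C hC => ?_
    by_cases h : s ∈ C
    · simp [h]
    · have : g C = 0 := by
        rw [hg]
        refine sum_eq_zero fun E hE => ?_
        rw [mem_filter, mem_powerset] at hE
        exact absurd (hE.1 hE.2) h
      simp [h, this]
  rw [h3, h1, h2, ← sum_add_distrib, hspec, ← sum_cumulant_mul u h0 hsS, mul_sum]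
  refine sum_congr rfl fun E hE => ?_
  rw [mem_filter, mem_powerset] at hE
  rw [← prod_sdiff hE.1]
  ring

theorem dvd_prod_sub_one {z : R} (hx : ∀ k, z ∣ x k - 1) (C : Finset ι) :
    z ∣ ∏ k ∈ C, x k - 1 := by
  induction C using Finset.induction_on with
  | empty => simp
  | insert a C ha ih =>
    rw [prod_insert ha, show x a * ∏ k ∈ C, x k - 1 =
      (x a - 1) * ∏ k ∈ C, x k + (∏ k ∈ C, x k - 1) by ring]
    exact dvd_add (Dvd.dvd.mul_right (hx a) _) ih

/-- In each term of `deconv_eq_sum` the factor `∏ x - 1` supplies the one power of `z` that the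
cumulant of `C` lacks, so the exponents add up to `#S`. -/
theorem pow_dvd_deconv (h0 : u ∅ = 1) {z : R} (hx : ∀ k, z ∣ x k - 1) (S : Finset ι)
    (hκ : ∀ C ⊆ S, C.Nonempty → z ^ (#C - 1) ∣ cumulant u C) :
    z ^ #S ∣ deconv u (fun B => (∏ k ∈ B, x k) * u B) S := by
  induction S using Finset.strongInduction with
  | H S ih =>
    rcases S.eq_empty_or_nonempty with rfl | ⟨s, hs⟩
    · simp
    rw [deconv_eq_sum u x h0 hs]
    refine dvd_sum fun C hC => ?_
    rw [mem_filter, mem_powerset] at hC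
    have hne : C.Nonempty := ⟨s, hC.2⟩
    have hpos := hne.card_pos
    have hcard := card_sdiff_add_card_eq_card hC.1
    have : z ^ #S = z * z ^ (#C - 1) * z ^ #(S \ C) := by
      rw [← pow_succ', ← pow_add]
      congr 1
      omega
    rw [this]
    refine mul_dvd_mul (mul_dvd_mul (dvd_prod_sub_one x hx C) (hκ C hC.1 hne))
      (ih _ (sdiff_ssubset hC.1 hne) fun D hD => hκ D (hD.trans sdiff_subset))

end Cumulant

section Factorization

variable {ι R : Type*} [LinearOrder ι] [CommRing R]

/-- Cumulants of a family of products, in which every factor is a combination of multiplicative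
functions that are congruent to `1` modulo `z`, are divisible by powers of `z`. -/
theorem pow_dvd_cumulant {κ : Type*} {z : R} (φ : ι → Finset ι → R) (I : ι → Finset κ)
    (c : ι → κ → R) (x : ι → κ → ι → R) (hx : ∀ j i k, z ∣ x j i k - 1)
    (hφ : ∀ j S, φ j S = ∑ i ∈ I j, c j i * ∏ k ∈ S, x j i k) (A : Finset ι) (hA : A.Nonempty) :
    z ^ (#A - 1) ∣ cumulant (fun B => ∏ j ∈ B, φ j {k ∈ B | j < k}) A := by
  set u : Finset ι → R := fun B => ∏ j ∈ B, φ j {k ∈ B | j < k} with hu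
  have h0 : u ∅ = 1 := by simp [hu]
  induction A using Finset.strongInduction with
  | H A ih =>
    set a := A.min' hA with ha
    set S := A.erase a with hS
    have haS : a ∉ S := notMem_erase _ _
    have hins : insert a S = A := insert_erase (A.min'_mem hA)
    have hlt : ∀ k ∈ S, a < k := fun k hk => A.min'_lt_of_mem_erase_min' hA hk
    have hSA : S ⊂ A := erase_ssubset (A.min'_mem hA)
    -- The minimum `a` is peeled off: `u (S ∪ {a}) = φ a S * u S`, and expanding `φ a` writes the
    -- cumulant as a combination of the quotients treated in `pow_dvd_deconv`.
    have hcum := eq_of_subset_convolution u h0 (fun C => cumulant u (insert a C))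
      (fun C => ∑ i ∈ I a, c a i * deconv u (fun B => (∏ k ∈ B, x a i k) * u B) C)
      (fun S => ∀ k ∈ S, a < k) (fun S T hTS hS k hk => hS k (hTS hk)) ?_ S hlt
    · rw [← hins, hcum, card_insert_of_notMem haS, Nat.add_sub_cancel]
      refine dvd_sum fun i hi => Dvd.dvd.mul_left (pow_dvd_deconv u _ h0 (hx a i) S ?_) _
      exact fun C hC hne => ih C (hC.trans_ssubset hSA) hne
    · intro S hS
      have haS : a ∉ S := fun h => lt_irrefl _ (hS a h)
      rw [sum_cumulant_insert_mul u h0 haS]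
      simp_rw [sum_mul]
      rw [sum_comm]
      simp_rw [mul_assoc, ← mul_sum, sum_deconv_mul u _ h0, ← mul_assoc]
      rw [← sum_mul, ← hφ, hu]
      simp only
      rw [prod_insert haS]
      congr 1
      · congr 1
        ext k
        simp only [mem_filter, mem_insert]
        constructor
        · rintro ⟨rfl | h, h'⟩
          · exact absurd h' (lt_irrefl _)
          · exact h
        · exact fun h => ⟨Or.inr h, hS k h⟩
      · refine prod_congr rfl fun j hj => ?_
        rw [filter_insert, if_neg (hS j hj).le.not_gt]

end Factorization

/-! ### Cumulants of monomials over pairs -/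

section Merge

variable {ι R : Type*} [LinearOrder ι] [CommRing R]

/-- The monomial `∏ y ^ a k`, over the pairs `j < k` in `B`. -/
def pairWeight (y : R) (a : ι → ℕ) (B : Finset ι) : R :=
  ∏ k ∈ B, y ^ (a k * #{j ∈ B | j < k})

/-- A finite geometric sum: the ranks of the elements of `S` run through `0, …, #S - 1`. -/
theorem sub_one_mul_sum_pow_rank (y : R) (S : Finset ι) :
    (y - 1) * ∑ j ∈ S, y ^ #{i ∈ S | i < j} = y ^ #S - 1 := by
  induction S using Finset.induction_on_max with
  | empty => simp
  | insert a S h ih =>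
    have ha : a ∉ S := fun h' => lt_irrefl _ (h a h')
    rw [sum_insert ha, card_insert_of_notMem ha, mul_add]
    have h1 : ∑ j ∈ S, y ^ #{i ∈ insert a S | i < j} = ∑ j ∈ S, y ^ #{i ∈ S | i < j} :=
      sum_congr rfl fun j hj => by rw [filter_insert, if_neg (h j hj).le.not_gt]
    have h2 : {i ∈ insert a S | i < a} = S := by
      rw [filter_insert, if_neg (lt_irrefl a), filter_true_of_mem h]
    rw [h1, ih, h2]
    ring

/-- Adding the largest index multiplies the weight of `S` by `(y ^ a n) ^ #S`. By the geometric sum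
this factor is `1` plus `y ^ a n - 1` times the powers of `y ^ a n` indexed by the ranks of `j ∈ S`,
and each such power is absorbed by raising `a j` to `a j + a n`. -/
theorem cumulant_pairWeight_insert (y : R) (a : ι → ℕ) {n : ι} {S : Finset ι} (hS : ∀ k ∈ S, k < n)
    (hne : S.Nonempty) :
    cumulant (pairWeight y a) (insert n S) =
      (y ^ a n - 1) * ∑ j ∈ S, cumulant (pairWeight y (Function.update a j (a j + a n))) S := by
  have h0 : ∀ a : ι → ℕ, pairWeight y a ∅ = 1 := fun a => by simp [pairWeight]
  -- The term at `C = ∅` accounts for the cumulant of `{n}` alone, which is `1`; it disappears for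
  -- nonempty `S`.
  have hcum := eq_of_subset_convolution (pairWeight y a) (h0 a)
    (fun C => cumulant (pairWeight y a) (insert n C))
    (fun C => (if C = ∅ then 1 else 0) + (y ^ a n - 1) *
      ∑ j ∈ C, cumulant (pairWeight y (Function.update a j (a j + a n))) C)
    (fun S => ∀ k ∈ S, k < n) (fun S T hTS hS k hk => hS k (hTS hk)) ?_ S hS
  · rw [hcum, if_neg hne.ne_empty, zero_add]
  intro S hS
  have hn : n ∉ S := fun h => lt_irrefl _ (hS n h)
  rw [sum_cumulant_insert_mul _ (h0 a) hn]
  have h1 : pairWeight y a (insert n S) = (y ^ a n) ^ #S * pairWeight y a S := by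
    rw [pairWeight, prod_insert hn, pow_mul]
    congr 1
    · rw [filter_insert, if_neg (lt_irrefl n), filter_true_of_mem hS]
    · refine prod_congr rfl fun k hk => ?_
      rw [filter_insert, if_neg (hS k hk).le.not_gt]
  have h2 : ∀ j ∈ S, pairWeight y (Function.update a j (a j + a n)) S =
      (y ^ a n) ^ #{i ∈ S | i < j} * pairWeight y a S := by
    intro j hj
    have e1 := mul_prod_erase S
      (fun k => y ^ (Function.update a j (a j + a n) k * #{i ∈ S | i < k})) hj
    have e2 := mul_prod_erase S (fun k => y ^ (a k * #{i ∈ S | i < k})) hj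
    rw [pairWeight, pairWeight, ← e1, ← e2, Function.update_self, ← mul_assoc, ← pow_mul,
      ← pow_add, add_mul, add_comm (a j * _)]
    congr 1
    refine prod_congr rfl fun k hk => ?_
    rw [Function.update_of_ne (ne_of_mem_erase hk)]
  have h3 : ∑ C ∈ S.powerset, (∑ j ∈ C, cumulant (pairWeight y (Function.update a j (a j + a n))) C)
      * pairWeight y a (S \ C) = ∑ j ∈ S, pairWeight y (Function.update a j (a j + a n)) S := by
    simp_rw [sum_mul]
    rw [sum_comm' (t' := S) (s' := fun j => S.powerset.filter (j ∈ ·))]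
    · refine sum_congr rfl fun j hj => ?_
      rw [← sum_cumulant_mul _ (h0 _) hj]
      refine sum_congr rfl fun C hC => ?_
      congr 1
      refine prod_congr rfl fun k hk => ?_
      rw [Function.update_of_ne]
      rintro rfl
      exact (mem_sdiff.1 hk).2 (mem_filter.1 hC).2
    · intro C j
      simp only [mem_powerset, mem_filter]
      exact ⟨fun h => ⟨⟨h.1, h.2⟩, h.1 h.2⟩, fun h => ⟨h.1.1, h.1.2⟩⟩
  simp_rw [add_mul, sum_add_distrib, mul_assoc]
  rw [← mul_sum, h3, sum_congr rfl h2, ← sum_mul, ← mul_assoc, sub_one_mul_sum_pow_rank, h1]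
  have h4 : ∑ C ∈ S.powerset, (if C = ∅ then (1 : R) else 0) * pairWeight y a (S \ C) =
      pairWeight y a S := by
    rw [sum_eq_single_of_mem ∅ (empty_mem_powerset S)]
    · simp
    · intro C _ hC
      simp [hC]
  rw [h4]
  ring

end Merge

theorem cumulant_singleton {ι R : Type*} [DecidableEq ι] [CommRing R] (u : Finset ι → R)
    (h0 : u ∅ = 1) (a : ι) : cumulant u {a} = u {a} := by
  have h := sum_cumulant_insert_mul u h0 (notMem_empty a)
  simpa [h0] using h

theorem setPartitions_empty {ι : Type*} [DecidableEq ι] :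
    setPartitions (∅ : Finset ι) = {∅} := by
  ext p
  rw [mem_setPartitions, mem_singleton]
  constructor
  · rintro ⟨h1, -, h3⟩
    rw [eq_empty_iff_forall_notMem]
    intro B hB
    have : B ⊆ ∅ := h3 ▸ le_sup (f := id) hB
    exact h1 (subset_empty.1 this ▸ hB)
  · rintro rfl
    simp

/-- Needed to move from columns indexed by `Fin n` to indices in `range n`. Both sides satisfy the
recursion anchored at the same element. -/
theorem cumulant_comp_map {ι κ R : Type*} [DecidableEq ι] [DecidableEq κ] [CommRing R] (e : ι ↪ κ)
    (v : Finset κ → R) (h0 : v ∅ = 1) (A : Finset ι) :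
    cumulant (fun B => v (B.map e)) A = cumulant v (A.map e) := by
  have h0' : (fun B : Finset ι => v (B.map e)) ∅ = 1 := by simpa using h0
  induction A using Finset.strongInduction with
  | H A ih =>
    rcases A.eq_empty_or_nonempty with rfl | ⟨a, ha⟩
    · rw [cumulant_eq_sum_setPartitions, cumulant_eq_sum_setPartitions]
      rw [setPartitions_empty, map_empty, setPartitions_empty]
      simp
    · have h1 := sum_cumulant_mul (fun B => v (B.map e)) h0' ha
      have h2 := sum_cumulant_mul v h0 (mem_map_of_mem e ha)
      have h3 : ∑ C ∈ (A.map e).powerset with e a ∈ C, cumulant v C * v (A.map e \ C) =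
          ∑ C ∈ A.powerset with a ∈ C, cumulant v (C.map e) * v ((A \ C).map e) := by
        symm
        refine sum_bij (fun C _ => C.map e) ?_ ?_ ?_ ?_
        · intro C hC
          simp only [mem_filter, mem_powerset] at hC ⊢
          exact ⟨map_subset_map.2 hC.1, mem_map_of_mem e hC.2⟩
        · intro C _ D _ h
          exact map_injective e h
        · intro D hD
          simp only [mem_filter, mem_powerset] at hD
          obtain ⟨C, hC, rfl⟩ := subset_map_iff.1 hD.1
          refine ⟨C, ?_, rfl⟩
          simp only [mem_filter, mem_powerset]
          exact ⟨hC, by simpa using hD.2⟩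
        · intro C hC
          rw [Finset.map_sdiff]
      rw [h3, ← h1] at h2
      have hA : A ∈ A.powerset.filter (a ∈ ·) := by simp [ha]
      rw [← add_sum_erase _ _ hA, ← add_sum_erase _ _ hA] at h2
      simp only [sdiff_self, bot_eq_empty, map_empty, h0, mul_one] at h2
      rw [sum_congr rfl fun C hC => ?_] at h2
      · exact (add_right_cancel h2).symm
      · simp only [mem_erase, mem_filter, mem_powerset] at hC
        rw [ih C (hC.2.1.ssubset_of_ne hC.1)]

end Macdonald

namespace Macdonald

/-! ### Increasing trees -/

section Trees

variable {m : ℕ}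

/-- Every vertex other than the root has exactly one smaller neighbour. -/
def HasUniqueParents (T : SimpleGraph (Fin (m + 1))) : Prop :=
  ∀ v, v ≠ 0 → ∃! p, p < v ∧ T.Adj v p

theorem IsIncreasingTree.hasUniqueParents {T : SimpleGraph (Fin (m + 1))}
    (hT : IsIncreasingTree T) : HasUniqueParents T := by
  intro v hv
  obtain ⟨w, hw, huniq⟩ := hT.1.existsUnique_path v 0
  cases w with
  | nil => exact absurd rfl hv
  | @cons _ p _ h w =>
    refine ⟨p, ⟨lt_of_le_of_ne (hT.2 p v ⟨_, hw, ?_⟩) h.ne', h⟩, ?_⟩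
    · simp
    · rintro p' ⟨hlt, hadj⟩
      obtain ⟨w', hw', -⟩ := hT.1.existsUnique_path p' 0
      have hmem : v ∉ w'.support := fun hmem => absurd (hT.2 v p' ⟨w', hw', hmem⟩) hlt.not_ge
      have := huniq (.cons hadj w') (hw'.cons hmem)
      injection this

theorem HasUniqueParents.exists_path {T : SimpleGraph (Fin (m + 1))} (hT : HasUniqueParents T)
    (v : Fin (m + 1)) : ∃ w : T.Walk v 0, w.IsPath ∧ ∀ x ∈ w.support, x ≤ v := by
  induction v using WellFoundedLT.induction with
  | ind v ih =>
    rcases eq_or_ne v 0 with rfl | hv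
    · exact ⟨.nil, by simp, by simp⟩
    · obtain ⟨p, ⟨hlt, hadj⟩, -⟩ := hT v hv
      obtain ⟨w, hw, hle⟩ := ih p hlt
      refine ⟨.cons hadj w, hw.cons fun h => absurd (hle v h) hlt.not_ge, ?_⟩
      intro x hx
      rw [SimpleGraph.Walk.support_cons, List.mem_cons] at hx
      rcases hx with rfl | hx
      · exact le_rfl
      · exact (hle x hx).trans hlt.le

theorem HasUniqueParents.isTree {T : SimpleGraph (Fin (m + 1))} (hT : HasUniqueParents T) :
    T.IsTree := by
  refine ⟨(SimpleGraph.connected_iff_exists_forall_reachable T).2 ⟨0, fun v => ?_⟩, ?_⟩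
  · obtain ⟨w, -⟩ := hT.exists_path v
    exact ⟨w.reverse⟩
  · intro u c hc
    -- The two neighbours on a cycle of its largest vertex would be two different smaller neighbours
    -- of that vertex.
    obtain ⟨v, hv, hmax⟩ := c.support.toFinset.exists_max_image id ⟨u, by simp⟩
    rw [List.mem_toFinset] at hv
    have hmax' : ∀ x ∈ c.support, x ≤ v := fun x hx => hmax x (by simpa using hx)
    set c' := c.rotate v hv with hc'
    have hcyc : c'.IsCycle := hc.rotate hv
    have hle : ∀ x ∈ c'.support, x ≤ v := by
      intro x hx
      exact hmax' x (by simpa [hc'] using hx)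
    have h1 : T.Adj v c'.snd := c'.adj_snd hcyc.not_nil
    have h2 : T.Adj v c'.penultimate := (c'.adj_penultimate hcyc.not_nil).symm
    have h3 : c'.snd < v := lt_of_le_of_ne (hle _ (c'.getVert_mem_support _)) h1.ne'
    have h4 : c'.penultimate < v := lt_of_le_of_ne (hle _ (c'.getVert_mem_support _)) h2.ne'
    have hv0 : v ≠ 0 := ((Fin.zero_le _).trans_lt h3).ne'
    exact hcyc.snd_ne_penultimate ((hT v hv0).unique ⟨h3, h1⟩ ⟨h4, h2⟩)

/-- This local criterion replaces paths by parents and makes the removal of the last vertex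
transparent. -/
theorem isIncreasingTree_iff {T : SimpleGraph (Fin (m + 1))} :
    IsIncreasingTree T ↔ HasUniqueParents T := by
  refine ⟨fun h => h.hasUniqueParents, fun hT => ⟨hT.isTree, ?_⟩⟩
  rintro i j ⟨w, hw, hi⟩
  obtain ⟨w', hw', hle⟩ := hT.exists_path j
  have := (hT.isTree.existsUnique_path j 0).unique hw hw'
  exact hle i (this ▸ hi)

theorem isDescendant_zero_iff {T : SimpleGraph (Fin (m + 1))} (i : Fin (m + 1)) :
    IsDescendant T i 0 ↔ i = 0 := by
  constructor
  · rintro ⟨w, hw, hi⟩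
    rw [SimpleGraph.Walk.isPath_iff_nil] at hw
    cases hw
    simpa using hi
  · rintro rfl
    exact ⟨.nil, by simp, by simp⟩

theorem HasUniqueParents.isDescendant_iff {T : SimpleGraph (Fin (m + 1))} (hT : HasUniqueParents T)
    {i v p : Fin (m + 1)} (hlt : p < v) (hadj : T.Adj v p) :
    IsDescendant T i v ↔ i = v ∨ IsDescendant T i p := by
  obtain ⟨w, hw, hle⟩ := hT.exists_path p
  have hvw : v ∉ w.support := fun h => absurd (hle v h) hlt.not_ge
  constructor
  · rintro ⟨w', hw', hi⟩
    have := (hT.isTree.existsUnique_path v 0).unique hw' (hw.cons (h := hadj) hvw)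
    rw [this, SimpleGraph.Walk.support_cons, List.mem_cons] at hi
    exact hi.imp id fun h => ⟨w, hw, h⟩
  · rintro (rfl | ⟨w', hw', hi⟩)
    · exact ⟨.cons hadj w, hw.cons hvw, by simp⟩
    · rw [(hT.isTree.existsUnique_path p 0).unique hw' hw] at hi
      exact ⟨.cons hadj w, hw.cons hvw, by simp [hi]⟩

/-- The graph `T` with a new last vertex attached to `j`. -/
def addLeaf (T : SimpleGraph (Fin (m + 1))) (j : Fin (m + 1)) : SimpleGraph (Fin (m + 1 + 1)) :=
  T.map Fin.castSuccEmb ⊔ SimpleGraph.edge j.castSucc (Fin.last (m + 1))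

theorem addLeaf_adj_castSucc (T : SimpleGraph (Fin (m + 1))) (j x y : Fin (m + 1)) :
    (addLeaf T j).Adj x.castSucc y.castSucc ↔ T.Adj x y := by
  simp only [addLeaf, SimpleGraph.edge_adj, SimpleGraph.sup_adj, SimpleGraph.map_adj',
    Fin.coe_castSuccEmb, Fin.castSucc_inj, Fin.castSucc_ne_last]
  constructor
  · rintro (⟨-, x', y', h, rfl, rfl⟩ | ⟨h, -⟩)
    · exact h
    · tauto
  · exact fun h => Or.inl ⟨fun h' => h.ne (Fin.castSucc_injective _ h'), x, y, h, rfl, rfl⟩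

theorem addLeaf_adj_last (T : SimpleGraph (Fin (m + 1))) (j x : Fin (m + 1)) :
    (addLeaf T j).Adj (Fin.last (m + 1)) x.castSucc ↔ x = j := by
  simp only [addLeaf, SimpleGraph.edge_adj, SimpleGraph.sup_adj, SimpleGraph.map_adj',
    Fin.coe_castSuccEmb, Fin.castSucc_inj, Fin.castSucc_ne_last, (Fin.castSucc_ne_last _).symm]
  simp [(Fin.castSucc_ne_last x).symm]

theorem hasUniqueParents_addLeaf {T : SimpleGraph (Fin (m + 1))} {j : Fin (m + 1)}
    (hT : HasUniqueParents T) : HasUniqueParents (addLeaf T j) := by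
  intro v hv
  induction v using Fin.lastCases with
  | last =>
    refine ⟨j.castSucc, ⟨Fin.castSucc_lt_last j, (addLeaf_adj_last T j j).2 rfl⟩, ?_⟩
    rintro p ⟨hlt, hadj⟩
    induction p using Fin.lastCases with
    | last => exact absurd hlt (lt_irrefl _)
    | cast p => rw [(addLeaf_adj_last T j p).1 hadj]
  | cast v =>
    have hv' : v ≠ 0 := by
      rintro rfl
      exact hv rfl
    obtain ⟨p, ⟨hlt, hadj⟩, huniq⟩ := hT v hv'
    refine ⟨p.castSucc, ⟨Fin.castSucc_lt_castSucc_iff.2 hlt,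
      (addLeaf_adj_castSucc T j v p).2 hadj⟩, ?_⟩
    rintro p' ⟨hlt', hadj'⟩
    induction p' using Fin.lastCases with
    | last => exact absurd hlt' (Fin.castSucc_lt_last v).not_gt
    | cast p' =>
      rw [huniq p' ⟨Fin.castSucc_lt_castSucc_iff.1 hlt', (addLeaf_adj_castSucc T j v p').1 hadj'⟩]

theorem comap_addLeaf (T : SimpleGraph (Fin (m + 1))) (j : Fin (m + 1)) :
    (addLeaf T j).comap Fin.castSucc = T := by
  ext x y
  rw [SimpleGraph.comap_adj, addLeaf_adj_castSucc]

theorem HasUniqueParents.exists_eq_addLeaf {T : SimpleGraph (Fin (m + 1 + 1))}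
    (hT : HasUniqueParents T) :
    ∃ T' : SimpleGraph (Fin (m + 1)), ∃ j, HasUniqueParents T' ∧ addLeaf T' j = T := by
  obtain ⟨p, ⟨hlt, hadj⟩, huniq⟩ := hT (Fin.last (m + 1)) (Fin.last_pos.ne')
  induction p using Fin.lastCases with
  | last => exact absurd hlt (lt_irrefl _)
  | cast j =>
  refine ⟨T.comap Fin.castSucc, j, ?_, ?_⟩
  · intro v hv
    obtain ⟨p, ⟨hlt, hadj⟩, huniq⟩ := hT v.castSucc (fun h => hv (Fin.castSucc_injective _ h))
    induction p using Fin.lastCases with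
    | last => exact absurd hlt (Fin.castSucc_lt_last v).not_gt
    | cast p =>
      refine ⟨p, ⟨Fin.castSucc_lt_castSucc_iff.1 hlt, hadj⟩, ?_⟩
      rintro p' ⟨hlt', hadj'⟩
      exact Fin.castSucc_injective _ (huniq _ ⟨Fin.castSucc_lt_castSucc_iff.2 hlt', hadj'⟩)
  · have key : ∀ x : Fin (m + 1), T.Adj (Fin.last (m + 1)) x.castSucc ↔ x = j := by
      refine fun x => ⟨fun h => ?_, ?_⟩
      · exact Fin.castSucc_injective _ (huniq _ ⟨Fin.castSucc_lt_last x, h⟩)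
      · rintro rfl
        exact hadj
    ext x y
    induction x using Fin.lastCases with
    | last =>
      induction y using Fin.lastCases with
      | last => simp
      | cast y => rw [addLeaf_adj_last, key]
    | cast x =>
      induction y using Fin.lastCases with
      | last => rw [SimpleGraph.adj_comm, addLeaf_adj_last, SimpleGraph.adj_comm, key]
      | cast y => rw [addLeaf_adj_castSucc, SimpleGraph.comap_adj]

theorem isDescendant_addLeaf_castSucc {T : SimpleGraph (Fin (m + 1))} (hT : HasUniqueParents T)
    (j i x : Fin (m + 1)) :
    IsDescendant (addLeaf T j) i.castSucc x.castSucc ↔ IsDescendant T i x := by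
  induction x using WellFoundedLT.induction with
  | ind x ih =>
    rcases eq_or_ne x 0 with rfl | hx
    · rw [isDescendant_zero_iff, Fin.castSucc_zero, isDescendant_zero_iff]
      exact (Fin.castSucc_injective _).eq_iff' rfl
    · obtain ⟨p, ⟨hlt, hadj⟩, -⟩ := hT x hx
      rw [hT.isDescendant_iff hlt hadj, (hasUniqueParents_addLeaf hT).isDescendant_iff
        (Fin.castSucc_lt_castSucc_iff.2 hlt) ((addLeaf_adj_castSucc T j x p).2 hadj), ih p hlt,
        (Fin.castSucc_injective _).eq_iff]

theorem isDescendant_addLeaf_last {T : SimpleGraph (Fin (m + 1))} (hT : HasUniqueParents T)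
    (j i : Fin (m + 1)) :
    IsDescendant (addLeaf T j) i.castSucc (Fin.last (m + 1)) ↔ IsDescendant T i j := by
  rw [(hasUniqueParents_addLeaf hT).isDescendant_iff (Fin.castSucc_lt_last j)
    ((addLeaf_adj_last T j j).2 rfl), isDescendant_addLeaf_castSucc hT]
  simp [Fin.castSucc_ne_last]

theorem last_isDescendant_addLeaf {T : SimpleGraph (Fin (m + 1))} (hT : HasUniqueParents T)
    (j : Fin (m + 1)) (x : Fin (m + 1 + 1)) :
    IsDescendant (addLeaf T j) (Fin.last (m + 1)) x ↔ x = Fin.last (m + 1) := by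
  have hT' := hasUniqueParents_addLeaf (j := j) hT
  constructor
  · intro h
    exact le_antisymm (Fin.le_last x) ((isIncreasingTree_iff.2 hT').2 _ _ h)
  · rintro rfl
    obtain ⟨w, hw, -⟩ := hT'.exists_path (Fin.last (m + 1))
    exact ⟨w, hw, by simp⟩

open Classical in
theorem treePoly_zero (a : ℕ → ℕ) : treePoly 0 a = 1 := by
  have : Subsingleton (Fin (0 + 1)) := inferInstanceAs (Subsingleton (Fin 1))
  rw [treePoly, sum_eq_single_of_mem (⊥ : SimpleGraph (Fin (0 + 1)))]
  · simp
  · rw [mem_filter, isIncreasingTree_iff]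
    exact ⟨mem_univ _, fun v hv => absurd (Subsingleton.elim v 0) hv⟩
  · intro T _ hT
    exact absurd (Subsingleton.elim T ⊥) hT

open Classical in
-- The last vertex is always a leaf, attached to an arbitrary earlier `j`. It contributes its own
-- factor, and every other vertex sees its weight exactly as if it were added to the weight of `j`.
theorem treePoly_succ (m : ℕ) (a : ℕ → ℕ) :
    treePoly (m + 1) a = qInt (a (m + 1)) *
      ∑ j ∈ range (m + 1), treePoly m (Function.update a j (a j + a (m + 1))) := by
  rw [← Fin.sum_univ_eq_sum_range
    (fun j => treePoly m (Function.update a j (a j + a (m + 1))))]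
  simp only [treePoly]
  rw [mul_sum]
  simp_rw [mul_sum]
  rw [← sum_product']
  symm
  refine sum_bij (fun x _ => addLeaf x.2 x.1) ?_ ?_ ?_ ?_
  · rintro ⟨j, T⟩ h
    simp only [mem_product, mem_filter, isIncreasingTree_iff] at h ⊢
    exact ⟨mem_univ _, hasUniqueParents_addLeaf h.2.2⟩
  · rintro ⟨j, T⟩ _ ⟨j', T'⟩ _ h
    simp only at h
    have h1 : T = T' := by rw [← comap_addLeaf T j, h, comap_addLeaf]
    subst h1
    have h2 := (addLeaf_adj_last T j j).2 rfl
    rw [h, addLeaf_adj_last] at h2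
    rw [h2]
  · intro T hT
    rw [mem_filter, isIncreasingTree_iff] at hT
    obtain ⟨T', j, hT', h⟩ := hT.2.exists_eq_addLeaf
    exact ⟨(j, T'), by simpa [isIncreasingTree_iff] using hT', h⟩
  · rintro ⟨j, T⟩ h
    simp only [mem_product, mem_filter, isIncreasingTree_iff] at h
    have hT := h.2.2
    rw [Fin.prod_univ_castSucc, mul_comm]
    congr 1
    · refine prod_congr rfl fun v _ => ?_
      congr 1
      rw [sum_filter, sum_filter, Fin.sum_univ_castSucc (n := m + 1)]
      simp only [Fin.succ_castSucc, isDescendant_addLeaf_castSucc hT,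
        isDescendant_addLeaf_last hT, Fin.val_castSucc, Fin.val_last]
      -- The leaf is a descendant of `v` exactly when its parent `j` is, so shifting its weight to
      -- `j` preserves the sum.
      have : ∀ x : Fin (m + 1), (if IsDescendant T v.succ x then
          Function.update a (j : ℕ) (a j + a (m + 1)) x else 0) =
          (if IsDescendant T v.succ x then a x else 0) +
            if x = j then (if IsDescendant T v.succ j then a (m + 1) else 0) else 0 := by
        intro x
        by_cases hx : x = j
        · subst hx
          rw [Function.update_self, if_pos rfl]
          split_ifs <;> rfl
        · rw [Function.update_of_ne (fun h => hx (Fin.ext h)), if_neg hx, add_zero]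
      rw [sum_congr rfl fun x _ => this x, sum_add_distrib]
      simp
    · congr 1
      rw [sum_filter, Fin.succ_last]
      simp [last_isDescendant_addLeaf hT]

end Trees

theorem sub_one_mul_aeval_qInt {R : Type*} [CommRing R] (y : R) (k : ℕ) :
    (y - 1) * Polynomial.aeval y (qInt k) = y ^ k - 1 := by
  rw [qInt, map_sum, mul_comm]
  simp_rw [map_pow, Polynomial.aeval_X]
  exact geom_sum_mul y k

/-- Merging the last index and deleting the last leaf are the same recursion, up to one factor `y -
1` per step. -/
theorem cumulant_pairWeight_range {R : Type*} [CommRing R] (y : R) (m : ℕ) (a : ℕ → ℕ) :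
    cumulant (pairWeight y a) (range (m + 1)) =
      (y - 1) ^ m * Polynomial.aeval y (treePoly m a) := by
  induction m generalizing a with
  | zero =>
    rw [treePoly_zero, zero_add, range_one, cumulant_singleton]
    · simp [pairWeight, filter_singleton]
    · simp [pairWeight]
  | succ m ih =>
    rw [range_add_one, cumulant_pairWeight_insert y a (fun k hk => mem_range.1 hk) (by simp),
      treePoly_succ, map_mul, map_sum, ← sub_one_mul_aeval_qInt]
    simp_rw [ih]
    rw [← mul_sum]
    ring

/-- The recursion has positive ingredients at `q = 1`, where `[k]_q` becomes `k`. This is what keeps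
the leading coefficient from vanishing. -/
theorem eval_one_treePoly_pos (m : ℕ) (a : ℕ → ℕ) (ha : ∀ j ≤ m, 0 < a j) :
    0 < (treePoly m a).eval 1 := by
  induction m generalizing a with
  | zero => simp [treePoly_zero]
  | succ m ih =>
    rw [treePoly_succ, Polynomial.eval_mul, Polynomial.eval_finsetSum]
    refine mul_pos ?_ (sum_pos (fun j hj => ih _ fun i hi => ?_) (by simp))
    · simp only [qInt, Polynomial.eval_finsetSum, Polynomial.eval_pow, Polynomial.eval_X, one_pow,
        sum_const, card_range, nsmul_eq_mul, mul_one]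
      exact_mod_cast ha _ le_rfl
    · rcases eq_or_ne i j with rfl | h
      · rw [Function.update_self]
        exact Nat.add_pos_left (ha _ (by omega)) _
      · rw [Function.update_of_ne h]
        exact ha _ (by omega)

end Macdonald

namespace Macdonald

/-! ### Symmetry for fillings by two letters -/

section TwoLetters

variable {ι R : Type*} [DecidableEq ι] [CommRing R]

/-- The weight of a filling of `S` by two letters, of which `T` is the set of cells that hold the
larger one: the product of `W u v` over all inversions. -/
def cutWeight (p : ι → ℤ) (W : ι → ι → R) (S T : Finset ι) : R :=
  ∏ u ∈ T, ∏ v ∈ S \ T, if p u < p v then W u v else 1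

/-- The generating function of the fillings of `S` by two letters. -/
def twoLetter (p : ι → ℤ) (W : ι → ι → R) (x y : R) (S : Finset ι) : R :=
  ∑ T ∈ S.powerset, x ^ #T * y ^ #(S \ T) * cutWeight p W S T

/-- The weight `W` is `z` at distances less than `D` and `1` at distances greater than `D`. -/
def IsKernel (p : ι → ℤ) (z : R) (D : ℕ) (W : ι → ι → R) (S : Finset ι) : Prop :=
  ∀ u ∈ S, ∀ v ∈ S, p u < p v → (p v < p u + D → W u v = z) ∧ (p u + D < p v → W u v = 1)

theorem IsKernel.mono {p : ι → ℤ} {z : R} {D : ℕ} {W : ι → ι → R} {S S' : Finset ι}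
    (h : IsKernel p z D W S) (hS : S' ⊆ S) : IsKernel p z D W S' :=
  fun u hu v hv => h u (hS hu) v (hS hv)

variable {p : ι → ℤ} {z : R} {D : ℕ} {W : ι → ι → R} {S : Finset ι} {i j : ι}

/-- Two cells at the maximal distance, the first of which holds the larger letter, interact with
the other cells in a way that does not depend on the letters there. -/
theorem cutWeight_insert (hp : Function.Injective p) (hW : IsKernel p z D W S) (hi : i ∈ S)
    (hj : j ∈ S) (hij : i ≠ j) (hD : p j = p i + D) {T : Finset ι}
    (hT : T ⊆ (S.erase i).erase j) :
    cutWeight p W S (insert i T) = W i j * z ^ #{k ∈ (S.erase i).erase j | p i < p k ∧ p k < p j} *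
      cutWeight p W ((S.erase i).erase j) T := by
  have hjT : j ∉ T := fun h => (mem_erase.1 (hT h)).1 rfl
  have hiT : i ∉ T := fun h => (mem_erase.1 (mem_of_mem_erase (hT h))).1 rfl
  have hij' : p i < p j := by
    refine lt_of_le_of_ne (by omega) fun h => hij (hp h)
  set S' := (S.erase i).erase j with hS'
  have hjS' : j ∉ S' := notMem_erase _ _
  have hiS' : i ∉ S' := fun h => (mem_erase.1 (mem_of_mem_erase h)).1 rfl
  have hS'S : S' ⊆ S := (erase_subset _ _).trans (erase_subset _ _)
  have hsd : S \ insert i T = insert j (S' \ T) := by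
    ext k
    simp only [hS', mem_sdiff, mem_insert, mem_erase]
    by_cases hk : k = j
    · subst hk
      simp [hj, hij.symm, hjT]
    · simp [hk]
      tauto
  have hjd : j ∉ S' \ T := fun h => hjS' (mem_sdiff.1 h).1
  rw [cutWeight, hsd, prod_insert hiT, prod_insert hjd, if_pos hij']
  simp_rw [prod_insert hjd]
  rw [prod_mul_distrib]
  -- A cell strictly between `i` and `j` contributes one `z` in any case: with the smaller letter it
  -- forms an inversion with `i`, with the larger one an inversion with `j`. Cells outside are
  -- farther than `D` from the partner with which they could form an inversion.
  have h1 : ∏ v ∈ S' \ T, (if p i < p v then W i v else 1) =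
      z ^ #{k ∈ S' \ T | p i < p k ∧ p k < p j} := by
    rw [← prod_const, prod_filter]
    refine prod_congr rfl fun v hv => ?_
    have hv' := (mem_sdiff.1 hv).1
    have hne : p v ≠ p j := fun h => hjd (hp h ▸ hv)
    by_cases h : p i < p v
    · by_cases h' : p v < p j
      · rw [if_pos h, if_pos ⟨h, h'⟩]
        exact (hW i hi v (hS'S hv') h).1 (by omega)
      · rw [if_pos h, if_neg fun hh => h' hh.2]
        exact (hW i hi v (hS'S hv') h).2 (by omega)
    · rw [if_neg h, if_neg fun hh => h hh.1]
  have h2 : ∏ u ∈ T, (if p u < p j then W u j else 1) =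
      z ^ #{k ∈ T | p i < p k ∧ p k < p j} := by
    rw [← prod_const, prod_filter]
    refine prod_congr rfl fun u hu => ?_
    have hne : p u ≠ p i := fun h => hiT (hp h ▸ hu)
    by_cases h : p u < p j
    · by_cases h' : p i < p u
      · rw [if_pos h, if_pos ⟨h', h⟩]
        exact (hW u (hS'S (hT hu)) j hj h).1 (by omega)
      · rw [if_pos h, if_neg fun hh => h' hh.1]
        exact (hW u (hS'S (hT hu)) j hj h).2 (by omega)
    · rw [if_neg h, if_neg fun hh => h hh.2]
  have h3 : #{k ∈ S' | p i < p k ∧ p k < p j} =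
      #{k ∈ S' \ T | p i < p k ∧ p k < p j} + #{k ∈ T | p i < p k ∧ p k < p j} := by
    rw [← card_union_of_disjoint (disjoint_filter_filter sdiff_disjoint), ← filter_union,
      sdiff_union_of_subset hT]
  rw [h1, h2, h3, pow_add, cutWeight]
  ring

theorem cutWeight_congr {W' : ι → ι → R} {T : Finset ι}
    (h : ∀ u ∈ T, ∀ v ∈ S, v ∉ T → W u v = W' u v) : cutWeight p W S T = cutWeight p W' S T := by
  refine prod_congr rfl fun u hu => prod_congr rfl fun v hv => ?_
  rw [mem_sdiff] at hv
  rw [h u hu v hv.1 hv.2]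

/-- Resolution of one pair of cells at the maximal distance. -/
theorem twoLetter_resolve (hp : Function.Injective p) (hW : IsKernel p z D W S) (hi : i ∈ S)
    (hj : j ∈ S) (hij : i ≠ j) (hD : p j = p i + D) (x y : R) :
    twoLetter p W x y S = twoLetter p (fun u v => if u = i ∧ v = j then 1 else W u v) x y S +
      (W i j - 1) * (x * y) * z ^ #{k ∈ (S.erase i).erase j | p i < p k ∧ p k < p j} *
        twoLetter p W x y ((S.erase i).erase j) := by
  set W' : ι → ι → R := fun u v => if u = i ∧ v = j then 1 else W u v with hW'
  have hij' : p i < p j := by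
    refine lt_of_le_of_ne (by omega) fun h => hij (hp h)
  have hker : IsKernel p z D W' S := by
    intro u hu v hv huv
    have := hW u hu v hv huv
    by_cases h : u = i ∧ v = j
    · obtain ⟨rfl, rfl⟩ := h
      exact ⟨fun h => by omega, fun h => by omega⟩
    · simpa [hW', h] using this
  set S' := (S.erase i).erase j with hS'
  have hS'S : S' ⊆ S := (erase_subset _ _).trans (erase_subset _ _)
  have hjS' : j ∉ S' := notMem_erase _ _
  have hiS' : i ∉ S' := fun h => (mem_erase.1 (mem_of_mem_erase h)).1 rfl
  rw [← sub_eq_iff_eq_add']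
  simp only [twoLetter]
  rw [← sum_sub_distrib, mul_sum]
  -- The changed value `W i j` matters only for fillings in which `i`, `j` is an inversion.
  have h0 : ∀ T ∈ S.powerset, ¬ (i ∈ T ∧ j ∉ T) → x ^ #T * y ^ #(S \ T) * cutWeight p W S T -
      x ^ #T * y ^ #(S \ T) * cutWeight p W' S T = 0 := by
    intro T hT h
    rw [cutWeight_congr (W' := W') fun u hu v hv hvT => ?_, sub_self]
    simp only [hW']
    rw [if_neg]
    rintro ⟨rfl, rfl⟩
    exact h ⟨hu, hvT⟩
  rw [← sum_filter_of_ne (p := fun T => i ∈ T ∧ j ∉ T)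
    fun T hT h => by_contra fun h' => h (h0 T hT h')]
  symm
  refine sum_bij' (fun T _ => insert i T) (fun T _ => T.erase i) ?_ ?_ ?_ ?_ ?_
  · intro T hT
    rw [mem_powerset] at hT
    rw [mem_filter, mem_powerset]
    refine ⟨insert_subset hi (hT.trans hS'S), mem_insert_self _ _, ?_⟩
    rw [mem_insert, not_or]
    exact ⟨hij.symm, fun h => hjS' (hT h)⟩
  · intro T hT
    rw [mem_filter, mem_powerset] at hT
    rw [mem_powerset, hS']
    intro k hk
    rw [mem_erase] at hk
    rw [mem_erase, mem_erase]
    exact ⟨fun h => hT.2.2 (h ▸ hk.2), hk.1, hT.1 hk.2⟩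
  · intro T hT
    rw [mem_powerset] at hT
    exact erase_insert fun h => hiS' (hT h)
  · intro T hT
    rw [mem_filter] at hT
    exact insert_erase hT.2.1
  · intro T hT
    rw [mem_powerset] at hT
    have hiT : i ∉ T := fun h => hiS' (hT h)
    have hjT : j ∉ T := fun h => hjS' (hT h)
    rw [cutWeight_insert hp hW hi hj hij hD hT, cutWeight_insert hp hker hi hj hij hD hT]
    have h1 : W' i j = 1 := by simp [hW']
    have h2 : cutWeight p W' S' T = cutWeight p W S' T := by
      refine cutWeight_congr fun u hu v hv _ => ?_
      simp only [hW']
      rw [if_neg]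
      rintro ⟨rfl, -⟩
      exact hiT hu
    have h3 : #(S \ insert i T) = #(S' \ T) + 1 := by
      have : S \ insert i T = insert j (S' \ T) := by
        ext k
        simp only [hS', mem_sdiff, mem_insert, mem_erase]
        by_cases hk : k = j
        · subst hk
          simp [hj, hij.symm, hjT]
        · simp [hk]
          tauto
      rw [this, card_insert_of_notMem fun h => hjS' (mem_sdiff.1 h).1]
    rw [h1, h2, h3, card_insert_of_notMem hiT]
    ring

open Classical in
-- Double induction, on the critical distance `D` and on the number of pairs at this distance whose
-- weight is not `1`. Resolving such a pair leaves two generating functions with fewer such pairs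
-- and the symmetric factor `x * y`. At `D = 0` all weights are `1` and the sum is `(x + y) ^ #S`.
theorem twoLetter_comm (hp : Function.Injective p) (x y : R) :
    ∀ (D : ℕ) (n : ℕ) (W : ι → ι → R) (S : Finset ι), IsKernel p z D W S →
      #{e ∈ S ×ˢ S | e.1 ≠ e.2 ∧ p e.2 = p e.1 + D ∧ W e.1 e.2 ≠ 1} = n →
      twoLetter p W x y S = twoLetter p W y x S := by
  intro D
  induction D with
  | zero =>
    intro n W S hW _
    have h1 : ∀ T ⊆ S, cutWeight p W S T = 1 := by
      intro T hT
      refine prod_eq_one fun u hu => prod_eq_one fun v hv => ?_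
      split_ifs with h
      · exact (hW u (hT hu) v (mem_sdiff.1 hv).1 h).2 (by simpa using h)
      · rfl
    have h2 : ∀ x y : R, twoLetter p W x y S = (x + y) ^ #S := by
      intro x y
      have := prod_add (fun _ : ι => x) (fun _ => y) S
      simp only [prod_const] at this
      rw [this, twoLetter]
      refine sum_congr rfl fun T hT => ?_
      rw [h1 T (mem_powerset.1 hT), mul_one]
    rw [h2, h2, add_comm]
  | succ D ihD =>
    intro n
    induction n using Nat.strong_induction_on with
    | _ n ih =>
    intro W S hW hn
    rcases eq_empty_or_nonempty
      {e ∈ S ×ˢ S | e.1 ≠ e.2 ∧ p e.2 = p e.1 + (D + 1 : ℕ) ∧ W e.1 e.2 ≠ 1} with h | ⟨⟨i, j⟩, he⟩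
    -- With no nontrivial pair left at distance `D + 1`, the weight is also a kernel for `D`.
    · refine ihD _ W S ?_ rfl
      intro u hu v hv huv
      refine ⟨fun h' => (hW u hu v hv huv).1 (by push_cast; omega), fun h' => ?_⟩
      by_cases h'' : p v = p u + (D + 1 : ℕ)
      · by_contra hne
        have : (u, v) ∈ ({e ∈ S ×ˢ S | e.1 ≠ e.2 ∧ p e.2 = p e.1 + (D + 1 : ℕ) ∧
            W e.1 e.2 ≠ 1} : Finset (ι × ι)) := by
          rw [mem_filter, mem_product]
          exact ⟨⟨hu, hv⟩, fun h => by simp only at h; subst h; exact lt_irrefl _ huv, h'', hne⟩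
        rw [h] at this
        exact notMem_empty _ this
      · exact (hW u hu v hv huv).2 (by push_cast at h'' ⊢; omega)
    · have he' := he
      simp only [mem_filter, mem_product] at he'
      obtain ⟨⟨hi, hj⟩, hij, hD, hne⟩ := he'
      rw [twoLetter_resolve hp hW hi hj hij hD x y, twoLetter_resolve hp hW hi hj hij hD y x,
        mul_comm x y]
      congr 1
      · refine ih _ ?_ _ S ?_ rfl
        · rw [← hn]
          refine card_lt_card ((ssubset_iff_of_subset ?_).2 ⟨(i, j), he, ?_⟩)
          · intro e
            simp only [mem_filter]
            rintro ⟨h1, h2, h3, h4⟩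
            refine ⟨h1, h2, h3, fun h => h4 ?_⟩
            split_ifs
            · rfl
            · exact h
          · simp
        · intro u hu v hv huv
          have := hW u hu v hv huv
          by_cases h : u = i ∧ v = j
          · obtain ⟨rfl, rfl⟩ := h
            exact ⟨fun h => by omega, fun h => by omega⟩
          · simpa [h] using this
      · congr 1
        refine ih _ ?_ W _ (hW.mono ((erase_subset _ _).trans (erase_subset _ _))) rfl
        rw [← hn]
        refine card_lt_card ((ssubset_iff_of_subset ?_).2 ⟨(i, j), he, ?_⟩)
        · intro e
          simp only [mem_filter, mem_product, mem_erase]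
          tauto
        · simp

theorem sum_cutWeight_comm (hp : Function.Injective p) (hW : IsKernel p z D W S) (k : ℕ) :
    ∑ T ∈ S.powerset with #T = k, cutWeight p W S T =
      ∑ T ∈ S.powerset with #(S \ T) = k, cutWeight p W S T := by
  have hW' : IsKernel p (Polynomial.C z) D (fun u v => Polynomial.C (W u v)) S := by
    intro u hu v hv huv
    obtain ⟨h1, h2⟩ := hW u hu v hv huv
    exact ⟨fun h => congrArg _ (h1 h), fun h => (congrArg _ (h2 h)).trans Polynomial.C_1⟩
  -- With the variables `X` and `1`, the coefficient of `X ^ k` counts fillings with `k` larger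
  -- letters on one side and `k` smaller letters on the other.
  have key := twoLetter_comm hp (Polynomial.X : Polynomial R) 1 D _ _ S hW' rfl
  have hcut : ∀ T, cutWeight p (fun u v => Polynomial.C (W u v)) S T =
      Polynomial.C (cutWeight p W S T) := by
    intro T
    simp only [cutWeight, map_prod]
    refine prod_congr rfl fun u _ => prod_congr rfl fun v _ => ?_
    split_ifs <;> simp
  have := congrArg (Polynomial.coeff · k) key
  simp only [twoLetter, one_pow, mul_one, one_mul, Polynomial.finsetSum_coeff, hcut,
    mul_comm _ (Polynomial.C _), Polynomial.coeff_C_mul_X_pow] at this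
  rw [sum_filter, sum_filter]
  simpa [eq_comm] using this

end TwoLetters

/-! ### Symmetry for general fillings -/

section Fillings

variable {C R : Type*} [Fintype C] [DecidableEq C] [CommRing R]

/-- The product of `W c d` over the inversions `c, d` of a filling, i.e. `rel d c` is true and `c`
comes before `d`. -/
def relWeight (p : C → ℤ) (W : C → C → R) (rel : C → C → Prop) [DecidableRel rel] : R :=
  ∏ c, ∏ d, if p c < p d ∧ rel d c then W c d else 1

/-- All fillings of weight `α`. -/
noncomputable def weightFillings (C : Type*) [Fintype C] [DecidableEq C] (α : ℕ →₀ ℕ) : Finset (C → ℕ) :=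
  (Fintype.piFinset fun _ => α.support).filter fun σ => ∑ c, Finsupp.single (σ c) 1 = α

theorem sum_single_apply (σ : C → ℕ) (k : ℕ) :
    (∑ c, Finsupp.single (σ c) 1 : ℕ →₀ ℕ) k = #{c | σ c = k} := by
  rw [Finsupp.finsetSum_apply, card_filter]
  exact sum_congr rfl fun c _ => by rw [Finsupp.single_apply]

theorem mem_weightFillings {α : ℕ →₀ ℕ} {σ : C → ℕ} :
    σ ∈ weightFillings C α ↔ ∀ k, #{c | σ c = k} = α k := by
  rw [weightFillings, mem_filter, Fintype.mem_piFinset, DFunLike.ext_iff]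
  simp_rw [sum_single_apply]
  refine ⟨fun h => h.2, fun h => ⟨fun c => ?_, h⟩⟩
  rw [Finsupp.mem_support_iff, ← h (σ c), card_ne_zero]
  exact ⟨c, by simp⟩

end Fillings

end Macdonald

namespace Macdonald

section Fillings

variable {C R : Type*} [Fintype C] [DecidableEq C] [CommRing R]

/-- The fillings of weight `α` sorted by the cells that hold the letters `i` and `i + 1`. -/
theorem sum_weightFillings_eq (i : ℕ) {α β : ℕ →₀ ℕ} (hi : β i = α i + α (i + 1))
    (hi' : β (i + 1) = 0) (hk : ∀ k, k ≠ i → k ≠ i + 1 → β k = α k) (F : (C → ℕ) → R) :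
    ∑ σ ∈ weightFillings C α, F σ = ∑ τ ∈ weightFillings C β,
      ∑ T ∈ ({c | τ c = i} : Finset C).powerset with #T = α (i + 1),
        F fun c => if c ∈ T then i + 1 else τ c := by
  have hne : ∀ τ ∈ weightFillings C β, ∀ c, τ c ≠ i + 1 := by
    intro τ hτ c hc
    have := (mem_weightFillings.1 hτ) (i + 1)
    rw [hi', card_eq_zero] at this
    exact notMem_empty c (this ▸ mem_filter.2 ⟨mem_univ c, hc⟩)
  rw [sum_sigma']
  refine sum_bij' (fun σ _ => ⟨fun c => if σ c = i + 1 then i else σ c, ({c | σ c = i + 1} : Finset C)⟩)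
    (fun x _ => fun c => if c ∈ x.2 then i + 1 else x.1 c) ?_ ?_ ?_ ?_ ?_
  · intro σ hσ
    rw [mem_weightFillings] at hσ
    simp only [mem_sigma, mem_filter, mem_powerset, mem_weightFillings]
    refine ⟨fun k => ?_, fun c hc => ?_, hσ (i + 1)⟩
    · rcases eq_or_ne k (i + 1) with rfl | h1
      · rw [hi', card_eq_zero, filter_eq_empty_iff]
        intro c _
        split_ifs with h
        · omega
        · exact h
      · rcases eq_or_ne k i with rfl | h2
        · rw [hi, ← hσ, ← hσ, ← card_union_of_disjoint]
          · congr 1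
            ext c
            simp only [mem_filter, mem_univ, true_and, mem_union]
            split_ifs with h <;> omega
          · rw [disjoint_filter]
            intro c _ h
            omega
        · rw [hk k h2 h1, ← hσ]
          congr 1
          ext c
          simp only [mem_filter, mem_univ, true_and]
          split_ifs with h <;> omega
    · simp only [mem_filter, mem_univ, true_and] at hc ⊢
      rw [if_pos hc]
  · rintro ⟨τ, T⟩ hx
    simp only [mem_sigma, mem_filter, mem_powerset] at hx
    obtain ⟨hτ, hT, hcard⟩ := hx
    have hne' := hne τ hτ
    rw [mem_weightFillings] at hτ
    have hT' : ∀ c ∈ T, τ c = i := fun c hc => (mem_filter.1 (hT hc)).2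
    rw [mem_weightFillings]
    intro k
    rcases eq_or_ne k (i + 1) with rfl | h1
    · rw [← hcard]
      congr 1
      ext c
      simp only [mem_filter, mem_univ, true_and]
      by_cases h : c ∈ T
      · simp [h]
      · simp [h, hne' c]
    · rcases eq_or_ne k i with rfl | h2
      · have h3 : ({c | (if c ∈ T then k + 1 else τ c) = k} : Finset C) =
            ({c | τ c = k} : Finset C) \ T := by
          ext c
          simp only [mem_filter, mem_univ, true_and, mem_sdiff]
          by_cases h : c ∈ T <;> simp [h]
        rw [h3, card_sdiff_of_subset hT, hτ, hi, hcard]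
        omega
      · rw [← hk k h2 h1, ← hτ]
        congr 1
        ext c
        simp only [mem_filter, mem_univ, true_and]
        by_cases h : c ∈ T
        · simp only [h, if_true, hT' c h]
          omega
        · simp [h]
  · intro σ _
    funext c
    by_cases h : σ c = i + 1 <;> simp [h]
  · rintro ⟨τ, T⟩ hx
    simp only [mem_sigma, mem_filter, mem_powerset] at hx
    obtain ⟨hτ, hT, hcard⟩ := hx
    have hne' := hne τ hτ
    have hT' : ∀ c ∈ T, τ c = i := fun c hc => (mem_filter.1 (hT hc)).2
    have h1 : (fun c => if (if c ∈ T then i + 1 else τ c) = i + 1 then i else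
        if c ∈ T then i + 1 else τ c) = τ := by
      funext c
      by_cases h : c ∈ T
      · simp [h, hT' c h]
      · simp [h, hne' c]
    have h2 : ({c | (if c ∈ T then i + 1 else τ c) = i + 1} : Finset C) = T := by
      ext c
      by_cases h : c ∈ T
      · simp [h]
      · simp [h, hne' c]
    simp only [h1, h2]
  · intro σ _
    congr 1
    funext c
    by_cases h : σ c = i + 1 <;> simp [h]

/-- Since `i` and `i + 1` are adjacent, they compare in the same way with every other letter.
Distributing them changes only comparisons among the cells that hold one of the two. -/
theorem relWeight_spread {p : C → ℤ} {W : C → C → R} {i : ℕ} {τ : C → ℕ} (hτ : ∀ c, τ c ≠ i + 1)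
    {T : Finset C} (hT : T ⊆ ({c | τ c = i} : Finset C)) :
    relWeight p W (fun d c => (if d ∈ T then i + 1 else τ d) < if c ∈ T then i + 1 else τ c) =
      relWeight p W (fun d c => τ d < τ c) * cutWeight p W {c | τ c = i} T := by
  set S : Finset C := {c | τ c = i} with hS
  have hcut : cutWeight p W S T =
      ∏ c, ∏ d, if p c < p d ∧ c ∈ T ∧ d ∈ S \ T then W c d else 1 := by
    rw [cutWeight, ← prod_subset (subset_univ T)]
    · refine prod_congr rfl fun c hc => ?_
      rw [← prod_subset (subset_univ (S \ T))]
      · refine prod_congr rfl fun d hd => ?_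
        simp [hc, hd]
      · intro d _ hd
        rw [if_neg fun h => hd h.2.2]
    · intro c _ hc
      exact prod_eq_one fun d _ => if_neg fun h => hc h.2.1
  rw [hcut, relWeight, relWeight, ← prod_mul_distrib]
  refine prod_congr rfl fun c _ => ?_
  rw [← prod_mul_distrib]
  refine prod_congr rfl fun d _ => ?_
  have hTS : ∀ c ∈ T, τ c = i := fun c hc => (mem_filter.1 (hT hc)).2
  have hSd : d ∈ S ↔ τ d = i := by simp [hS]
  have h1 := hτ c
  have h2 := hτ d
  by_cases hp : p c < p d
  swap
  · simp [hp]
  simp only [hp, true_and, mem_sdiff, hSd]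
  by_cases hc : c ∈ T
  · have := hTS c hc
    by_cases hd : d ∈ T
    · have := hTS d hd
      simp [*]
    · simp only [hc, hd, if_true, if_false, not_false_eq_true, and_true, true_and]
      by_cases hd' : τ d = i
      · rw [if_pos (by omega), if_neg (by omega), if_pos hd', one_mul]
      · rw [if_neg hd', mul_one]
        congr 1
        exact propext ⟨fun h => by omega, fun h => by omega⟩
  · by_cases hd : d ∈ T
    · have := hTS d hd
      simp only [hc, hd, if_true, if_false, false_and, mul_one]
      congr 1
      exact propext ⟨fun h => by omega, fun h => by omega⟩
    · simp [hc, hd]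

/-- With `i` and `i + 1` identified, both sums run over the same fillings `τ`, and for each `τ` the
claim is the two-letter symmetry on the cells where `τ` equals `i`. -/
theorem sum_relWeight_swap {p : C → ℤ} (hp : Function.Injective p) {W : C → C → R} {z : R} {D : ℕ}
    (hW : IsKernel p z D W univ) (i : ℕ) (α : ℕ →₀ ℕ) :
    ∑ σ ∈ weightFillings C (α.mapDomain (Equiv.swap i (i + 1))),
        relWeight p W (fun d c => σ d < σ c) =
      ∑ σ ∈ weightFillings C α, relWeight p W (fun d c => σ d < σ c) := by
  set α' := α.mapDomain (Equiv.swap i (i + 1)) with hα'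
  have hα'k : ∀ k, α' k = α (Equiv.swap i (i + 1) k) := by
    intro k
    have := Finsupp.mapDomain_apply (Equiv.swap i (i + 1)).injective α (Equiv.swap i (i + 1) k)
    rwa [Equiv.swap_apply_self] at this
  set β : ℕ →₀ ℕ := α.erase (i + 1) + Finsupp.single i (α (i + 1)) with hβ
  have h1 : β i = α i + α (i + 1) := by
    simp [hβ, Finsupp.erase_ne (show i ≠ i + 1 by omega)]
  have h2 : β (i + 1) = 0 := by
    simp [hβ]
  have h3 : ∀ k, k ≠ i → k ≠ i + 1 → β k = α k := by
    intro k hk hk'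
    simp [hβ, Finsupp.erase_ne hk', Finsupp.single_eq_of_ne hk]
  have hτ : ∀ τ ∈ weightFillings C β, ∀ c, τ c ≠ i + 1 := by
    intro τ hτ c hc
    have := (mem_weightFillings.1 hτ) (i + 1)
    rw [h2, card_eq_zero] at this
    exact notMem_empty c (this ▸ mem_filter.2 ⟨mem_univ c, hc⟩)
  rw [sum_weightFillings_eq i h1 h2 h3, sum_weightFillings_eq (β := β) i _ h2 _]
  rotate_left
  · rw [hα'k, hα'k, Equiv.swap_apply_left, Equiv.swap_apply_right, h1, add_comm]
  · intro k hk hk'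
    rw [hα'k, Equiv.swap_apply_of_ne_of_ne hk hk', h3 k hk hk']
  refine sum_congr rfl fun τ hτ' => ?_
  have hcard : #({c | τ c = i} : Finset C) = α i + α (i + 1) :=
    (mem_weightFillings.1 hτ' i).trans h1
  have key : ∀ T ∈ ({c | τ c = i} : Finset C).powerset,
      relWeight p W (fun d c => (if d ∈ T then i + 1 else τ d) < if c ∈ T then i + 1 else τ c) =
      relWeight p W (fun d c => τ d < τ c) * cutWeight p W {c | τ c = i} T :=
    fun T hT => relWeight_spread (hτ τ hτ') (mem_powerset.1 hT)
  rw [sum_congr rfl fun T hT => key T (mem_filter.1 hT).1,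
    sum_congr rfl fun T hT => key T (mem_filter.1 hT).1, ← mul_sum, ← mul_sum]
  congr 1
  rw [sum_cutWeight_comm hp (hW.mono (subset_univ _))]
  refine sum_congr (filter_congr fun T hT => ?_) fun _ _ => rfl
  rw [mem_powerset] at hT
  rw [card_sdiff_of_subset hT, hcard, hα'k, Equiv.swap_apply_right]
  have := card_le_card hT
  omega

end Fillings

/-! ### From adjacent transpositions to all permutations -/

section Permutations

/-- A function of exponents that is invariant under adjacent transpositions is symmetric. -/
theorem invariant_of_adjacent_swaps {A : Type*} (f : (ℕ →₀ ℕ) → A)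
    (hf : ∀ i α, f (α.mapDomain (Equiv.swap i (i + 1))) = f α) (e : Equiv.Perm ℕ) (α : ℕ →₀ ℕ) :
    f (α.mapDomain e) = f α := by
  have hfin : ∀ (n : ℕ) (g : Equiv.Perm (Fin n)) (α : ℕ →₀ ℕ),
      f (α.mapDomain (g.viaFintypeEmbedding Fin.valEmbedding)) = f α := by
    intro n g
    rcases n with _ | n
    · intro α
      congr 1
      convert! Finsupp.mapDomain_id
    have hg : g ∈ Submonoid.closure (Set.range fun i : Fin n => Equiv.swap i.castSucc i.succ) := by
      rw [Equiv.Perm.mclosure_swap_castSucc_succ]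
      trivial
    induction hg using Submonoid.closure_induction with
    | mem x hx =>
      obtain ⟨i, rfl⟩ := hx
      intro α
      have : ((Equiv.swap i.castSucc i.succ).viaFintypeEmbedding Fin.valEmbedding : Equiv.Perm ℕ) =
          Equiv.swap (i : ℕ) (i + 1) := by
        ext k
        by_cases hk : k ∈ Set.range (Fin.valEmbedding (n := n + 1))
        · obtain ⟨x, rfl⟩ := hk
          rw [Equiv.Perm.viaFintypeEmbedding_apply_image]
          simp only [Fin.valEmbedding_apply, Equiv.swap_apply_def, Fin.ext_iff, Fin.val_castSucc,
            Fin.val_succ]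
          split_ifs <;> simp
        · rw [Equiv.Perm.viaFintypeEmbedding_apply_notMem_range _ _ hk, Equiv.swap_apply_of_ne_of_ne]
          · rintro rfl
            exact hk ⟨i.castSucc, rfl⟩
          · rintro rfl
            exact hk ⟨i.succ, rfl⟩
      rw [this, hf]
    | one =>
      intro α
      congr 1
      convert! Finsupp.mapDomain_id
      funext k
      by_cases hk : k ∈ Set.range (Fin.valEmbedding (n := n + 1))
      · obtain ⟨x, rfl⟩ := hk
        rw [Equiv.Perm.viaFintypeEmbedding_apply_image]
        rfl
      · rw [Equiv.Perm.viaFintypeEmbedding_apply_notMem_range _ _ hk]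
        rfl
    | mul x y _ _ hx hy =>
      intro α
      have : ((x * y).viaFintypeEmbedding Fin.valEmbedding : Equiv.Perm ℕ) =
          x.viaFintypeEmbedding Fin.valEmbedding * y.viaFintypeEmbedding Fin.valEmbedding := by
        ext k
        rw [Equiv.Perm.mul_apply]
        by_cases hk : k ∈ Set.range (Fin.valEmbedding (n := n + 1))
        · obtain ⟨x, rfl⟩ := hk
          simp only [Equiv.Perm.viaFintypeEmbedding_apply_image]
          rfl
        · simp only [Equiv.Perm.viaFintypeEmbedding_apply_notMem_range _ _ hk]
      rw [this, Equiv.Perm.coe_mul, Finsupp.mapDomain_comp, hx, hy]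
  -- `n` bounds the support of `α` and its image, so on the support `e` agrees with a permutation of
  -- `Fin n`, to which generation by adjacent transpositions applies.
  set n := (α.support ∪ α.support.image e).sup id + 1 with hn
  have hlt : ∀ k ∈ α.support, k < n ∧ e k < n := by
    intro k hk
    refine ⟨Nat.lt_succ_of_le (le_sup (f := id) (mem_union_left _ hk)), Nat.lt_succ_of_le
      (le_sup (f := id) (mem_union_right _ (mem_image_of_mem e hk)))⟩
  have hex : ∃ g : Equiv.Perm (Fin n), ∀ x : Fin n, (x : ℕ) ∈ α.support → (g x : ℕ) = e x := by
    let φ : {x : Fin n // (x : ℕ) ∈ α.support} ↪ Fin n :=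
      ⟨fun x => ⟨e x.1, (hlt _ x.2).2⟩, fun x y h => by
        have := congrArg Fin.val h
        simp only [e.apply_eq_iff_eq] at this
        exact Subtype.ext (Fin.ext this)⟩
    classical
    refine ⟨(Equiv.ofInjective φ φ.injective).extendSubtype, fun x hx => ?_⟩
    exact congrArg Fin.val
      (Equiv.extendSubtype_apply_of_mem (Equiv.ofInjective φ φ.injective) x hx)
  obtain ⟨g, hg⟩ := hex
  rw [← hfin n g α]
  congr 1
  refine Finsupp.mapDomain_congr fun k hk => ?_
  have := Equiv.Perm.viaFintypeEmbedding_apply_image g Fin.valEmbedding ⟨k, (hlt k hk).1⟩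
  simp only [Fin.valEmbedding_apply] at this
  rw [this, hg _ hk]

end Permutations
end Macdonald

namespace Macdonald

/-! ### Symmetric functions and triangular families -/

section SymmetricFunctions

theorem coeff_renameEquiv (e : Equiv.Perm ℕ) (f : PS) (α : ℕ →₀ ℕ) :
    MvPowerSeries.coeff (α.mapDomain e) (MvPowerSeries.renameEquiv QT e f) =
      MvPowerSeries.coeff α f := by
  have := MvPowerSeries.coeff_embDomain_rename e.toEmbedding f α
  rwa [Finsupp.embDomain_eq_mapDomain] at this

theorem mapDomain_symm_mapDomain (e : Equiv.Perm ℕ) (α : ℕ →₀ ℕ) :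
    (α.mapDomain e.symm).mapDomain e = α := by
  rw [← Finsupp.mapDomain_comp]
  simp

theorem coeff_mapDomain_of_mem {f : PS} (hf : f ∈ SymFun) (e : Equiv.Perm ℕ) (α : ℕ →₀ ℕ) :
    MvPowerSeries.coeff (α.mapDomain e) f = MvPowerSeries.coeff α f := by
  conv_lhs => rw [← hf.1 e]
  exact coeff_renameEquiv e f α

theorem mem_symFun_of_coeff {f : PS}
    (hf : ∀ i α, MvPowerSeries.coeff (α.mapDomain (Equiv.swap i (i + 1))) f =
      MvPowerSeries.coeff α f)
    (N : ℕ) (hN : ∀ α : ℕ →₀ ℕ, MvPowerSeries.coeff α f ≠ 0 → α.degree ≤ N) : f ∈ SymFun := by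
  refine ⟨fun e => ?_, N, hN⟩
  ext α
  rw [← mapDomain_symm_mapDomain e α, coeff_renameEquiv]
  exact (invariant_of_adjacent_swaps (fun α => MvPowerSeries.coeff α f) hf e _).symm

/-- The exponent of the monomial `x ^ μ`. -/
noncomputable def partsExp (mu : YoungDiagram) : ℕ →₀ ℕ :=
  Finsupp.onFinset (range (mu.colLen 0)) mu.rowLen fun i hi => by
    rw [mem_range, ← YoungDiagram.mem_iff_lt_colLen, YoungDiagram.mem_iff_lt_rowLen]
    exact Nat.pos_of_ne_zero hi

@[simp]
theorem partsExp_apply (mu : YoungDiagram) (i : ℕ) : partsExp mu i = mu.rowLen i := rfl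

theorem eq_of_rowLen_eq {mu nu : YoungDiagram} (h : ∀ i, mu.rowLen i = nu.rowLen i) : mu = nu := by
  apply YoungDiagram.ext
  ext ⟨i, j⟩
  rw [YoungDiagram.mem_cells, YoungDiagram.mem_cells, YoungDiagram.mem_iff_lt_rowLen,
    YoungDiagram.mem_iff_lt_rowLen, h]

theorem support_partsExp (mu : YoungDiagram) : (partsExp mu).support = range (mu.colLen 0) := by
  ext i
  rw [Finsupp.mem_support_iff, partsExp_apply, mem_range, ← YoungDiagram.mem_iff_lt_colLen,
    YoungDiagram.mem_iff_lt_rowLen, Nat.pos_iff_ne_zero]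

/-- The number of cells in the first `k` rows. -/
theorem card_filter_row_lt (mu : YoungDiagram) (k : ℕ) :
    #{c ∈ mu.cells | c.1 < k} = ∑ i ∈ range k, mu.rowLen i := by
  rw [card_eq_sum_card_fiberwise (f := Prod.fst) (t := range k)]
  · refine sum_congr rfl fun i hi => ?_
    rw [YoungDiagram.rowLen_eq_card, YoungDiagram.row, filter_filter]
    congr 1
    ext c
    simp only [mem_filter, and_congr_right_iff]
    rw [mem_range] at hi
    exact fun _ => ⟨fun h => h.2, fun h => ⟨by omega, h⟩⟩
  · intro c hc
    simpa using (mem_filter.1 hc).2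

theorem sum_range_rowLen (mu : YoungDiagram) {k : ℕ} (hk : mu.colLen 0 ≤ k) :
    ∑ i ∈ range k, mu.rowLen i = mu.card := by
  rw [← card_filter_row_lt, filter_true_of_mem]
  rintro ⟨i, j⟩ hc
  rw [YoungDiagram.mem_cells, YoungDiagram.mem_iff_lt_colLen] at hc
  exact hc.trans_le ((mu.colLen_anti 0 j (Nat.zero_le _)).trans hk)

theorem degree_partsExp (mu : YoungDiagram) : (partsExp mu).degree = mu.card := by
  rw [Finsupp.degree_apply, support_partsExp, ← sum_range_rowLen mu le_rfl]
  rfl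

/-- The diagram with prescribed row lengths. -/
def ofAntitone (a : ℕ →₀ ℕ) (ha : Antitone a) : YoungDiagram where
  cells := (a.support ×ˢ range (a 0)).filter fun c => c.2 < a c.1
  isLowerSet := by
    rintro ⟨i, j⟩ ⟨i', j'⟩ ⟨hi, hj⟩ h
    simp only [coe_filter, mem_product, Finsupp.mem_support_iff, mem_range,
      Set.mem_ofPred_eq] at h ⊢
    have hi' : i' ≤ i := hi
    have hj' : j' ≤ j := hj
    have h1 := ha hi'
    have h2 := ha (Nat.zero_le i')
    omega

theorem partsExp_ofAntitone (a : ℕ →₀ ℕ) (ha : Antitone a) : partsExp (ofAntitone a ha) = a := by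
  ext i
  rw [partsExp_apply]
  refine eq_of_forall_lt_iff fun j => ?_
  rw [← YoungDiagram.mem_iff_lt_rowLen, ← YoungDiagram.mem_cells]
  simp only [ofAntitone, mem_filter, mem_product, Finsupp.mem_support_iff, mem_range]
  have := ha (Nat.zero_le i)
  omega

/-- Every exponent is a permutation of a partition. -/
theorem exists_mapDomain_eq_partsExp (α : ℕ →₀ ℕ) :
    ∃ (e : Equiv.Perm ℕ) (mu : YoungDiagram), α.mapDomain e = partsExp mu := by
  set n := α.support.sup id + 1 with hn
  have hlt : ∀ k, n ≤ k → α k = 0 := by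
    intro k hk
    by_contra h
    have := le_sup (f := id) (Finsupp.mem_support_iff.2 h)
    simp only [id] at this
    omega
  set σ : Equiv.Perm (Fin n) := Tuple.sort fun x : Fin n => OrderDual.toDual (α x) with hσ
  have hanti : ∀ x y : Fin n, x ≤ y → α (σ y) ≤ α (σ x) := fun x y h =>
    Tuple.monotone_sort (fun x : Fin n => OrderDual.toDual (α x)) h
  set e : Equiv.Perm ℕ := Equiv.Perm.viaFintypeEmbedding σ.symm Fin.valEmbedding with he
  have h1 : ∀ x : Fin n, α.mapDomain e x = α (σ x) := by
    intro x
    have h := Finsupp.mapDomain_apply e.injective α (σ x : ℕ)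
    have h' := Equiv.Perm.viaFintypeEmbedding_apply_image σ.symm Fin.valEmbedding (σ x)
    rw [← he] at h'
    simp only [Fin.valEmbedding_apply, Equiv.symm_apply_apply] at h'
    rwa [h'] at h
  have h2 : ∀ k, n ≤ k → α.mapDomain e k = 0 := by
    intro k hk
    have h := Finsupp.mapDomain_apply e.injective α k
    have h' := Equiv.Perm.viaFintypeEmbedding_apply_notMem_range σ.symm Fin.valEmbedding
      (b := k) (by rintro ⟨x, rfl⟩; exact absurd x.2 (not_lt.2 hk))
    rw [← he] at h'
    rw [h', hlt k hk] at h
    exact h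
  have h3 : Antitone (α.mapDomain e) := by
    intro x y hxy
    rcases lt_or_ge y n with hy | hy
    · have := hanti ⟨x, hxy.trans_lt hy⟩ ⟨y, hy⟩ hxy
      rwa [← h1, ← h1] at this
    · rw [h2 y hy]
      exact Nat.zero_le _
  exact ⟨e, ofAntitone _ h3, (partsExp_ofAntitone _ h3).symm⟩

theorem symFun_ext {f g : PS} (hf : f ∈ SymFun) (hg : g ∈ SymFun)
    (h : ∀ mu, MvPowerSeries.coeff (partsExp mu) f = MvPowerSeries.coeff (partsExp mu) g) :
    f = g := by
  ext α
  obtain ⟨e, mu, he⟩ := exists_mapDomain_eq_partsExp α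
  rw [← coeff_mapDomain_of_mem hf e, ← coeff_mapDomain_of_mem hg e, he, h]

/-- Expansion in a family that is triangular with respect to the rank function `rk`. -/
theorem exists_expansion (v : YoungDiagram → PS) (hv : ∀ mu, v mu ∈ SymFun)
    (rk : YoungDiagram → ℕ) (hdiag : ∀ mu, MvPowerSeries.coeff (partsExp mu) (v mu) ≠ 0)
    (le : YoungDiagram → YoungDiagram → Prop) (hle : ∀ rho lam,
      MvPowerSeries.coeff (partsExp rho) (v lam) ≠ 0 → le rho lam)
    (hrk : ∀ rho lam, le rho lam → rho = lam ∨ rk rho < rk lam)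
    (U : Finset YoungDiagram) (hU : ∀ lam ∈ U, ∀ rho, le rho lam → rho ∈ U) :
    ∀ g ∈ SymFun, (∀ rho, MvPowerSeries.coeff (partsExp rho) g ≠ 0 → rho ∈ U) →
      ∃ c : YoungDiagram →₀ QT, c.support ⊆ U ∧ g = c.sum fun lam a => a • v lam := by
  classical
  induction U using Finset.strongInduction with
  | H U ih =>
    intro g hg hgU
    rcases U.eq_empty_or_nonempty with rfl | hne
    · refine ⟨0, by simp, symFun_ext hg (by simp [SymFun.zero_mem]) fun mu => ?_⟩
      rw [Finsupp.sum_zero_index, map_zero]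
      by_contra h
      exact notMem_empty _ (hgU mu h)
    -- Elimination from the top: removing an element of maximal rank leaves `U` closed under `le`,
    -- because no other element of `U` lies above it.
    obtain ⟨lam, hlam, hmax⟩ := U.exists_max_image rk hne
    set a := MvPowerSeries.coeff (partsExp lam) g / MvPowerSeries.coeff (partsExp lam) (v lam)
      with ha
    have h1 : ∀ kap ∈ U.erase lam, ∀ rho, le rho kap → rho ∈ U.erase lam := by
      intro kap hkap rho hrho
      rw [mem_erase] at hkap ⊢
      refine ⟨?_, hU kap hkap.2 rho hrho⟩
      rintro rfl
      rcases hrk _ _ hrho with h | h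
      · exact hkap.1 h.symm
      · exact absurd (hmax kap hkap.2) (not_le.2 h)
    have h2 : ∀ rho, MvPowerSeries.coeff (partsExp rho) (g - a • v lam) ≠ 0 →
        rho ∈ U.erase lam := by
      intro rho hrho
      rw [mem_erase]
      rw [map_sub, map_smul, smul_eq_mul] at hrho
      constructor
      · rintro rfl
        rw [ha, div_mul_cancel₀ _ (hdiag _), sub_self] at hrho
        exact hrho rfl
      · by_cases h : MvPowerSeries.coeff (partsExp rho) g = 0
        · rw [h, zero_sub, neg_ne_zero] at hrho
          exact hU lam hlam rho (hle rho lam (right_ne_zero_of_mul hrho))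
        · exact hgU rho h
    obtain ⟨c, hc, hgc⟩ := ih (U.erase lam) (erase_ssubset hlam) h1 (g - a • v lam)
      (SymFun.sub_mem hg (SymFun.smul_mem (hv lam) a)) h2
    refine ⟨c + Finsupp.single lam a, ?_, ?_⟩
    · refine Finsupp.support_add.trans (union_subset (hc.trans (erase_subset _ _)) ?_)
      exact Finsupp.support_single_subset.trans (singleton_subset_iff.2 hlam)
    · rw [Finsupp.sum_add_index' (h := fun lam a => a • v lam) (fun _ => zero_smul _ _)
        (fun _ _ _ => add_smul _ _ _),
        Finsupp.sum_single_index (h := fun lam a => a • v lam) (zero_smul _ _), ← hgc,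
        sub_add_cancel]

/-- Diagrams of bounded size. -/
theorem finite_card_le (N : ℕ) : {mu : YoungDiagram | mu.card ≤ N}.Finite := by
  refine ((range N ×ˢ range N).powerset.finite_toSet.preimage
    (f := YoungDiagram.cells) fun x _ y _ h => YoungDiagram.ext h).subset ?_
  intro mu hmu
  rw [Set.mem_preimage, mem_coe, mem_powerset]
  rintro ⟨i, j⟩ hc
  have h1 : range (i + 1) ×ˢ {j} ⊆ mu.cells := by
    rintro ⟨i', j'⟩ h
    simp only [mem_product, mem_range, mem_singleton] at h
    obtain ⟨h, rfl⟩ := h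
    exact mu.up_left_mem (Nat.lt_succ_iff.1 h) le_rfl hc
  have h2 : {i} ×ˢ range (j + 1) ⊆ mu.cells := by
    rintro ⟨i', j'⟩ h
    simp only [mem_product, mem_range, mem_singleton] at h
    obtain ⟨rfl, h⟩ := h
    exact mu.up_left_mem le_rfl (Nat.lt_succ_iff.1 h) hc
  have h1' := card_le_card h1
  have h2' := card_le_card h2
  have hmu' : #mu.cells ≤ N := hmu
  simp only [card_product, card_range, card_singleton] at h1' h2'
  simp only [mem_product, mem_range]
  omega

end SymmetricFunctions
end Macdonald

namespace Macdonald

/-! ### Power sums generate -/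

section PowerSums

theorem coeff_powerSum (k : ℕ) (α : ℕ →₀ ℕ) [Decidable (∃ i, α = Finsupp.single i k)] :
    MvPowerSeries.coeff α (powerSum k) = if ∃ i, α = Finsupp.single i k then 1 else 0 := by
  rw [MvPowerSeries.coeff_apply, powerSum]
  congr

theorem powerSum_mem (k : ℕ) : powerSum k ∈ SymFun := by
  classical
  refine mem_symFun_of_coeff (fun i α => ?_) k fun α hα => ?_
  · rw [coeff_powerSum, coeff_powerSum]
    congr 1
    refine propext ⟨?_, ?_⟩
    · rintro ⟨j, hj⟩
      refine ⟨Equiv.swap i (i + 1) j, ?_⟩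
      have := congrArg (Finsupp.mapDomain (Equiv.swap i (i + 1))) hj
      rw [← Finsupp.mapDomain_comp, Finsupp.mapDomain_single] at this
      convert! this
      rw [← Equiv.coe_trans, Equiv.swap_swap]
      simp
    · rintro ⟨j, rfl⟩
      exact ⟨_, Finsupp.mapDomain_single⟩
  · rw [coeff_powerSum] at hα
    obtain ⟨i, rfl⟩ := (ite_ne_right_iff.1 hα).1
    rw [Finsupp.degree_single]

/-- The product of the power sums of the parts of `mu`. -/
noncomputable def powerSumProd (mu : YoungDiagram) : PS := ∏ i ∈ range (mu.colLen 0), powerSum (mu.rowLen i)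

theorem powerSumProd_mem (mu : YoungDiagram) : powerSumProd mu ∈ SymFun :=
  SymFun.prod_mem fun _ _ => powerSum_mem _

open Classical in
/-- The factorizations of `x ^ α` into monomials of the power sums of the parts of `mu`. -/
theorem coeff_powerSumProd (mu : YoungDiagram) (α : ℕ →₀ ℕ) :
    MvPowerSeries.coeff α (powerSumProd mu) =
      (#{l ∈ finsuppAntidiag (range (mu.colLen 0)) α |
        ∀ i ∈ range (mu.colLen 0), ∃ j, l i = Finsupp.single j (mu.rowLen i)} : QT) := by
  rw [powerSumProd, MvPowerSeries.coeff_prod, card_filter, Nat.cast_sum]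
  refine sum_congr rfl fun l _ => ?_
  simp_rw [coeff_powerSum]
  rw [prod_boole, Nat.cast_ite, Nat.cast_one, Nat.cast_zero]

theorem coeff_powerSumProd_self (mu : YoungDiagram) :
    MvPowerSeries.coeff (partsExp mu) (powerSumProd mu) ≠ 0 := by
  classical
  rw [coeff_powerSumProd, Nat.cast_ne_zero, card_ne_zero]
  set ℓ := mu.colLen 0
  have hzero : ∀ i, i ∉ range ℓ → mu.rowLen i = 0 := by
    intro i hi
    rw [← support_partsExp, Finsupp.notMem_support_iff] at hi
    exact hi
  refine ⟨Finsupp.onFinset (range ℓ) (fun i => Finsupp.single i (mu.rowLen i)) ?_, ?_⟩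
  · intro i hi
    by_contra h
    exact hi (by rw [hzero i h, Finsupp.single_zero])
  · rw [mem_filter, mem_finsuppAntidiag]
    refine ⟨⟨?_, Finsupp.support_onFinset_subset⟩, fun i _ => ⟨i, rfl⟩⟩
    ext k
    rw [Finsupp.finsetSum_apply, partsExp_apply]
    simp only [Finsupp.onFinset_apply, Finsupp.single_apply, sum_ite_eq']
    split_ifs with h
    · rfl
    · exact (hzero k h).symm

theorem filter_rowLen_gt (mu : YoungDiagram) (v : ℕ) :
    {i ∈ range (mu.colLen 0) | v < mu.rowLen i} = range (mu.colLen v) := by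
  ext i
  rw [mem_filter, mem_range, mem_range, ← YoungDiagram.mem_iff_lt_rowLen,
    YoungDiagram.mem_iff_lt_colLen, and_iff_right_iff_imp]
  exact fun h => h.trans_le (mu.colLen_anti 0 v (Nat.zero_le _))

/-- A monomial `x ^ ρ` of `p_λ` groups the parts of `λ` into those of `ρ`. So `ρ` has fewer parts,
or the grouping is a bijection. This is the triangularity that makes the products of power sums
span. -/
theorem eq_or_colLen_lt_of_coeff_powerSumProd {rho lam : YoungDiagram}
    (h : MvPowerSeries.coeff (partsExp rho) (powerSumProd lam) ≠ 0) :
    rho.card = lam.card ∧ (rho = lam ∨ rho.colLen 0 < lam.colLen 0) := by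
  classical
  rw [coeff_powerSumProd, Nat.cast_ne_zero, card_ne_zero] at h
  obtain ⟨l, hl⟩ := h
  rw [mem_filter, mem_finsuppAntidiag] at hl
  obtain ⟨⟨hsum, -⟩, hl⟩ := hl
  choose! j hj using hl
  set ℓ := lam.colLen 0 with hℓ
  have hsum' : ∑ i ∈ range ℓ, Finsupp.single (j i) (lam.rowLen i) = partsExp rho := by
    rw [← hsum]
    exact sum_congr rfl fun i hi => (hj i hi).symm
  have happ : ∀ k, ∑ i ∈ range ℓ, (if j i = k then lam.rowLen i else 0) = rho.rowLen k := by
    intro k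
    rw [← partsExp_apply, ← hsum', Finsupp.finsetSum_apply]
    exact sum_congr rfl fun i _ => by rw [Finsupp.single_apply]
  have hsub : range (rho.colLen 0) ⊆ (range ℓ).image j := by
    intro k hk
    rw [← support_partsExp, Finsupp.mem_support_iff, partsExp_apply, ← happ] at hk
    obtain ⟨i, hi, hne⟩ := exists_ne_zero_of_sum_ne_zero hk
    exact mem_image.2 ⟨i, hi, (ite_ne_right_iff.1 hne).1⟩
  refine ⟨?_, ?_⟩
  · rw [← degree_partsExp, ← hsum', map_sum, ← sum_range_rowLen lam le_rfl]
    exact sum_congr rfl fun i _ => Finsupp.degree_single _ _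
  have hcard := (card_le_card hsub).trans card_image_le
  rw [card_range, card_range] at hcard
  rcases hcard.lt_or_eq with hlt | heq
  · exact Or.inr hlt
  left
  have himg : (range ℓ).image j = range ℓ := by
    rw [heq] at hsub
    exact (eq_of_subset_of_card_le hsub card_image_le).symm
  have hinj : Set.InjOn j (range ℓ) := card_image_iff.1 (by rw [himg])
  have hrow : ∀ i ∈ range ℓ, rho.rowLen (j i) = lam.rowLen i := by
    intro i hi
    rw [← happ, sum_eq_single_of_mem i hi, if_pos rfl]
    intro i' hi' hne
    exact if_neg fun h => hne (hinj hi' hi h)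
  -- Equality of the multisets of parts is turned into equality of diagrams by counting the parts
  -- greater than `v`.
  have hcol : ∀ v, rho.colLen v = lam.colLen v := by
    intro v
    have h1 := filter_rowLen_gt rho v
    have h2 := filter_rowLen_gt lam v
    rw [heq] at h1
    rw [← card_range (rho.colLen v), ← card_range (lam.colLen v), ← h1, ← h2, ← himg, filter_image,
      card_image_of_injOn (hinj.mono fun x hx => (mem_filter.1 hx).1), himg]
    exact congrArg card (filter_congr fun i hi => by rw [hrow i hi])
  apply YoungDiagram.ext
  ext ⟨i, k⟩
  rw [YoungDiagram.mem_cells, YoungDiagram.mem_cells, YoungDiagram.mem_iff_lt_colLen,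
    YoungDiagram.mem_iff_lt_colLen, hcol]

theorem coeff_ne_zero_card_le {f : PS} {N : ℕ}
    (hN : ∀ α : ℕ →₀ ℕ, MvPowerSeries.coeff α f ≠ 0 → α.degree ≤ N) (rho : YoungDiagram)
    (h : MvPowerSeries.coeff (partsExp rho) f ≠ 0) : rho ∈ (finite_card_le N).toFinset := by
  rw [Set.Finite.mem_toFinset]
  exact (degree_partsExp rho).symm.trans_le (hN _ h)

/-- Every symmetric function is a polynomial in the power sums. -/
theorem exists_aeval_powerSum {f : PS} (hf : f ∈ SymFun) :
    ∃ F : MvPolynomial ℕ QT, MvPolynomial.aeval (fun k => powerSum (k + 1)) F = f := by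
  obtain ⟨N, hN⟩ := hf.2
  have hU : ∀ lam ∈ (finite_card_le N).toFinset, ∀ rho : YoungDiagram,
      rho.card = lam.card ∧ (rho = lam ∨ rho.colLen 0 < lam.colLen 0) →
        rho ∈ (finite_card_le N).toFinset := by
    intro lam hlam rho h
    rw [Set.Finite.mem_toFinset] at hlam ⊢
    exact h.1.trans_le hlam
  obtain ⟨c, -, hc⟩ := exists_expansion powerSumProd powerSumProd_mem (fun mu => mu.colLen 0)
    coeff_powerSumProd_self _ (fun rho lam => eq_or_colLen_lt_of_coeff_powerSumProd)
    (fun rho lam h => h.2) _ hU f hf (coeff_ne_zero_card_le hN)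
  have hprod : ∀ mu : YoungDiagram, MvPolynomial.aeval (fun k => powerSum (k + 1))
      (∏ i ∈ range (mu.colLen 0), MvPolynomial.X (mu.rowLen i - 1) : MvPolynomial ℕ QT) =
        powerSumProd mu := by
    intro mu
    rw [map_prod, powerSumProd]
    refine prod_congr rfl fun i hi => ?_
    rw [mem_range, ← YoungDiagram.mem_iff_lt_colLen, YoungDiagram.mem_iff_lt_rowLen] at hi
    rw [MvPolynomial.aeval_X, Nat.sub_add_cancel hi]
  refine ⟨c.sum fun mu a => a • ∏ i ∈ range (mu.colLen 0), MvPolynomial.X (mu.rowLen i - 1), ?_⟩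
  rw [hc, Finsupp.sum, Finsupp.sum, map_sum]
  exact sum_congr rfl fun mu _ => by rw [map_smul, hprod]

end PowerSums

end Macdonald

namespace Macdonald

/-! ### Dominance order -/

section RowCounting

theorem sum_range_card_eq (s : Finset (ℕ × ℕ)) (a : ℕ × ℕ → ℕ) (k : ℕ) :
    ∑ i ∈ range k, #{c ∈ s | a c = i} = #{c ∈ s | a c < k} := by
  rw [card_eq_sum_card_fiberwise (f := a) (t := range k)]
  · refine sum_congr rfl fun i hi => ?_
    rw [filter_filter]
    congr 1
    ext c
    rw [mem_range] at hi
    simp only [mem_filter, and_congr_right_iff]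
    exact fun _ => ⟨fun h => ⟨by omega, h⟩, fun h => h.2⟩
  · intro c hc
    simpa using (mem_filter.1 hc).2

/-- Cells with value less than `k` lie in the first `k` rows. This one count gives dominance both
for semistandard tableaux and for the surviving signed fillings. -/
theorem sum_range_card_le (mu : YoungDiagram) (a : ℕ × ℕ → ℕ) (ha : ∀ c ∈ mu.cells, c.1 ≤ a c)
    (k : ℕ) : ∑ i ∈ range k, #{c ∈ mu.cells | a c = i} ≤ ∑ i ∈ range k, mu.rowLen i := by
  rw [sum_range_card_eq, ← card_filter_row_lt]
  refine card_le_card fun c hc => ?_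
  rw [mem_filter] at hc ⊢
  exact ⟨hc.1, (ha c hc.1).trans_lt hc.2⟩

theorem eq_row_of_card_eq (mu : YoungDiagram) (a : ℕ × ℕ → ℕ) (ha : ∀ c ∈ mu.cells, c.1 ≤ a c)
    (h : ∀ i, #{c ∈ mu.cells | a c = i} = mu.rowLen i) : ∀ c ∈ mu.cells, a c = c.1 := by
  intro c hc
  have hsub : {c' ∈ mu.cells | a c' < c.1 + 1} ⊆ {c' ∈ mu.cells | c'.1 < c.1 + 1} := by
    intro c' hc'
    rw [mem_filter] at hc' ⊢
    exact ⟨hc'.1, (ha c' hc'.1).trans_lt hc'.2⟩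
  have heq := eq_of_subset_of_card_le hsub (by
    rw [card_filter_row_lt, ← sum_range_card_eq]
    exact (sum_congr rfl fun i _ => h i).ge)
  have : c ∈ {c' ∈ mu.cells | a c' < c.1 + 1} := by
    rw [heq, mem_filter]
    exact ⟨hc, by omega⟩
  have h1 := (mem_filter.1 this).2
  have h2 := ha c hc
  omega

end RowCounting

section Dominance

theorem colLen_zero_le_card (mu : YoungDiagram) : mu.colLen 0 ≤ mu.card := by
  rw [YoungDiagram.colLen_eq_card]
  exact card_le_card (filter_subset _ _)

theorem rowLen_eq_zero (mu : YoungDiagram) {i : ℕ} (hi : mu.card ≤ i) : mu.rowLen i = 0 := by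
  by_contra h
  have h1 : (i, 0) ∈ mu := YoungDiagram.mem_iff_lt_rowLen.2 (Nat.pos_of_ne_zero h)
  have h2 := YoungDiagram.mem_iff_lt_colLen.1 h1
  have h3 := colLen_zero_le_card mu
  omega

/-- A rank function for the dominance order. -/
def dominanceRank (mu : YoungDiagram) : ℕ :=
  ∑ k ∈ range (mu.card + 1), ∑ i ∈ range k, mu.rowLen i

/-- The rank adds up the partial sums, each of which is monotone, so equal ranks force equal partial
sums and hence equal rows. -/
theorem DominatedBy.eq_or_rank_lt {rho lam : YoungDiagram} (h : DominatedBy rho lam) :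
    rho = lam ∨ dominanceRank rho < dominanceRank lam := by
  obtain ⟨hcard, hle⟩ := h
  unfold dominanceRank
  rw [hcard]
  have hle' := sum_le_sum (s := range (lam.card + 1)) fun k _ => hle k
  rcases hle'.eq_or_lt with heq | hlt
  swap
  · exact Or.inr hlt
  left
  rw [sum_eq_sum_iff_of_le fun k _ => hle k] at heq
  refine eq_of_rowLen_eq fun i => ?_
  rcases lt_or_ge i lam.card with hi | hi
  · have h1 := heq i (mem_range.2 (by omega))
    have h2 := heq (i + 1) (mem_range.2 (by omega))
    rw [sum_range_succ, sum_range_succ] at h2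
    omega
  · rw [rowLen_eq_zero lam hi, rowLen_eq_zero rho (hcard.trans_le hi)]

theorem DominatedBy.trans {a b c : YoungDiagram} (h : DominatedBy a b) (h' : DominatedBy b c) :
    DominatedBy a c :=
  ⟨h.1.trans h'.1, fun k => (h.2 k).trans (h'.2 k)⟩

end Dominance

/-! ### Schur functions and the Bender–Knuth involution -/

section Schur

variable {lam : YoungDiagram}

theorem tableauWeight_apply (T : SemistandardYoungTableau lam) (k : ℕ) :
    tableauWeight T k = #{c ∈ lam.cells | T c.1 c.2 = k} := by
  rw [tableauWeight, Finsupp.finsetSum_apply, card_filter]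
  exact sum_congr rfl fun c _ => by rw [Finsupp.single_apply]

theorem degree_tableauWeight (T : SemistandardYoungTableau lam) :
    (tableauWeight T).degree = lam.card := by
  rw [tableauWeight, map_sum]
  simp

theorem le_entry (T : SemistandardYoungTableau lam) {i j : ℕ} (h : (i, j) ∈ lam) : i ≤ T i j := by
  induction i with
  | zero => exact Nat.zero_le _
  | succ i ih =>
    have h1 := ih (lam.up_left_mem (Nat.le_succ i) le_rfl h)
    have h2 := T.col_strict (Nat.lt_add_one i) h
    omega

theorem coeff_schur (α : ℕ →₀ ℕ) : MvPowerSeries.coeff α (schur lam) =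
    (Nat.card {T : SemistandardYoungTableau lam // tableauWeight T = α} : QT) := rfl

theorem exists_tableau_of_coeff_schur {α : ℕ →₀ ℕ} (h : MvPowerSeries.coeff α (schur lam) ≠ 0) :
    ∃ T : SemistandardYoungTableau lam, tableauWeight T = α := by
  rw [coeff_schur, Nat.cast_ne_zero] at h
  obtain ⟨T⟩ := (Nat.card_ne_zero.1 h).1
  exact ⟨T.1, T.2⟩

theorem dominatedBy_of_coeff_schur {rho : YoungDiagram}
    (h : MvPowerSeries.coeff (partsExp rho) (schur lam) ≠ 0) : DominatedBy rho lam := by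
  obtain ⟨T, hT⟩ := exists_tableau_of_coeff_schur h
  refine ⟨by rw [← degree_partsExp, ← hT, degree_tableauWeight], fun k => ?_⟩
  have := sum_range_card_le lam (fun c => T c.1 c.2) (fun c hc => le_entry T hc) k
  simp_rw [← tableauWeight_apply, hT, partsExp_apply] at this
  exact this

theorem coeff_schur_self (lam : YoungDiagram) :
    MvPowerSeries.coeff (partsExp lam) (schur lam) = 1 := by
  have hentry : ∀ T : SemistandardYoungTableau lam, tableauWeight T = partsExp lam →
      ∀ c ∈ lam.cells, T c.1 c.2 = c.1 := by
    intro T hT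
    refine eq_row_of_card_eq lam (fun c => T c.1 c.2) (fun c hc => le_entry T hc) fun i => ?_
    rw [← tableauWeight_apply, hT, partsExp_apply]
  rw [coeff_schur, Nat.card_eq_one_iff_unique.2, Nat.cast_one]
  refine ⟨⟨fun T T' => Subtype.ext (SemistandardYoungTableau.ext fun i j => ?_)⟩,
    ⟨SemistandardYoungTableau.highestWeight lam, ?_⟩⟩
  · by_cases h : (i, j) ∈ lam.cells
    · exact (hentry T.1 T.2 _ h).trans (hentry T'.1 T'.2 _ h).symm
    · rw [T.1.zeros h, T'.1.zeros h]
  · ext k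
    rw [tableauWeight_apply, partsExp_apply, YoungDiagram.rowLen_eq_card, YoungDiagram.row]
    congr 1
    refine filter_congr fun c hc => ?_
    rw [SemistandardYoungTableau.highestWeight_apply, if_pos (show (c.1, c.2) ∈ lam from hc)]

/-- The number of entries less than `k` in row `r`. -/
def rowCount (T : SemistandardYoungTableau lam) (k r : ℕ) : ℕ :=
  #{c ∈ range (lam.rowLen r) | T r c < k}

/-- Rows increase weakly, so the entries less than `k` form an initial segment. A tableau is thereby
encoded by its boundaries, and the involution acts on these numbers. -/
theorem rowCount_eq_iff (T : SemistandardYoungTableau lam) {k r m : ℕ} :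
    rowCount T k r = m ↔
      m ≤ lam.rowLen r ∧ ∀ c, c < lam.rowLen r → (T r c < k ↔ c < m) := by
  have key : ∀ m, m ≤ lam.rowLen r → (∀ c, c < lam.rowLen r → (T r c < k ↔ c < m)) →
      rowCount T k r = m := by
    intro m hm h
    rw [rowCount, ← card_range m]
    congr 1
    ext c
    rw [mem_filter, mem_range, mem_range]
    exact ⟨fun h' => (h c h'.1).1 h'.2, fun h' => ⟨h'.trans_le hm, (h c (h'.trans_le hm)).2 h'⟩⟩
  refine ⟨?_, fun h => key m h.1 h.2⟩
  have hex : ∃ m, m ≤ lam.rowLen r ∧ ∀ c, c < lam.rowLen r → (T r c < k ↔ c < m) := by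
    by_cases hall : ∀ c, c < lam.rowLen r → T r c < k
    · exact ⟨_, le_rfl, fun c hc => ⟨fun _ => hc, fun _ => hall c hc⟩⟩
    · push Not at hall
      classical
      refine ⟨Nat.find hall, (Nat.find_spec hall).1.le, fun c hc => ⟨fun h => ?_, fun h => ?_⟩⟩
      · by_contra hlt
        have h1 := (Nat.find_spec hall).2
        have h2 := T.row_weak_of_le (not_lt.1 hlt) (YoungDiagram.mem_iff_lt_rowLen.2 hc)
        omega
      · by_contra hge
        exact Nat.find_min hall h ⟨hc, not_lt.1 hge⟩
  rintro rfl
  obtain ⟨m, hm, h⟩ := hex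
  rw [key m hm h]
  exact ⟨hm, h⟩

theorem rowCount_le (T : SemistandardYoungTableau lam) (k r : ℕ) :
    rowCount T k r ≤ lam.rowLen r := ((rowCount_eq_iff T).1 rfl).1

theorem lt_rowCount_iff (T : SemistandardYoungTableau lam) {k r c : ℕ} (hc : (r, c) ∈ lam) :
    c < rowCount T k r ↔ T r c < k :=
  (((rowCount_eq_iff T).1 rfl).2 c (YoungDiagram.mem_iff_lt_rowLen.1 hc)).symm

theorem rowCount_mono (T : SemistandardYoungTableau lam) {k k' : ℕ} (h : k ≤ k') (r : ℕ) :
    rowCount T k r ≤ rowCount T k' r :=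
  card_le_card (monotone_filter_right _ fun _ _ h' => h'.trans_le h)

/-- The interlacing condition that expresses strictness of the columns. -/
theorem rowCount_succ_le (T : SemistandardYoungTableau lam) (k r : ℕ) :
    rowCount T (k + 1) (r + 1) ≤ rowCount T k r := by
  by_contra! h
  set c := rowCount T k r
  have hc : (r + 1, c) ∈ lam :=
    YoungDiagram.mem_iff_lt_rowLen.2 (h.trans_le (rowCount_le T (k + 1) (r + 1)))
  have hc' := lam.up_left_mem (Nat.le_succ r) le_rfl hc
  have h1 := (lt_rowCount_iff T hc).1 h
  have h2 := T.col_strict (Nat.lt_add_one r) hc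
  have h3 := (lt_rowCount_iff T (k := k) hc').2 (by omega)
  exact lt_irrefl _ h3

theorem sum_rowCount (T : SemistandardYoungTableau lam) (k : ℕ) :
    ∑ r ∈ range (lam.colLen 0), rowCount T k r = ∑ i ∈ range k, tableauWeight T i := by
  simp_rw [tableauWeight_apply]
  rw [sum_range_card_eq lam.cells fun c => T c.1 c.2,
    card_eq_sum_card_fiberwise (f := Prod.fst) (t := range (lam.colLen 0))]
  · refine sum_congr rfl fun r hr => ?_
    rw [rowCount]
    refine card_bij (fun c _ => (r, c)) ?_ ?_ ?_
    · intro c hc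
      simp only [mem_filter, mem_range] at hc ⊢
      exact ⟨⟨YoungDiagram.mem_iff_lt_rowLen.2 hc.1, hc.2⟩, trivial⟩
    · intro c _ c' _ h
      exact congrArg Prod.snd h
    · rintro ⟨r', c⟩ hc
      simp only [mem_filter] at hc
      obtain ⟨⟨hc, hT⟩, rfl⟩ := hc
      exact ⟨c, by simpa using ⟨YoungDiagram.mem_iff_lt_rowLen.1 hc, hT⟩, rfl⟩
  · rintro ⟨r, c⟩ hc
    have := YoungDiagram.mem_iff_lt_colLen.1 (mem_filter.1 hc).1
    simpa using this.trans_le (lam.colLen_anti 0 c (Nat.zero_le _))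

/-- The least possible boundary between the letters `a` and `a + 1` in row `r`. -/
def toggleLo (T : SemistandardYoungTableau lam) (a r : ℕ) : ℕ :=
  max (rowCount T a r) (rowCount T (a + 2) (r + 1))

/-- The largest possible boundary between the letters `a` and `a + 1` in row `r`. -/
def toggleHi (T : SemistandardYoungTableau lam) (a : ℕ) : ℕ → ℕ
  | 0 => rowCount T (a + 2) 0
  | r + 1 => min (rowCount T (a + 2) (r + 1)) (rowCount T a r)

theorem toggleLo_le (T : SemistandardYoungTableau lam) (a r : ℕ) :
    toggleLo T a r ≤ rowCount T (a + 1) r :=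
  max_le (rowCount_mono T (Nat.le_succ a) r) (rowCount_succ_le T (a + 1) r)

theorem le_toggleHi (T : SemistandardYoungTableau lam) (a r : ℕ) :
    rowCount T (a + 1) r ≤ toggleHi T a r := by
  cases r with
  | zero => exact rowCount_mono T (Nat.le_succ (a + 1)) 0
  | succ r =>
    exact le_min (rowCount_mono T (Nat.le_succ (a + 1)) (r + 1)) (rowCount_succ_le T a r)

theorem toggleHi_le (T : SemistandardYoungTableau lam) (a r : ℕ) :
    toggleHi T a r ≤ rowCount T (a + 2) r := by
  cases r with
  | zero => exact le_rfl
  | succ r => exact min_le_left _ _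

/-- The reflected boundary between the letters `a` and `a + 1` in row `r`. -/
def toggleRow (T : SemistandardYoungTableau lam) (a r : ℕ) : ℕ :=
  toggleLo T a r + toggleHi T a r - rowCount T (a + 1) r

theorem toggleRow_bounds (T : SemistandardYoungTableau lam) (a r : ℕ) :
    toggleLo T a r ≤ toggleRow T a r ∧ toggleRow T a r ≤ toggleHi T a r := by
  have h1 := toggleLo_le T a r
  have h2 := le_toggleHi T a r
  unfold toggleRow
  omega

/-- The Bender–Knuth involution. -/
def toggle (T : SemistandardYoungTableau lam) (a : ℕ) : SemistandardYoungTableau lam where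
  entry r c := if T r c = a ∨ T r c = a + 1 then
    (if (r, c) ∈ lam then (if c < toggleRow T a r then a else a + 1) else T r c) else T r c
  row_weak' {r c c'} h hc' := by
    have hc := lam.up_left_mem le_rfl h.le hc'
    have hle := T.row_weak h hc'
    rw [if_pos hc, if_pos hc']
    split_ifs <;> omega
  col_strict' {r r' c} h hc' := by
    have hc := lam.up_left_mem h.le le_rfl hc'
    have hlt := T.col_strict h hc'
    rw [if_pos hc, if_pos hc']
    by_cases h1 : T r c = a ∧ T r' c = a + 1
    · obtain ⟨h1, h2⟩ := h1
      have hr : r' = r + 1 := by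
        by_contra hne
        have hc'' := lam.up_left_mem (show r + 1 ≤ r' by omega) le_rfl hc'
        have h3 := T.col_strict (Nat.lt_add_one r) hc''
        have h4 := T.col_strict (show r + 1 < r' by omega) hc'
        omega
      subst hr
      have h3 : c < toggleRow T a r :=
        ((lt_rowCount_iff T hc').2 (by omega)).trans_le
          ((le_max_right _ _).trans (toggleRow_bounds T a r).1)
      have h4 : toggleRow T a (r + 1) ≤ c := by
        refine ((toggleRow_bounds T a (r + 1)).2.trans (min_le_right _ _)).trans ?_
        exact not_lt.1 fun h => by have := (lt_rowCount_iff T hc).1 h; omega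
      rw [if_pos (Or.inl h1), if_pos (Or.inr h2), if_pos h3, if_neg (not_lt.2 h4)]
      exact Nat.lt_succ_self a
    · split_ifs <;> omega
  zeros' {r c} h := by
    rw [if_neg h, ite_self]
    exact T.zeros h

theorem toggle_apply (T : SemistandardYoungTableau lam) (a : ℕ) {r c : ℕ} (h : (r, c) ∈ lam) :
    toggle T a r c = if T r c = a ∨ T r c = a + 1 then
      (if c < toggleRow T a r then a else a + 1) else T r c := by
  change (if T r c = a ∨ T r c = a + 1 then
    (if (r, c) ∈ lam then (if c < toggleRow T a r then a else a + 1) else T r c) else T r c) = _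
  rw [if_pos h]

theorem rowCount_toggle_of_ne (T : SemistandardYoungTableau lam) {a k : ℕ} (hk : k ≠ a + 1)
    (r : ℕ) : rowCount (toggle T a) k r = rowCount T k r := by
  rw [rowCount_eq_iff]
  refine ⟨rowCount_le T k r, fun c hc => ?_⟩
  have hc' := YoungDiagram.mem_iff_lt_rowLen.2 hc
  rw [lt_rowCount_iff T hc', toggle_apply T a hc']
  split_ifs <;> omega

theorem rowCount_toggle (T : SemistandardYoungTableau lam) (a r : ℕ) :
    rowCount (toggle T a) (a + 1) r = toggleRow T a r := by
  rw [rowCount_eq_iff]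
  obtain ⟨h1, h2⟩ := toggleRow_bounds T a r
  have h3 := toggleHi_le T a r
  have h4 : rowCount T a r ≤ toggleLo T a r := le_max_left _ _
  refine ⟨(h2.trans h3).trans (rowCount_le T _ r), fun c hc => ?_⟩
  have hc' := YoungDiagram.mem_iff_lt_rowLen.2 hc
  have h5 := lt_rowCount_iff T (k := a) hc'
  have h6 := lt_rowCount_iff T (k := a + 2) hc'
  rw [toggle_apply T a hc']
  split_ifs <;> omega

theorem toggleRow_toggle (T : SemistandardYoungTableau lam) (a r : ℕ) :
    toggleRow (toggle T a) a r = rowCount T (a + 1) r := by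
  have hlo : toggleLo (toggle T a) a r = toggleLo T a r := by
    rw [toggleLo, toggleLo, rowCount_toggle_of_ne T (by omega), rowCount_toggle_of_ne T (by omega)]
  have hhi : toggleHi (toggle T a) a r = toggleHi T a r := by
    cases r with
    | zero => rw [toggleHi, toggleHi, rowCount_toggle_of_ne T (by omega)]
    | succ r =>
      rw [toggleHi, toggleHi, rowCount_toggle_of_ne T (by omega),
        rowCount_toggle_of_ne T (by omega)]
  have h1 := toggleLo_le T a r
  have h2 := le_toggleHi T a r
  rw [toggleRow, hlo, hhi, rowCount_toggle, toggleRow]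
  omega

theorem toggle_toggle (T : SemistandardYoungTableau lam) (a : ℕ) : toggle (toggle T a) a = T := by
  refine SemistandardYoungTableau.ext fun r c => ?_
  by_cases h : (r, c) ∈ lam
  · have h5 := lt_rowCount_iff T (k := a + 1) h
    rw [toggle_apply _ a h, toggleRow_toggle, toggle_apply _ a h]
    split_ifs <;> omega
  · rw [(toggle (toggle T a) a).zeros h, T.zeros h]

/-- The lower bound in row `n` is the maximum, and the upper bound in row `n + 1` the minimum, of
the same two numbers. The sum telescopes after this shift by one row. -/
theorem sum_toggleLo_add_toggleHi (T : SemistandardYoungTableau lam) (a n : ℕ) :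
    ∑ r ∈ range n, (toggleLo T a r + toggleHi T a r) + toggleHi T a n =
      ∑ r ∈ range n, (rowCount T a r + rowCount T (a + 2) r) + rowCount T (a + 2) n := by
  induction n with
  | zero => simp [toggleHi]
  | succ n ih =>
    rw [sum_range_succ, sum_range_succ]
    have h : toggleLo T a n + toggleHi T a (n + 1) =
        rowCount T a n + rowCount T (a + 2) (n + 1) := by
      simp only [toggleLo, toggleHi]
      omega
    omega

theorem sum_rowCount_toggle (T : SemistandardYoungTableau lam) (a : ℕ) :
    ∑ r ∈ range (lam.colLen 0), rowCount (toggle T a) (a + 1) r +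
      ∑ r ∈ range (lam.colLen 0), rowCount T (a + 1) r =
    ∑ r ∈ range (lam.colLen 0), rowCount T a r +
      ∑ r ∈ range (lam.colLen 0), rowCount T (a + 2) r := by
  have hzero : lam.rowLen (lam.colLen 0) = 0 := by
    have := support_partsExp lam
    rw [← partsExp_apply, ← Finsupp.notMem_support_iff, this]
    exact notMem_range_self
  have h1 : rowCount T (a + 2) (lam.colLen 0) = 0 := by
    have := rowCount_le T (a + 2) (lam.colLen 0)
    omega
  have h2 : toggleHi T a (lam.colLen 0) = 0 := by
    have := toggleHi_le T a (lam.colLen 0)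
    omega
  have key := sum_toggleLo_add_toggleHi T a (lam.colLen 0)
  rw [h1, h2, add_zero, add_zero] at key
  rw [← sum_add_distrib, ← sum_add_distrib, ← key]
  refine sum_congr rfl fun r _ => ?_
  have h1 := toggleLo_le T a r
  have h2 := le_toggleHi T a r
  rw [rowCount_toggle, toggleRow]
  omega

/-- The partial sums of the weight are totals of `rowCount`. Only the total at `a + 1` changes, and
it is reflected between its two neighbours, which exchanges the multiplicities of `a` and `a + 1`.
-/
theorem tableauWeight_toggle (T : SemistandardYoungTableau lam) (a : ℕ) :
    tableauWeight (toggle T a) = (tableauWeight T).mapDomain (Equiv.swap a (a + 1)) := by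
  have hsum : ∀ k, k ≠ a + 1 → ∑ i ∈ range k, tableauWeight (toggle T a) i =
      ∑ i ∈ range k, tableauWeight T i := by
    intro k hk
    rw [← sum_rowCount, ← sum_rowCount]
    exact sum_congr rfl fun r _ => rowCount_toggle_of_ne T hk r
  have hmid := sum_rowCount_toggle T a
  simp_rw [sum_rowCount, sum_range_succ] at hmid
  have h0 := hsum a (by omega)
  have h2 := hsum (a + 2) (by omega)
  simp_rw [sum_range_succ] at h2
  ext k
  have hswap := Finsupp.mapDomain_apply (Equiv.swap a (a + 1)).injective (tableauWeight T)
    (Equiv.swap a (a + 1) k)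
  rw [Equiv.swap_apply_self] at hswap
  rw [hswap]
  rcases eq_or_ne k a with rfl | hka
  · rw [Equiv.swap_apply_left]
    omega
  rcases eq_or_ne k (a + 1) with rfl | hka'
  · rw [Equiv.swap_apply_right]
    omega
  · rw [Equiv.swap_apply_of_ne_of_ne hka hka']
    have h1 := hsum k hka'
    have h2 := hsum (k + 1) (by omega)
    rw [sum_range_succ, sum_range_succ] at h2
    omega

theorem schur_mem (lam : YoungDiagram) : schur lam ∈ SymFun := by
  refine mem_symFun_of_coeff (fun a α => ?_) lam.card fun α hα => ?_
  · rw [coeff_schur, coeff_schur]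
    congr 1
    refine Nat.card_congr ⟨fun T => ⟨toggle T.1 a, ?_⟩, fun T => ⟨toggle T.1 a, ?_⟩, ?_, ?_⟩
    · rw [tableauWeight_toggle, T.2, ← Finsupp.mapDomain_comp, ← Equiv.coe_trans, Equiv.swap_swap]
      simp
    · rw [tableauWeight_toggle, T.2]
    · exact fun T => Subtype.ext (toggle_toggle T.1 a)
    · exact fun T => Subtype.ext (toggle_toggle T.1 a)
  · obtain ⟨T, rfl⟩ := exists_tableau_of_coeff_schur hα
    exact (degree_tableauWeight T).le

end Schur

end Macdonald

namespace Macdonald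

/-! ### Reading order and symmetry of Macdonald polynomials -/

section Geometry

variable {mu : YoungDiagram}

/-- The position of a cell in the reading order; two cells in the same column and in consecutive
rows have distance `mu.rowLen 0`. -/
def position (c : mu.cells) : ℤ := c.1.2 - mu.rowLen 0 * c.1.1

theorem snd_lt_rowLen_zero (c : mu.cells) : c.1.2 < mu.rowLen 0 :=
  (YoungDiagram.mem_iff_lt_rowLen.1 (show (c.1.1, c.1.2) ∈ mu from c.2)).trans_le
    (mu.rowLen_anti 0 _ (Nat.zero_le _))

/-- All comparisons of cells below follow from these cases by linear arithmetic. Columns are less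
than `rowLen 0`, so rows occupy disjoint intervals of positions. -/
theorem position_cases (c d : mu.cells) :
    (d.1.1 = c.1.1 ∧ position d - position c = (d.1.2 : ℤ) - c.1.2) ∨
    (c.1.1 = d.1.1 + 1 ∧ position d - position c = (d.1.2 : ℤ) - c.1.2 + mu.rowLen 0) ∨
    (d.1.1 = c.1.1 + 1 ∧ position d - position c = (d.1.2 : ℤ) - c.1.2 - mu.rowLen 0) ∨
    (d.1.1 + 2 ≤ c.1.1 ∧ (mu.rowLen 0 : ℤ) < position d - position c) ∨
    (c.1.1 + 2 ≤ d.1.1 ∧ (mu.rowLen 0 : ℤ) < position c - position d) := by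
  have hc := snd_lt_rowLen_zero c
  have hd := snd_lt_rowLen_zero d
  unfold position
  rcases lt_trichotomy c.1.1 d.1.1 with h | h | h
  · rcases Nat.lt_or_ge (c.1.1 + 1) d.1.1 with h' | h'
    · right; right; right; right
      refine ⟨h', ?_⟩
      obtain ⟨k, hk⟩ := Nat.exists_eq_add_of_le h'
      rw [hk]
      push_cast
      nlinarith [Int.natCast_nonneg (mu.rowLen 0 * k)]
    · right; right; left
      have : d.1.1 = c.1.1 + 1 := by omega
      refine ⟨this, ?_⟩
      rw [this]
      push_cast
      ring
  · left
    exact ⟨h.symm, by rw [h]; ring⟩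
  · rcases Nat.lt_or_ge (d.1.1 + 1) c.1.1 with h' | h'
    · right; right; right; left
      refine ⟨h', ?_⟩
      obtain ⟨k, hk⟩ := Nat.exists_eq_add_of_le h'
      rw [hk]
      push_cast
      nlinarith [Int.natCast_nonneg (mu.rowLen 0 * k)]
    · right; left
      have : c.1.1 = d.1.1 + 1 := by omega
      refine ⟨this, ?_⟩
      rw [this]
      push_cast
      ring

theorem position_injective : Function.Injective (position (mu := mu)) := by
  intro c d h
  have hc := snd_lt_rowLen_zero c
  have hd := snd_lt_rowLen_zero d
  apply Subtype.ext
  apply Prod.ext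
  all_goals rcases position_cases c d with h' | h' | h' | h' | h' <;> omega

theorem precedes_iff (c d : mu.cells) : Precedes c d ↔ position c < position d := by
  have hc := snd_lt_rowLen_zero c
  have hd := snd_lt_rowLen_zero d
  unfold Precedes
  rcases position_cases c d with h' | h' | h' | h' | h' <;> omega

theorem isAbove_iff (c d : mu.cells) :
    IsAbove c d ↔ position d = position c + mu.rowLen 0 := by
  have hc := snd_lt_rowLen_zero c
  have hd := snd_lt_rowLen_zero d
  unfold IsAbove
  rcases position_cases c d with h' | h' | h' | h' | h' <;> omega

theorem attack_iff {c d : mu.cells} (h : position c < position d) :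
    Attack c d ↔ position d < position c + mu.rowLen 0 := by
  have hc := snd_lt_rowLen_zero c
  have hd := snd_lt_rowLen_zero d
  have hne : c ≠ d := fun h' => by rw [h'] at h; exact lt_irrefl _ h
  unfold Attack
  simp only [hne, ne_eq, not_false_eq_true, true_and]
  rcases position_cases c d with h' | h' | h' | h' | h' <;> omega

theorem IsAbove.position_lt {c d : mu.cells} (h : IsAbove c d) : position c < position d := by
  rw [← precedes_iff]
  exact Or.inl (by have := h.1; omega)

theorem IsAbove.eq {c d d' : mu.cells} (h : IsAbove c d) (h' : IsAbove c d') : d = d' := by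
  apply Subtype.ext
  apply Prod.ext
  · have := h.1
    have := h'.1
    omega
  · exact h.2.symm.trans h'.2

end Geometry

section Weights

variable {mu : YoungDiagram}

theorem q_ne_zero : q ≠ 0 := by
  rw [q, Ne, map_eq_zero_iff _ (IsFractionRing.injective (MvPolynomial (Fin 2) ℚ) QT)]
  exact MvPolynomial.X_ne_zero 0

open Classical in
/-- The contribution of an inversion `c, d` to the weight of a filling. -/
noncomputable def pairFactor (c d : mu.cells) : QT :=
  if Attack c d then q else if IsAbove c d then q ^ (-(arm c : ℤ)) * t ^ (leg c + 1) else 1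

/-- Cells attack each other at distances less than `μ_1`, and the cell immediately below is at
distance exactly `μ_1`. So the descent factor sits at the one critical distance that the two-letter
argument leaves free. -/
theorem isKernel_pairFactor (mu : YoungDiagram) :
    IsKernel (position (mu := mu)) q (mu.rowLen 0) pairFactor univ := by
  intro c _ d _ h
  refine ⟨fun h' => ?_, fun h' => ?_⟩
  · rw [pairFactor, if_pos ((attack_iff h).2 h')]
  · rw [pairFactor, if_neg fun h'' => absurd ((attack_iff h).1 h'') h'.le.not_gt,
      if_neg fun h'' => absurd ((isAbove_iff c d).1 h'') h'.ne']

open Classical in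
-- A descent is an inversion between a cell and the one below it, so `maj` and the arm correction of
-- `inv` are products over pairs as well.
theorem weight_eq_relWeight (σ : mu.cells → ℕ) :
    q ^ inv σ * t ^ maj σ = relWeight position pairFactor (fun d c => σ d < σ c) := by
  have h1 : ∀ c d : mu.cells, (if position c < position d ∧ σ d < σ c then pairFactor c d else 1) =
      (if Attack c d ∧ Precedes c d ∧ σ d < σ c then q else 1) *
      (if IsAbove c d ∧ σ d < σ c then q ^ (-(arm c : ℤ)) * t ^ (leg c + 1) else 1) := by
    intro c d
    rw [precedes_iff]
    by_cases hσ : σ d < σ c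
    swap
    · simp [hσ]
    by_cases hp : position c < position d
    swap
    · have : ¬ IsAbove c d := fun h => hp h.position_lt
      simp [hp, this]
    by_cases ha : Attack c d
    · have : ¬ IsAbove c d := by
        rw [attack_iff hp] at ha
        rw [isAbove_iff]
        exact ha.ne
      simp [hσ, hp, ha, this, pairFactor]
    · simp [hσ, hp, ha, pairFactor]
  have h2 : ∀ c : mu.cells, (∏ d : mu.cells,
      if IsAbove c d ∧ σ d < σ c then q ^ (-(arm c : ℤ)) * t ^ (leg c + 1) else 1) =
      if c ∈ descents σ then q ^ (-(arm c : ℤ)) * t ^ (leg c + 1) else 1 := by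
    intro c
    by_cases hc : c ∈ descents σ
    · rw [if_pos hc]
      obtain ⟨-, d, hd, hlt⟩ := mem_filter.1 hc
      rw [prod_eq_single d, if_pos ⟨hd, hlt⟩]
      · intro d' _ hne
        exact if_neg fun h => hne (h.1.eq hd)
      · exact fun h => absurd (mem_univ d) h
    · rw [if_neg hc]
      refine prod_eq_one fun d _ => if_neg fun h => hc ?_
      exact mem_filter.2 ⟨mem_univ _, d, h.1, h.2⟩
  rw [relWeight]
  simp_rw [h1, prod_mul_distrib, h2]
  rw [← prod_product', univ_product_univ, ← prod_filter, prod_const, prod_ite_mem, univ_inter,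
    prod_mul_distrib, prod_pow_eq_pow_sum, inv, maj, sub_eq_add_neg, zpow_add₀ q_ne_zero,
    zpow_natCast, mul_assoc]
  congr 2
  rw [← sum_neg_distrib]
  generalize descents σ = s
  induction s using Finset.induction_on with
  | empty => simp
  | insert a s ha ih => rw [sum_insert ha, prod_insert ha, zpow_add₀ q_ne_zero, ih]

theorem mem_fillings {α : ℕ →₀ ℕ} {σ : mu.cells → ℕ} :
    σ ∈ fillings mu α ↔ ∀ k, #{c | σ c = k} = α k := by
  rw [← mem_weightFillings, fillings, weightFillings]

theorem coeff_macdonaldH (mu : YoungDiagram) (α : ℕ →₀ ℕ) :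
    MvPowerSeries.coeff α (macdonaldH mu) = ∑ σ ∈ weightFillings mu.cells α,
      relWeight position pairFactor (fun d c => σ d < σ c) := by
  rw [MvPowerSeries.coeff_apply, macdonaldH]
  have : fillings mu α = weightFillings mu.cells α := by
    ext σ
    rw [mem_fillings, mem_weightFillings]
  rw [this]
  exact sum_congr rfl fun σ _ => weight_eq_relWeight σ

theorem degree_of_coeff_macdonaldH {α : ℕ →₀ ℕ}
    (h : MvPowerSeries.coeff α (macdonaldH mu) ≠ 0) : α.degree = mu.card := by
  rw [coeff_macdonaldH] at h
  obtain ⟨σ, hσ, -⟩ := exists_ne_zero_of_sum_ne_zero h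
  rw [weightFillings, mem_filter] at hσ
  rw [← hσ.2, map_sum]
  simp

/-- The Macdonald polynomials are symmetric functions. -/
theorem macdonaldH_mem (mu : YoungDiagram) : macdonaldH mu ∈ SymFun := by
  refine mem_symFun_of_coeff (fun i α => ?_) mu.card fun α hα => (degree_of_coeff_macdonaldH hα).le
  rw [coeff_macdonaldH, coeff_macdonaldH]
  exact sum_relWeight_swap position_injective (isKernel_pairFactor mu) i α

end Weights

end Macdonald

namespace Macdonald

/-! ### Combinatorial reciprocity -/

section Reciprocity

variable {K : Type*} [Field K] [CharZero K]

/-- Every polynomial over a field of characteristic zero is a difference. -/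
theorem exists_antidifference (D : Polynomial K) :
    ∃ P : Polynomial K, P.eval 0 = 0 ∧ ∀ x, P.eval (x + 1) = P.eval x + D.eval x := by
  suffices h : ∃ P : Polynomial K, ∀ x, P.eval (x + 1) = P.eval x + D.eval x by
    obtain ⟨P, hP⟩ := h
    refine ⟨P - Polynomial.C (P.eval 0), by simp, fun x => ?_⟩
    simp only [Polynomial.eval_sub, Polynomial.eval_C, hP]
    ring
  induction D using Polynomial.induction_on' with
  | add D₁ D₂ h₁ h₂ =>
    obtain ⟨P₁, h₁⟩ := h₁
    obtain ⟨P₂, h₂⟩ := h₂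
    refine ⟨P₁ + P₂, fun x => ?_⟩
    simp only [Polynomial.eval_add, h₁, h₂]
    ring
  | monomial n a =>
    have hn : ((n + 1 : ℕ) : K) ≠ 0 := Nat.cast_ne_zero.2 n.succ_ne_zero
    -- The Bernoulli polynomial of degree `n + 1` has difference `(n + 1) x ^ n`.
    refine ⟨Polynomial.C (a / (n + 1 : ℕ)) *
      (Polynomial.bernoulli (n + 1)).map (algebraMap ℚ K), fun x => ?_⟩
    have h := congrArg (fun P => (P.map (algebraMap ℚ K)).eval x)
      (Polynomial.bernoulli_comp_one_add_X (n + 1))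
    simp only [Polynomial.map_comp, Polynomial.map_add, Polynomial.map_one, Polynomial.map_X,
      Polynomial.eval_comp, Polynomial.eval_add, Polynomial.eval_one, Polynomial.eval_X,
      Polynomial.map_pow, Polynomial.eval_pow,
      Nat.add_sub_cancel, nsmul_eq_mul, Polynomial.map_mul, Polynomial.map_natCast,
      Polynomial.eval_mul, Polynomial.eval_natCast] at h
    rw [Polynomial.eval_mul, Polynomial.eval_mul, Polynomial.eval_C, Polynomial.eval_C,
      Polynomial.eval_monomial, add_comm x 1, h, mul_add, ← mul_assoc, div_mul_cancel₀ _ hn]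

variable {C : Type*} [Fintype C] [DecidableEq C]

/-- The functions on `s` with values less than `N`, extended by zero. -/
def boxFunctions (s : Finset C) (N : ℕ) : Finset (C → ℕ) :=
  Fintype.piFinset fun c => if c ∈ s then range N else {0}

theorem mem_boxFunctions {s : Finset C} {N : ℕ} {g : C → ℕ} :
    g ∈ boxFunctions s N ↔ (∀ c ∈ s, g c < N) ∧ ∀ c ∉ s, g c = 0 := by
  rw [boxFunctions, Fintype.mem_piFinset]
  refine ⟨fun h => ⟨fun c hc => by simpa [hc] using h c, fun c hc => by simpa [hc] using h c⟩,
    fun h c => ?_⟩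
  by_cases hc : c ∈ s
  · simpa [hc] using h.1 c hc
  · simpa [hc] using h.2 c hc

/-- The inversions of a function on `s`. -/
def invPairs (p : C → ℤ) (s : Finset C) (g : C → ℕ) : Finset (C × C) :=
  {e ∈ s ×ˢ s | p e.1 < p e.2 ∧ g e.2 < g e.1}

theorem sum_boxFunctions_succ {M : Type*} [AddCommMonoid M] (s : Finset C) (N : ℕ)
    (F : (C → ℕ) → M) :
    ∑ g ∈ boxFunctions s (N + 1), F g = ∑ T ∈ s.powerset, ∑ g ∈ boxFunctions (s \ T) N,
      F fun c => if c ∈ T then N else g c := by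
  rw [Finset.sum_sigma']
  refine Finset.sum_bij' (fun g _ => ⟨{c ∈ s | g c = N}, fun c => if g c = N then 0 else g c⟩)
    (fun x _ c => if c ∈ x.1 then N else x.2 c) ?_ ?_ ?_ ?_ ?_
  · intro g hg
    rw [mem_boxFunctions] at hg
    rw [mem_sigma, mem_powerset, mem_boxFunctions]
    refine ⟨filter_subset _ _, fun c hc => ?_, fun c hc => ?_⟩
    · rw [mem_sdiff, mem_filter, not_and] at hc
      have h1 := hg.1 c hc.1
      have h2 := hc.2 hc.1
      simp only [h2, if_false]
      omega
    · rw [mem_sdiff, mem_filter] at hc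
      by_cases hcs : c ∈ s
      · have : g c = N := by
          by_contra h
          exact hc ⟨hcs, fun h' => h h'.2⟩
        simp [this]
      · simp [hg.2 c hcs]
  · rintro ⟨T, g⟩ hx
    rw [mem_sigma, mem_powerset, mem_boxFunctions] at hx
    obtain ⟨hT, h1, h2⟩ := hx
    rw [mem_boxFunctions]
    refine ⟨fun c hc => ?_, fun c hc => ?_⟩
    · by_cases hcT : c ∈ T
      · simp [hcT]
      · have := h1 c (mem_sdiff.2 ⟨hc, hcT⟩)
        simp only [hcT, if_false]
        simp only at this
        omega
    · have hcT : c ∉ T := fun h => hc (hT h)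
      simpa [hcT] using h2 c fun h => hc (mem_sdiff.1 h).1
  · intro g hg
    rw [mem_boxFunctions] at hg
    funext c
    by_cases hcs : c ∈ s
    · by_cases h : g c = N <;> simp [hcs, h]
    · by_cases h : g c = N <;> simp [hcs, hg.2 c hcs]
  · rintro ⟨T, g⟩ hx
    rw [mem_sigma, mem_powerset, mem_boxFunctions] at hx
    obtain ⟨hT, h1, h2⟩ := hx
    have hTe : ({c ∈ s | (if c ∈ T then N else g c) = N} : Finset C) = T := by
      ext c
      rw [mem_filter]
      by_cases hcT : c ∈ T
      · simp [hcT, hT hcT]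
      · simp only [hcT, if_false, iff_false, not_and]
        intro hc h
        have := h1 c (mem_sdiff.2 ⟨hc, hcT⟩)
        simp only at this
        omega
    simp only [hTe]
    congr 1
    funext c
    by_cases hcT : c ∈ T
    · have := h2 c fun h => (mem_sdiff.1 h).2 hcT
      simp only at this
      simp [hcT, this]
    · by_cases h : g c = N
      · by_cases hcs : c ∈ s
        · have := h1 c (mem_sdiff.2 ⟨hcs, hcT⟩)
          simp only at this
          omega
        · have := h2 c fun h => hcs (mem_sdiff.1 h).1
          simp only at this
          simp [hcT, this]
      · simp [hcT, h]
  · intro g hg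
    rw [mem_boxFunctions] at hg
    congr 1
    funext c
    by_cases hcs : c ∈ s
    · by_cases h : g c = N <;> simp [hcs, h]
    · by_cases h : g c = N <;> simp [hcs, hg.2 c hcs]

theorem invPairs_ite (p : C → ℤ) {s T : Finset C} (hT : T ⊆ s) {N : ℕ} {g : C → ℕ}
    (hg : g ∈ boxFunctions (s \ T) N) :
    invPairs p s (fun c => if c ∈ T then N else g c) =
      invPairs p (s \ T) g ∪ {e ∈ T ×ˢ (s \ T) | p e.1 < p e.2} := by
  rw [mem_boxFunctions] at hg
  ext ⟨c, d⟩
  have hc := hg.1 c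
  have hd := hg.1 d
  have hcT := @hT c
  have hdT := @hT d
  simp only [invPairs, mem_union, mem_filter, mem_product, mem_sdiff] at hc hd ⊢
  by_cases h1 : c ∈ T <;> by_cases h2 : d ∈ T <;> simp only [h1, h2, if_true, if_false] <;>
    by_cases h3 : d ∈ s <;> by_cases h4 : c ∈ s <;>
    simp only [h1, h2, h3, h4] at hc hd hcT hdT ⊢ <;> grind

/-- Sorting the functions by the set `T` where the top value is attained gives a difference equation
in `N`, so the sum is polynomial by induction on `s`. At `N = -1` the sum is replaced by one signed
term in which every pair counts as an inversion. -/
theorem exists_polynomial_sum_boxFunctions (p : C → ℤ) (s : Finset C) (W : Finset (C × C) → K) :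
    ∃ P : Polynomial K, (∀ N : ℕ, P.eval (N : K) = ∑ g ∈ boxFunctions s N, W (invPairs p s g)) ∧
      P.eval (-1) = (-1) ^ #s * W {e ∈ s ×ˢ s | p e.1 < p e.2} := by
  induction s using Finset.strongInduction generalizing W with
  | H s ih =>
  rcases s.eq_empty_or_nonempty with rfl | hs
  · refine ⟨Polynomial.C (W ∅), fun N => ?_, ?_⟩
    · have : boxFunctions (∅ : Finset C) N = {0} := by
        ext g
        rw [mem_boxFunctions, mem_singleton]
        exact ⟨fun h => funext fun c => h.2 c (notMem_empty c), fun h => by simp [h]⟩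
      rw [this, sum_singleton]
      simp [invPairs]
    · simp
  let cut : Finset C → Finset (C × C) := fun T => {e ∈ T ×ˢ (s \ T) | p e.1 < p e.2}
  have h1 : ∀ T : Finset C, ∃ P : Polynomial K, T ∈ s.powerset.erase ∅ →
      (∀ N : ℕ, P.eval (N : K) =
        ∑ g ∈ boxFunctions (s \ T) N, W (invPairs p (s \ T) g ∪ cut T)) ∧
      P.eval (-1) = (-1) ^ #(s \ T) *
        W ({e ∈ (s \ T) ×ˢ (s \ T) | p e.1 < p e.2} ∪ cut T) := by
    intro T
    by_cases hT : T ∈ s.powerset.erase ∅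
    · rw [mem_erase, mem_powerset] at hT
      obtain ⟨P, hP⟩ := ih (s \ T) (sdiff_ssubset hT.2 (nonempty_iff_ne_empty.2 hT.1))
        (fun E => W (E ∪ cut T))
      exact ⟨P, fun _ => hP⟩
    · exact ⟨0, fun h => absurd h hT⟩
  choose D hD using h1
  obtain ⟨P, hP0, hP⟩ := exists_antidifference (∑ T ∈ s.powerset.erase ∅, D T)
  refine ⟨P, fun N => ?_, ?_⟩
  · induction N with
    | zero =>
      rw [Nat.cast_zero, hP0, eq_comm]
      obtain ⟨c, hc⟩ := hs
      refine sum_eq_zero fun g hg => ?_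
      exact absurd ((mem_boxFunctions.1 hg).1 c hc) (Nat.not_lt_zero _)
    | succ N ihN =>
      rw [Nat.cast_succ, hP, ihN, sum_boxFunctions_succ,
        ← add_sum_erase _ _ (empty_mem_powerset s), Polynomial.eval_finsetSum]
      congr 1
      · simp
      · refine sum_congr rfl fun T hT => ?_
        rw [(hD T hT).1]
        refine sum_congr rfl fun g hg => ?_
        rw [invPairs_ite p (mem_powerset.1 (mem_of_mem_erase hT)) hg]
  · have h2 : P.eval (-1) = - ∑ T ∈ s.powerset.erase ∅, (D T).eval (-1) := by
      have := hP (-1)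
      rw [neg_add_cancel, hP0, Polynomial.eval_finsetSum] at this
      linear_combination -this
    -- Together with the pairs from `T` to its complement, the second entry avoids `T` and the first
    -- is arbitrary.
    have hpairs : ∀ T ∈ s.powerset, ({e ∈ (s \ T) ×ˢ (s \ T) | p e.1 < p e.2} ∪ cut T :
        Finset (C × C)) = {e ∈ s ×ˢ (s \ T) | p e.1 < p e.2} := by
      intro T hT
      rw [mem_powerset] at hT
      ext ⟨c, d⟩
      have := @hT c
      simp only [cut, mem_union, mem_filter, mem_product, mem_sdiff]
      tauto
    -- The cell `u` of least position is never a second entry, so moving `u` in or out of `T`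
    -- changes only the sign. The term at `T = ∅` is therefore minus the sum of the others, which is
    -- `P(-1)`.
    have h3 : ∑ T ∈ s.powerset, (-1) ^ #(s \ T) *
        W {e ∈ s ×ˢ (s \ T) | p e.1 < p e.2} = 0 := by
      obtain ⟨u, hu, hmin⟩ := exists_min_image s p hs
      rw [← insert_erase hu, sum_powerset_insert (notMem_erase u s), ← sum_add_distrib]
      refine sum_eq_zero fun T hT => ?_
      rw [mem_powerset] at hT
      have huT : u ∉ T := fun h => notMem_erase u s (hT h)
      rw [insert_erase hu]
      have hset : ({e ∈ s ×ˢ (s \ T) | p e.1 < p e.2} : Finset (C × C)) =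
          {e ∈ s ×ˢ (s \ insert u T) | p e.1 < p e.2} := by
        ext ⟨c, d⟩
        simp only [mem_filter, mem_product, mem_sdiff, mem_insert, not_or]
        refine ⟨fun h => ⟨⟨h.1.1, h.1.2.1, fun h' => ?_, h.1.2.2⟩, h.2⟩,
          fun h => ⟨⟨h.1.1, h.1.2.1, h.1.2.2.2⟩, h.2⟩⟩
        exact absurd (h' ▸ h.2) (hmin c h.1.1).not_gt
      have hcard : s \ T = insert u (s \ insert u T) := by
        ext c
        simp only [mem_sdiff, mem_insert, not_or]
        by_cases hc : c = u
        · simp [hc, hu, huT]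
        · simp [hc]
      rw [← hset, hcard, card_insert_of_notMem (by simp), pow_succ]
      ring
    rw [← add_sum_erase _ _ (empty_mem_powerset s), Finset.sdiff_empty] at h3
    rw [h2, eq_comm, ← sub_eq_zero, sub_neg_eq_add, ← h3]
    congr 1
    refine sum_congr rfl fun T hT => ?_
    rw [(hD T hT).2, hpairs T (mem_of_mem_erase hT)]

end Reciprocity

end Macdonald

namespace Macdonald

/-! ### Evaluation on finite alphabets -/

section Alphabets

/-- The finite alphabet of the letters `z_j x_{v j}`, `j < m`. -/
noncomputable def letters (m : ℕ) (z : ℕ → QT) (v : ℕ → ℕ) (j : ℕ) : PS :=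
  if j < m then z j • MvPowerSeries.X (v j) else 0

variable (m : ℕ) (z : ℕ → QT) (v : ℕ → ℕ)

theorem hasSubst_letters : MvPowerSeries.HasSubst (letters m z v) where
  const_coeff j := by
    have : MvPowerSeries.constantCoeff (letters m z v j) = 0 := by
      rw [letters]
      split_ifs
      · rw [MvPowerSeries.smul_eq_C_mul, map_mul, MvPowerSeries.constantCoeff_X, mul_zero]
      · exact map_zero _
    rw [this]
    exact IsNilpotent.zero
  coeff_zero d := by
    refine (Set.finite_lt_nat m).subset fun j hj => ?_
    by_contra h
    rw [Set.mem_ofPred_eq] at hj h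
    exact hj (by rw [letters, if_neg h, map_zero])

theorem subst_letters_powerSum (k : ℕ) (hk : k ≠ 0) :
    MvPowerSeries.subst (letters m z v) (powerSum k) =
      ∑ j ∈ range m, (z j ^ k) • (MvPowerSeries.X (v j) : PS) ^ k := by
  classical
  ext e
  rw [MvPowerSeries.coeff_subst (hasSubst_letters m z v),
    finsum_eq_sum_of_support_subset (s := (range m).image fun j => Finsupp.single j k)]
  · rw [sum_image fun i _ j _ h => (Finsupp.single_left_injective hk) h, map_sum]
    refine sum_congr rfl fun j hj => ?_
    rw [coeff_powerSum, if_pos ⟨j, rfl⟩, one_smul, Finsupp.prod_single_index (h := fun s k => letters m z v s ^ k) (pow_zero _), letters,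
      if_pos (mem_range.1 hj), smul_pow]
  · intro d hd
    rw [Function.mem_support, coeff_powerSum] at hd
    by_cases h : ∃ j, d = Finsupp.single j k
    · obtain ⟨j, rfl⟩ := h
      by_cases hj : j < m
      · exact mem_coe.2 (mem_image_of_mem _ (mem_range.2 hj))
      · refine absurd ?_ hd
        rw [Finsupp.prod_single_index (h := fun s k => letters m z v s ^ k) (pow_zero _), letters, if_neg hj, zero_pow hk, map_zero,
          smul_zero]
    · rw [if_neg h, zero_smul] at hd
      exact absurd rfl hd

/-- Setting the variables from `x_n` on to zero does not affect monomials in the first `n`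
variables, so a single coefficient may be studied on a finite alphabet. -/
theorem coeff_subst_letters_id {n : ℕ} {e : ℕ →₀ ℕ} (he : e.support ⊆ range n) (f : PS) :
    MvPowerSeries.coeff e (MvPowerSeries.subst (letters n 1 id) f) = MvPowerSeries.coeff e f := by
  classical
  have hmon : ∀ d : ℕ →₀ ℕ, d.support ⊆ range n →
      d.prod (fun s k => letters n 1 id s ^ k) = MvPowerSeries.monomial d (1 : QT) := by
    intro d hd
    have h1 : d.prod (fun s k => letters n 1 id s ^ k) =
        d.prod fun s k => (MvPowerSeries.X s : PS) ^ k := by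
      refine Finsupp.prod_congr fun s hs => ?_
      rw [letters, if_pos (mem_range.1 (hd hs)), Pi.one_apply, one_smul, id]
    rw [h1]
    have h2 := MvPolynomial.coe_monomial (R := QT) d 1
    rw [← h2, MvPolynomial.monomial_eq, map_one, one_mul, Finsupp.prod, Finsupp.prod]
    rw [← MvPolynomial.coeToMvPowerSeries.ringHom_apply, map_prod]
    simp
  rw [MvPowerSeries.coeff_subst (hasSubst_letters n 1 id), finsum_eq_single _ e]
  · rw [hmon e he, MvPowerSeries.coeff_monomial_same, smul_eq_mul, mul_one]
  · intro d hd
    by_cases h : d.support ⊆ range n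
    · rw [hmon d h, MvPowerSeries.coeff_monomial, if_neg hd.symm, smul_zero]
    · obtain ⟨j, hj, hjn⟩ := not_subset.1 h
      rw [Finsupp.prod, prod_eq_zero hj, map_zero, smul_zero]
      rw [letters, if_neg (by simpa using hjn), zero_pow (Finsupp.mem_support_iff.1 hj)]

variable {C : Type*} [Fintype C] [DecidableEq C]

theorem coeff_subst_letters {f : PS} {w : (C → ℕ) → QT}
    (hf : ∀ d, MvPowerSeries.coeff d f = ∑ σ ∈ weightFillings C d, w σ) (e : ℕ →₀ ℕ) :
    MvPowerSeries.coeff e (MvPowerSeries.subst (letters m z v) f) =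
      ∑ σ ∈ Fintype.piFinset (fun _ : C => range m),
        if ∑ c, Finsupp.single (v (σ c)) 1 = e then w σ * ∏ c, z (σ c) else 0 := by
  classical
  set S := Fintype.piFinset (fun _ : C => range m) with hS
  set wt : (C → ℕ) → (ℕ →₀ ℕ) := fun σ => ∑ c, Finsupp.single (σ c) 1 with hwt
  have hmem : ∀ d σ, σ ∈ weightFillings C d ↔ wt σ = d := by
    intro d σ
    rw [mem_weightFillings, DFunLike.ext_iff]
    simp_rw [hwt, sum_single_apply]
  have hprod : ∀ σ : C → ℕ, (wt σ).prod (fun s k => letters m z v s ^ k) =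
      ∏ c, letters m z v (σ c) := by
    intro σ
    rw [hwt, ← Finsupp.prod_finsetSum_index (fun _ => pow_zero _) (fun _ _ _ => pow_add _ _ _)]
    refine prod_congr rfl fun c _ => ?_
    rw [Finsupp.prod_single_index (h := fun s k => letters m z v s ^ k) (pow_zero _), pow_one]
  have hcoeff : ∀ σ ∈ S, MvPowerSeries.coeff e (∏ c, letters m z v (σ c)) =
      if ∑ c, Finsupp.single (v (σ c)) 1 = e then ∏ c, z (σ c) else 0 := by
    intro σ hσ
    have h1 : ∏ c, letters m z v (σ c) =
        (∏ c, z (σ c)) • MvPowerSeries.monomial (∑ c, Finsupp.single (v (σ c)) 1) (1 : QT) := by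
      have h2 : ∀ c, letters m z v (σ c) = z (σ c) • MvPowerSeries.X (v (σ c)) := fun c => by
        rw [letters, if_pos (mem_range.1 (Fintype.mem_piFinset.1 hσ c))]
      simp_rw [h2, MvPowerSeries.smul_eq_C_mul, prod_mul_distrib, ← map_prod]
      congr 1
      generalize (univ : Finset C) = s
      induction s using Finset.induction_on with
      | empty => simp
      | insert c s hc ih =>
        rw [prod_insert hc, sum_insert hc, ih, MvPowerSeries.X, MvPowerSeries.monomial_mul_monomial,
          one_mul]
    rw [h1, MvPowerSeries.coeff_smul, MvPowerSeries.coeff_monomial]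
    by_cases h : ∑ c, Finsupp.single (v (σ c)) 1 = e
    · rw [if_pos h, if_pos h.symm, mul_one]
    · rw [if_neg h, if_neg fun h' => h h'.symm, mul_zero]
  have hzero : ∀ σ ∉ S, ∏ c, letters m z v (σ c) = 0 := by
    intro σ hσ
    rw [hS, Fintype.mem_piFinset, not_forall] at hσ
    obtain ⟨c, hc⟩ := hσ
    exact prod_eq_zero (mem_univ c) (by rw [letters, if_neg (by simpa using hc)])
  have hterm : ∀ d : ℕ →₀ ℕ, MvPowerSeries.coeff d f •
      MvPowerSeries.coeff e (d.prod fun s k => letters m z v s ^ k) =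
      ∑ σ ∈ S with wt σ = d, w σ * MvPowerSeries.coeff e (∏ c, letters m z v (σ c)) := by
    intro d
    rw [hf, smul_eq_mul, sum_mul]
    symm
    refine sum_subset_zero_on_sdiff (fun σ hσ => (hmem d σ).2 (mem_filter.1 hσ).2) ?_ ?_
    · intro σ hσ
      rw [mem_sdiff, hmem] at hσ
      rw [← hσ.1, hprod, hzero, map_zero, mul_zero]
      exact fun h => hσ.2 (mem_filter.2 ⟨h, hσ.1⟩)
    · intro σ hσ
      rw [← (mem_filter.1 hσ).2, hprod]
  rw [MvPowerSeries.coeff_subst (hasSubst_letters m z v),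
    finsum_eq_sum_of_support_subset (s := S.image wt)]
  · simp_rw [hterm]
    rw [sum_fiberwise_of_maps_to fun σ hσ => mem_image_of_mem wt hσ]
    refine sum_congr rfl fun σ hσ => ?_
    rw [hcoeff σ hσ, mul_ite, mul_zero]
  · intro d hd
    rw [Function.mem_support, hterm] at hd
    obtain ⟨σ, hσ, -⟩ := exists_ne_zero_of_sum_ne_zero hd
    rw [mem_filter] at hσ
    exact mem_coe.2 (mem_image.2 ⟨σ, hσ.1, hσ.2⟩)

/-- The coefficients of a polynomial in power series depending linearly on a parameter are
polynomials in the parameter. -/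
theorem exists_polynomial_coeff_aeval (u : ℕ → QT) (b : ℕ → PS) (F : MvPolynomial ℕ QT) :
    ∀ e : ℕ →₀ ℕ, ∃ P : Polynomial QT, ∀ x, MvPowerSeries.coeff e
      (MvPolynomial.aeval (fun k => (u k + x) • b k) F) = P.eval x := by
  classical
  have hmul : ∀ g h : QT → PS,
      (∀ e : ℕ →₀ ℕ, ∃ P : Polynomial QT, ∀ x, MvPowerSeries.coeff e (g x) = P.eval x) →
      (∀ e : ℕ →₀ ℕ, ∃ P : Polynomial QT, ∀ x, MvPowerSeries.coeff e (h x) = P.eval x) →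
      ∀ e : ℕ →₀ ℕ, ∃ P : Polynomial QT, ∀ x, MvPowerSeries.coeff e (g x * h x) = P.eval x := by
    intro g h hg hh e
    choose P hP using hg
    choose Q hQ using hh
    refine ⟨∑ y ∈ antidiagonal e, P y.1 * Q y.2, fun x => ?_⟩
    rw [MvPowerSeries.coeff_mul, Polynomial.eval_finsetSum]
    exact sum_congr rfl fun y _ => by rw [hP, hQ, Polynomial.eval_mul]
  induction F using MvPolynomial.induction_on with
  | C a =>
    intro e
    exact ⟨Polynomial.C (MvPowerSeries.coeff e (algebraMap QT PS a)), fun x => by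
      rw [MvPolynomial.aeval_C, Polynomial.eval_C]⟩
  | add F G hF hG =>
    intro e
    obtain ⟨P, hP⟩ := hF e
    obtain ⟨Q, hQ⟩ := hG e
    exact ⟨P + Q, fun x => by rw [map_add, map_add, hP, hQ, Polynomial.eval_add]⟩
  | mul_X F k hF =>
    simp_rw [map_mul]
    refine hmul _ _ hF fun e => ?_
    refine ⟨(Polynomial.C (u k) + Polynomial.X) * Polynomial.C (MvPowerSeries.coeff e (b k)),
      fun x => ?_⟩
    rw [MvPolynomial.aeval_X, MvPowerSeries.coeff_smul]
    simp

theorem sum_range_mul_eq {M : Type*} [AddCommMonoid M] (n N : ℕ) (F : ℕ → M) :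
    ∑ j ∈ range (n * N), F j = ∑ i ∈ range n, ∑ c ∈ range N, F (i * N + c) := by
  induction n with
  | zero => simp
  | succ n ih => rw [Nat.succ_mul, sum_range_add, ih, sum_range_succ]

/-- The scalars of the alphabet `(x_0 + ⋯ + x_{n-1})(t + N)`. -/
noncomputable def superScalar (n j : ℕ) : QT := if j < n then t else 1

/-- The variables of the alphabet `(x_0 + ⋯ + x_{n-1})(t + N)`. -/
def superVar (n N j : ℕ) : ℕ := if j < n then j else n - 1 - (j - n) / N

/-- The letters `t x_0, …, t x_{n-1}` are followed by `N` copies each of `x_{n-1}, …, x_0`. The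
reversed order of the copies has no effect here, but it becomes the order of the negative letters.
-/
theorem subst_superLetters_powerSum (n N k : ℕ) (hk : k ≠ 0) :
    MvPowerSeries.subst (letters (n + n * N) (superScalar n) (superVar n N)) (powerSum k) =
      (t ^ k + N) • ∑ i ∈ range n, (MvPowerSeries.X i : PS) ^ k := by
  rw [subst_letters_powerSum _ _ _ k hk, sum_range_add, sum_range_mul_eq, add_smul, smul_sum]
  congr 1
  · refine sum_congr rfl fun i hi => ?_
    rw [mem_range] at hi
    rw [superScalar, superVar, if_pos hi, if_pos hi]
  · rw [← sum_range_reflect, smul_sum]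
    refine sum_congr rfl fun i hi => ?_
    rw [mem_range] at hi
    have : ∀ c ∈ range N, superScalar n (n + ((n - 1 - i) * N + c)) ^ k •
        (MvPowerSeries.X (superVar n N (n + ((n - 1 - i) * N + c))) : PS) ^ k =
        (MvPowerSeries.X i : PS) ^ k := by
      intro c hc
      rw [mem_range] at hc
      have h1 : ((n - 1 - i) * N + c) / N = n - 1 - i := by
        rw [add_comm, Nat.add_mul_div_right _ _ (by omega), Nat.div_eq_of_lt hc, zero_add]
      rw [superScalar, superVar, if_neg (by omega), if_neg (by omega), one_pow, one_smul,
        Nat.add_sub_cancel_left, h1, Nat.sub_sub_self (by omega)]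
    rw [sum_congr rfl this, sum_const, card_range, Nat.cast_smul_eq_nsmul]

end Alphabets

end Macdonald

namespace Macdonald

/-! ### Superization -/

section Superization

variable {C : Type*} [Fintype C] [DecidableEq C]

/-- The comparison of the letters in the cells `d` and `c` of a signed filling, with absolute values
`a` and negative letters on `s`: the positive letters come first, in increasing order, and are
followed by the negative letters in decreasing order. -/
def superRel (a : C → ℕ) (s : Finset C) (E : C → C → Prop) (d c : C) : Prop :=
  if c ∈ s then d ∈ s → a c < a d ∨ (a c = a d ∧ E d c) else d ∉ s ∧ a d < a c

theorem relWeight_congr {R : Type*} [CommRing R] {p : C → ℤ} {W : C → C → R} {r r' : C → C → Prop}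
    [DecidableRel r] [DecidableRel r'] (h : ∀ c d, p c < p d → (r d c ↔ r' d c)) :
    relWeight p W r = relWeight p W r' := by
  refine prod_congr rfl fun c _ => prod_congr rfl fun d _ => ?_
  by_cases hp : p c < p d
  · simp only [hp, true_and, h c d hp]
  · simp only [hp, false_and]

/-- The filling by numbers corresponding to a signed filling. -/
def superFilling (n N : ℕ) (a : C → ℕ) (s : Finset C) (g : C → ℕ) (c : C) : ℕ :=
  if c ∈ s then n + ((n - 1 - a c) * N + g c) else a c

theorem superFilling_lt_iff {n N : ℕ} {a : C → ℕ} {s : Finset C} {g : C → ℕ}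
    (ha : ∀ c, a c < n) (hg : ∀ c ∈ s, g c < N) (d c : C) :
    superFilling n N a s g d < superFilling n N a s g c ↔
      superRel a s (fun d c => g d < g c) d c := by
  unfold superFilling superRel
  have hc := ha c
  have hd := ha d
  by_cases h1 : c ∈ s <;> by_cases h2 : d ∈ s <;> simp only [h1, h2, if_true, if_false, forall_const,
    not_true, not_false_iff, true_and, false_and, false_implies, iff_true, iff_false]
  · have h3 := hg c h1
    have h4 := hg d h2
    rcases lt_trichotomy (a c) (a d) with h | h | h
    · simp only [h, true_or, iff_true]
      have : (n - 1 - a d + 1) * N ≤ (n - 1 - a c) * N := Nat.mul_le_mul_right _ (by omega)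
      rw [Nat.succ_mul] at this
      omega
    · simp [h]
    · have h5 : ¬ a c < a d := h.not_gt
      have h6 : a c ≠ a d := h.ne'
      simp only [h5, h6, false_and, or_self, iff_false]
      have : (n - 1 - a c + 1) * N ≤ (n - 1 - a d) * N := Nat.mul_le_mul_right _ (by omega)
      rw [Nat.succ_mul] at this
      omega
  · omega
  · omega

theorem superVar_superFilling {n N : ℕ} {a : C → ℕ} {s : Finset C} {g : C → ℕ}
    (ha : ∀ c, a c < n) (hg : ∀ c ∈ s, g c < N) (c : C) :
    superVar n N (superFilling n N a s g c) = a c := by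
  have hc := ha c
  unfold superFilling superVar
  by_cases h : c ∈ s
  · have h3 := hg c h
    have h1 : ((n - 1 - a c) * N + g c) / N = n - 1 - a c := by
      rw [add_comm, Nat.add_mul_div_right _ _ (by omega), Nat.div_eq_of_lt h3, zero_add]
    rw [if_pos h, if_neg (by omega), Nat.add_sub_cancel_left, h1]
    omega
  · rw [if_neg h, if_pos hc]

theorem superFilling_lt {n N : ℕ} {a : C → ℕ} {s : Finset C} {g : C → ℕ}
    (ha : ∀ c, a c < n) (hg : ∀ c ∈ s, g c < N) (c : C) :
    superFilling n N a s g c < n + n * N := by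
  have hc := ha c
  unfold superFilling
  by_cases h : c ∈ s
  · have h3 := hg c h
    have : (n - 1 - a c + 1) * N ≤ n * N := Nat.mul_le_mul_right _ (by omega)
    rw [Nat.succ_mul] at this
    rw [if_pos h]
    omega
  · rw [if_neg h]
    omega

theorem le_superFilling_iff {n N : ℕ} {a : C → ℕ} {s : Finset C} {g : C → ℕ}
    (ha : ∀ c, a c < n) (c : C) : n ≤ superFilling n N a s g c ↔ c ∈ s := by
  have hc := ha c
  unfold superFilling
  by_cases h : c ∈ s
  · simp [h]
  · simp only [h, if_false, iff_false]
    omega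

/-- A letter is decoded by division with remainder by `N` into an absolute value, a sign and, for a
negative letter, the number of its copy, which only breaks ties. -/
theorem sum_piFinset_superFilling {M : Type*} [AddCommMonoid M] (n N : ℕ) (F : (C → ℕ) → M) :
    ∑ σ ∈ Fintype.piFinset (fun _ : C => range (n + n * N)), F σ =
      ∑ a ∈ Fintype.piFinset (fun _ : C => range n), ∑ s : Finset C, ∑ g ∈ boxFunctions s N,
        F (superFilling n N a s g) := by
  have h : ∀ a : C → ℕ, ∑ s : Finset C, ∑ g ∈ boxFunctions s N, F (superFilling n N a s g) =
      ∑ x ∈ (univ : Finset (Finset C)).sigma fun s => boxFunctions s N,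
        F (superFilling n N a x.1 x.2) := fun a => Finset.sum_sigma' _ _ _
  simp_rw [h]
  rw [← Finset.sum_product']
  symm
  refine Finset.sum_bij' (fun x _ => superFilling n N x.1 x.2.1 x.2.2)
    (fun σ _ => (fun c => superVar n N (σ c), ⟨univ.filter fun c => n ≤ σ c, fun c => if n ≤ σ c then (σ c - n) % N else 0⟩))
    ?_ ?_ ?_ ?_ ?_
  · rintro ⟨a, s, g⟩ hx
    simp only [mem_product, mem_sigma, Fintype.mem_piFinset, mem_range, mem_boxFunctions] at hx ⊢
    exact superFilling_lt hx.1 hx.2.2.1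
  · intro σ hσ
    simp only [mem_product, mem_sigma, Fintype.mem_piFinset, mem_range, mem_boxFunctions,
      mem_univ, true_and, mem_filter] at hσ ⊢
    have hN : ∀ c, n ≤ σ c → 0 < N := fun c hc => by
      rcases Nat.eq_zero_or_pos N with h | h
      · have := hσ c
        rw [h, mul_zero] at this
        omega
      · exact h
    refine ⟨fun c => ?_, fun c hc => ?_, fun c hc => ?_⟩
    · rw [superVar]
      split_ifs with h
      · exact h
      · have := hσ c
        have : 0 < n := by
          rcases Nat.eq_zero_or_pos n with h0 | h0
          · rw [h0, zero_mul] at this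
            omega
          · exact h0
        generalize (σ c - n) / N = x
        omega
    · rw [if_pos hc]
      exact Nat.mod_lt _ (hN c hc)
    · rw [if_neg hc]
  · rintro ⟨a, s, g⟩ hx
    simp only [mem_product, mem_sigma, Fintype.mem_piFinset, mem_range, mem_boxFunctions,
      mem_univ, true_and] at hx
    obtain ⟨ha, hg, hg0⟩ := hx
    simp only [superVar_superFilling ha hg, le_superFilling_iff ha]
    refine Prod.ext rfl ?_
    simp only
    have hs : ({c | c ∈ s} : Finset C) = s := by ext; simp
    rw [hs]
    congr 1
    funext c
    by_cases h : c ∈ s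
    · have := hg c h
      rw [if_pos h, superFilling, if_pos h, Nat.add_sub_cancel_left, add_comm,
        Nat.add_mul_mod_self_right, Nat.mod_eq_of_lt this]
    · rw [if_neg h, hg0 c h]
  · intro σ hσ
    simp only [Fintype.mem_piFinset, mem_range] at hσ
    funext c
    have := hσ c
    simp only [superFilling, superVar, mem_filter, mem_univ, true_and]
    by_cases h : n ≤ σ c
    · rw [if_pos h, if_pos h, if_neg (by omega)]
      have h1 : (σ c - n) / N < n := Nat.div_lt_of_lt_mul (by rw [mul_comm]; omega)
      rw [Nat.sub_sub_self (Nat.le_sub_one_of_lt h1), mul_comm,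
        Nat.div_add_mod]
      omega
    · rw [if_neg h, if_pos (by omega)]
  · intro x _
    rfl

/-- The plethysm with `X(t-1)` is the value at `N = -1` of the substitution of the alphabets
`X(t+N)`. -/
theorem exists_polynomial_superization (F : MvPolynomial ℕ QT) (e : ℕ →₀ ℕ) :
    ∃ n, e.support ⊆ range n ∧ ∃ P : Polynomial QT,
      MvPowerSeries.coeff e (MvPolynomial.aeval (fun k => alphabetXt (k + 1)) F) = P.eval (-1) ∧
      ∀ N : ℕ, P.eval (N : QT) = MvPowerSeries.coeff e (MvPowerSeries.subst
        (letters (n + n * N) (superScalar n) (superVar n N))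
        (MvPolynomial.aeval (fun k => powerSum (k + 1)) F)) := by
  obtain ⟨n, hn⟩ : ∃ n, e.support ⊆ range n :=
    ⟨e.support.sup id + 1, fun i hi => mem_range.2 (Nat.lt_succ_of_le (le_sup (f := id) hi))⟩
  set b : ℕ → PS := fun k => ∑ i ∈ range n, (MvPowerSeries.X i : PS) ^ (k + 1) with hb
  have hmap : ∀ (φ : PS →ₐ[QT] PS) (u : ℕ → PS),
      φ (MvPolynomial.aeval u F) = MvPolynomial.aeval (fun k => φ (u k)) F :=
    fun φ u => by
      have h := DFunLike.congr_fun (MvPolynomial.comp_aeval u φ) F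
      rw [AlgHom.comp_apply] at h
      exact h
  obtain ⟨P, hP⟩ := exists_polynomial_coeff_aeval (fun k => t ^ (k + 1)) b F e
  refine ⟨n, hn, P, ?_, fun N => ?_⟩
  · rw [← hP, ← coeff_subst_letters_id hn, ← MvPowerSeries.coe_substAlgHom (hasSubst_letters n 1 id),
      hmap]
    congr 3
    funext k
    rw [alphabetXt, map_smul, MvPowerSeries.coe_substAlgHom,
      subst_letters_powerSum _ _ _ _ k.succ_ne_zero, ← sub_eq_add_neg]
    congr 1
    refine sum_congr rfl fun i _ => ?_
    rw [Pi.one_apply, one_pow, one_smul, id]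
  · rw [← hP, ← MvPowerSeries.coe_substAlgHom (hasSubst_letters _ _ _), hmap]
    congr 3
    funext k
    rw [MvPowerSeries.coe_substAlgHom, subst_superLetters_powerSum _ _ _ k.succ_ne_zero]

open Classical in
/-- The superization formula for the alphabet `X(t-1)`. -/
theorem coeff_aeval_alphabetXt {p : C → ℤ} {W : C → C → QT} {f : PS}
    (hf : ∀ d, MvPowerSeries.coeff d f =
      ∑ σ ∈ weightFillings C d, relWeight p W fun d c => σ d < σ c)
    {F : MvPolynomial ℕ QT} (hF : MvPolynomial.aeval (fun k => powerSum (k + 1)) F = f)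
    (e : ℕ →₀ ℕ) :
    MvPowerSeries.coeff e (MvPolynomial.aeval (fun k => alphabetXt (k + 1)) F) =
      ∑ a ∈ weightFillings C e, ∑ s : Finset C, (-1) ^ #s * t ^ #sᶜ *
        relWeight p W (superRel a s fun _ _ => True) := by
  obtain ⟨n, hn, P, h1, hP⟩ := exists_polynomial_superization F e
  have hmem : ∀ a : C → ℕ, a ∈ weightFillings C e ↔
      a ∈ Fintype.piFinset (fun _ : C => range n) ∧ ∑ c, Finsupp.single (a c) 1 = e := by
    intro a
    rw [weightFillings, mem_filter]
    refine ⟨fun h => ⟨Fintype.mem_piFinset.2 fun c => hn (Fintype.mem_piFinset.1 h.1 c), h.2⟩,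
      fun h => ⟨Fintype.mem_piFinset.2 fun c => ?_, h.2⟩⟩
    rw [← h.2, Finsupp.mem_support_iff, sum_single_apply, card_ne_zero]
    exact ⟨c, by simp⟩
  -- For fixed absolute values and signs the weight depends on the copies only through their
  -- inversions, which is the input required by reciprocity.
  let V : (C → ℕ) → Finset C → Finset (C × C) → QT := fun a s E =>
    relWeight p W (superRel a s fun d c => (c, d) ∈ E)
  choose Q hQ hQ' using fun (a : C → ℕ) (s : Finset C) =>
    exists_polynomial_sum_boxFunctions p s (V a s)
  -- Both polynomials agree at all natural numbers. At `-1` equal negative letters then always count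
  -- as inversions.
  have h2 : P = ∑ a ∈ weightFillings C e, ∑ s : Finset C, Polynomial.C (t ^ #sᶜ) * Q a s := by
    refine Polynomial.eq_of_infinite_eval_eq _ _
      ((Set.infinite_range_of_injective (Nat.cast_injective (R := QT))).mono ?_)
    rintro _ ⟨N, rfl⟩
    rw [Set.mem_ofPred_eq, hP, hF]
    have hWF : weightFillings C e = {a ∈ Fintype.piFinset (fun _ : C => range n) |
        ∑ c, Finsupp.single (a c) 1 = e} := by
      ext a
      rw [hmem, mem_filter]
    rw [coeff_subst_letters _ _ _ hf, sum_piFinset_superFilling, Polynomial.eval_finsetSum,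
      hWF, sum_filter]
    refine sum_congr rfl fun a ha => ?_
    replace ha : ∀ c, a c < n := fun c => mem_range.1 (Fintype.mem_piFinset.1 ha c)
    by_cases he : ∑ c, Finsupp.single (a c) 1 = e
    · rw [if_pos he, Polynomial.eval_finsetSum]
      refine sum_congr rfl fun s _ => ?_
      rw [Polynomial.eval_mul, Polynomial.eval_C, hQ, mul_sum]
      refine sum_congr rfl fun g hg => ?_
      rw [mem_boxFunctions] at hg
      simp only [superVar_superFilling ha hg.1]
      rw [if_pos he, mul_comm]
      congr 1
      · have : ∀ c, superScalar n (superFilling n N a s g c) = if c ∈ sᶜ then t else 1 := by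
          intro c
          have := le_superFilling_iff (n := n) (N := N) (s := s) (g := g) ha c
          rw [superScalar]
          by_cases hc : c ∈ s
          · rw [if_neg (by simpa using this.2 hc), if_neg (by simpa using hc)]
          · rw [if_pos (by rw [← this] at hc; simpa using hc), if_pos (mem_compl.2 hc)]
        simp_rw [this]
        rw [prod_ite_mem, univ_inter, prod_const]
      · refine relWeight_congr fun c d hcd => ?_
        rw [superFilling_lt_iff ha hg.1]
        unfold superRel
        by_cases hc : c ∈ s
        · by_cases hd : d ∈ s
          · simp [hc, hd, invPairs, hcd]
          · simp [hd]
        · simp [hc]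
    · rw [if_neg he]
      refine sum_eq_zero fun s _ => sum_eq_zero fun g hg => ?_
      rw [mem_boxFunctions] at hg
      simp only [superVar_superFilling ha hg.1]
      rw [if_neg he]
  rw [h1, h2, Polynomial.eval_finsetSum]
  refine sum_congr rfl fun a _ => ?_
  rw [Polynomial.eval_finsetSum]
  refine sum_congr rfl fun s _ => ?_
  rw [Polynomial.eval_mul, Polynomial.eval_C, hQ']
  have : V a s {e ∈ s ×ˢ s | p e.1 < p e.2} = relWeight p W (superRel a s fun _ _ => True) := by
    refine relWeight_congr fun c d hcd => ?_
    unfold superRel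
    by_cases hc : c ∈ s
    · by_cases hd : d ∈ s
      · simp [hc, hd, hcd]
      · simp [hd]
    · simp [hc]
  rw [this]
  ring

/-- Plethysm with `X(t-1)` does not depend on the expression by power sums. -/
theorem aeval_alphabetXt_eq_zero {F : MvPolynomial ℕ QT}
    (hF : MvPolynomial.aeval (fun k => powerSum (k + 1)) F = 0) :
    MvPolynomial.aeval (fun k => alphabetXt (k + 1)) F = 0 := by
  ext e
  obtain ⟨n, hn, P, h1, hP⟩ := exists_polynomial_superization F e
  -- On each alphabet `X(t+N)` the plethysm is a genuine substitution and sends `0` to `0`, so `P`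
  -- has infinitely many zeros.
  have h2 : P = 0 := by
    refine Polynomial.eq_of_infinite_eval_eq _ _
      ((Set.infinite_range_of_injective (Nat.cast_injective (R := QT))).mono ?_)
    rintro _ ⟨N, rfl⟩
    rw [Set.mem_ofPred_eq, hP, hF, ← MvPowerSeries.coe_substAlgHom (hasSubst_letters _ _ _),
      map_zero, map_zero, Polynomial.eval_zero]
  rw [h1, h2, Polynomial.eval_zero, map_zero]

end Superization

end Macdonald

namespace Macdonald

/-! ### Cancellation of signed fillings -/

section Cancellation

variable {mu : YoungDiagram}

theorem card_row_interval (mu : YoungDiagram) (r lo hi : ℕ) (h : hi ≤ mu.rowLen r) :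
    #{c : mu.cells | c.1.1 = r ∧ lo ≤ c.1.2 ∧ c.1.2 < hi} = hi - lo := by
  rw [← Nat.card_Ico]
  refine card_bij' (fun c _ => c.1.2)
    (fun j hj => ⟨(r, j), YoungDiagram.mem_iff_lt_rowLen.2 ((mem_Ico.1 hj).2.trans_le h)⟩) ?_ ?_ ?_ ?_
  · intro c hc
    exact mem_Ico.2 (mem_filter.1 hc).2.2
  · intro j hj
    exact mem_filter.2 ⟨mem_univ _, rfl, mem_Ico.1 hj⟩
  · intro c hc
    exact Subtype.ext (Prod.ext (mem_filter.1 hc).2.1.symm rfl)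
  · intro j hj
    rfl

theorem prod_ite_q (P : mu.cells → Prop) [DecidablePred P] :
    ∏ c, (if P c then q else 1) = q ^ #{c | P c} := by
  rw [← prod_filter, prod_const]

theorem snd_lt_rowLen (c : mu.cells) : c.1.2 < mu.rowLen c.1.1 :=
  YoungDiagram.mem_iff_lt_rowLen.1 (show (c.1.1, c.1.2) ∈ mu from c.2)

open Classical in
theorem prod_pairFactor_left (u : mu.cells) :
    ∏ c : mu.cells, (if c.1.1 = u.1.1 ∧ c.1.2 < u.1.2 then pairFactor c u else 1) = q ^ u.1.2 := by
  have h : ∀ c : mu.cells, (if c.1.1 = u.1.1 ∧ c.1.2 < u.1.2 then pairFactor c u else 1) =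
      if c.1.1 = u.1.1 ∧ 0 ≤ c.1.2 ∧ c.1.2 < u.1.2 then q else 1 := by
    intro c
    by_cases h : c.1.1 = u.1.1 ∧ c.1.2 < u.1.2
    · rw [if_pos h, if_pos ⟨h.1, Nat.zero_le _, h.2⟩, pairFactor, if_pos]
      refine Or.inl ⟨fun h' => ?_, h.1⟩
      rw [h'] at h
      exact lt_irrefl _ h.2
    · rw [if_neg h, if_neg fun h' => h ⟨h'.1, h'.2.2⟩]
  simp_rw [h]
  rw [prod_ite_q, card_row_interval _ _ _ _ (snd_lt_rowLen u).le, Nat.sub_zero]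

open Classical in
theorem prod_pairFactor_right (u : mu.cells) :
    ∏ d : mu.cells, (if d.1.1 = u.1.1 ∧ u.1.2 < d.1.2 then pairFactor u d else 1) = q ^ arm u := by
  have h : ∀ d : mu.cells, (if d.1.1 = u.1.1 ∧ u.1.2 < d.1.2 then pairFactor u d else 1) =
      if d.1.1 = u.1.1 ∧ u.1.2 + 1 ≤ d.1.2 ∧ d.1.2 < mu.rowLen u.1.1 then q else 1 := by
    intro d
    by_cases h : d.1.1 = u.1.1 ∧ u.1.2 < d.1.2
    · rw [if_pos h, if_pos ⟨h.1, h.2, h.1 ▸ snd_lt_rowLen d⟩, pairFactor, if_pos]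
      refine Or.inl ⟨fun h' => ?_, h.1.symm⟩
      rw [h'] at h
      exact lt_irrefl _ h.2
    · rw [if_neg h, if_neg fun h' => h ⟨h'.1, h'.2.1⟩]
  simp_rw [h]
  rw [prod_ite_q, card_row_interval _ _ _ _ le_rfl, arm]

open Classical in
-- The attacking cells in the next row contribute `q` to the arm of the cell above `u`, which the
-- factor of that cell cancels. What remains is its leg plus one, the leg of `u`. Without a cell
-- above, both sides are `1`.
theorem prod_pairFactor_upper (u : mu.cells) :
    ∏ c : mu.cells, (if u.1.1 < c.1.1 then pairFactor c u else 1) = t ^ leg u := by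
  have h : ∀ c : mu.cells, (if u.1.1 < c.1.1 then pairFactor c u else 1) =
      (if c.1.1 = u.1.1 + 1 ∧ u.1.2 + 1 ≤ c.1.2 ∧ c.1.2 < mu.rowLen (u.1.1 + 1) then q else 1) *
        if IsAbove c u then q ^ (-(arm c : ℤ)) * t ^ (leg c + 1) else 1 := by
    intro c
    by_cases h : u.1.1 < c.1.1
    swap
    · rw [if_neg h, if_neg (by omega), if_neg (fun h' => by have := h'.1; omega), one_mul]
    rw [if_pos h, pairFactor]
    by_cases h' : IsAbove c u
    · have h1 := h'.1
      have h2 := h'.2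
      rw [if_pos h', if_neg, if_neg (by omega), one_mul]
      unfold Attack
      omega
    · rw [if_neg h', mul_one]
      have h1 : Attack c u ↔ c.1.1 = u.1.1 + 1 ∧ u.1.2 + 1 ≤ c.1.2 ∧
          c.1.2 < mu.rowLen (u.1.1 + 1) := by
        have := snd_lt_rowLen c
        unfold Attack
        constructor
        · intro h2
          have h3 : c.1.1 = u.1.1 + 1 := by omega
          rw [h3] at this
          omega
        · intro h2
          exact Or.inr (Or.inl ⟨h2.1, h2.2.1⟩)
      by_cases h2 : Attack c u
      · rw [if_pos h2, if_pos (h1.1 h2)]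
      · rw [if_neg h2, if_neg fun h3 => h2 (h1.2 h3)]
  simp_rw [h, prod_mul_distrib]
  rw [prod_ite_q, card_row_interval _ _ _ _ le_rfl]
  by_cases hc : (u.1.1 + 1, u.1.2) ∈ mu
  · have h1 : IsAbove (⟨(u.1.1 + 1, u.1.2), hc⟩ : mu.cells) u := ⟨rfl, rfl⟩
    rw [prod_eq_single (⟨(u.1.1 + 1, u.1.2), hc⟩ : mu.cells), if_pos h1, ← mul_assoc, ← zpow_natCast,
      ← zpow_add₀ q_ne_zero]
    · have h2 : mu.rowLen (u.1.1 + 1) - (u.1.2 + 1) = arm (⟨(u.1.1 + 1, u.1.2), hc⟩ : mu.cells) := rfl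
      rw [h2, add_neg_cancel, zpow_zero, one_mul]
      congr 1
      have := YoungDiagram.mem_iff_lt_colLen.1 hc
      simp only [leg]
      omega
    · intro c _ hne
      refine if_neg fun h' => hne ?_
      exact Subtype.ext (Prod.ext h'.1 h'.2)
    · exact fun h' => absurd (mem_univ _) h'
  · rw [prod_eq_one, mul_one]
    · have h1 : mu.colLen u.1.2 ≤ u.1.1 + 1 := by
        rw [YoungDiagram.mem_iff_lt_colLen] at hc
        omega
      rw [YoungDiagram.mem_iff_lt_rowLen] at hc
      rw [show mu.rowLen (u.1.1 + 1) - (u.1.2 + 1) = 0 by omega, leg,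
        show mu.colLen u.1.2 - (u.1.1 + 1) = 0 by omega, pow_zero, pow_zero]
    · intro c _
      refine if_neg fun h' => hc ?_
      rw [← h'.1, ← h'.2]
      exact c.2

open Classical in
theorem prod_pairFactor_lower (u : mu.cells) (hu : 0 < u.1.1) :
    ∏ d : mu.cells, (if d.1.1 < u.1.1 then pairFactor u d else 1) =
      q ^ u.1.2 * (q ^ (-(arm u : ℤ)) * t ^ (leg u + 1)) := by
  have hbelow : (u.1.1 - 1, u.1.2) ∈ mu :=
    mu.up_left_mem (Nat.sub_le _ _) le_rfl (show (u.1.1, u.1.2) ∈ mu from u.2)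
  have h : ∀ d : mu.cells, (if d.1.1 < u.1.1 then pairFactor u d else 1) =
      (if d.1.1 = u.1.1 - 1 ∧ 0 ≤ d.1.2 ∧ d.1.2 < u.1.2 then q else 1) *
        if IsAbove u d then q ^ (-(arm u : ℤ)) * t ^ (leg u + 1) else 1 := by
    intro d
    by_cases h : d.1.1 < u.1.1
    swap
    · rw [if_neg h, if_neg (by omega), if_neg (fun h' => by have := h'.1; omega), one_mul]
    rw [if_pos h, pairFactor]
    by_cases h' : IsAbove u d
    · have h1 := h'.1
      have h2 := h'.2
      rw [if_pos h', if_neg, if_neg (by omega), one_mul]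
      unfold Attack
      omega
    · rw [if_neg h', mul_one]
      have h1 : Attack u d ↔ d.1.1 = u.1.1 - 1 ∧ 0 ≤ d.1.2 ∧ d.1.2 < u.1.2 := by
        unfold Attack
        omega
      by_cases h2 : Attack u d
      · rw [if_pos h2, if_pos (h1.1 h2)]
      · rw [if_neg h2, if_neg fun h3 => h2 (h1.2 h3)]
  simp_rw [h, prod_mul_distrib]
  rw [prod_ite_q, card_row_interval _ _ _ _ (YoungDiagram.mem_iff_lt_rowLen.1 hbelow).le, Nat.sub_zero]
  have h1 : IsAbove u (⟨(u.1.1 - 1, u.1.2), hbelow⟩ : mu.cells) := ⟨by simp only; omega, rfl⟩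
  rw [prod_eq_single (⟨(u.1.1 - 1, u.1.2), hbelow⟩ : mu.cells), if_pos h1]
  · intro d _ hne
    exact if_neg fun h' => hne (h'.eq h1)
  · exact fun h' => absurd (mem_univ _) h'

open Classical in
theorem prod_pairFactor_before (u : mu.cells) :
    ∏ c, (if position c < position u then pairFactor c u else 1) = q ^ u.1.2 * t ^ leg u := by
  rw [← prod_pairFactor_left, ← prod_pairFactor_upper, ← prod_mul_distrib]
  refine prod_congr rfl fun c _ => ?_
  have hp := precedes_iff c u
  unfold Precedes at hp
  simp only [← hp]
  rcases lt_trichotomy u.1.1 c.1.1 with h | h | h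
  · simp [h, h.ne']
  · simp [h]
  · simp [h.ne, h.not_gt]

open Classical in
-- Compared with `prod_pairFactor_before` there is exactly one more `t`. This balances the factor
-- `t` lost when the letter in `u` becomes negative.
theorem prod_pairFactor_after (u : mu.cells) (hu : 0 < u.1.1) :
    ∏ d, (if position u < position d then pairFactor u d else 1) = q ^ u.1.2 * t ^ (leg u + 1) := by
  have h1 : q ^ u.1.2 * t ^ (leg u + 1) =
      q ^ arm u * (q ^ u.1.2 * (q ^ (-(arm u : ℤ)) * t ^ (leg u + 1))) := by
    rw [zpow_neg, zpow_natCast]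
    field_simp [q_ne_zero]
  rw [h1, ← prod_pairFactor_right, ← prod_pairFactor_lower u hu, ← prod_mul_distrib]
  refine prod_congr rfl fun d _ => ?_
  have hp := precedes_iff u d
  unfold Precedes at hp
  simp only [← hp]
  rcases lt_trichotomy u.1.1 d.1.1 with h | h | h
  · simp [h.ne, h.ne', h.not_gt]
  · simp [h]
  · simp [h, h.ne]

theorem prod_prod_eq_erase {C R : Type*} [Fintype C] [DecidableEq C] [CommRing R] (f : C → C → R)
    (u : C) (hu : f u u = 1) : ∏ c, ∏ d, f c d =
      (∏ c ∈ univ.erase u, ∏ d ∈ univ.erase u, f c d) * ((∏ c, f c u) * ∏ d, f u d) := by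
  rw [← mul_prod_erase univ (fun c => ∏ d, f c d) (mem_univ u),
    ← mul_prod_erase univ (fun c => f c u) (mem_univ u), hu, one_mul]
  have : ∀ c ∈ univ.erase u, ∏ d, f c d = f c u * ∏ d ∈ univ.erase u, f c d := fun c _ =>
    (mul_prod_erase univ (fun d => f c d) (mem_univ u)).symm
  rw [prod_congr rfl this, prod_mul_distrib]
  ring

open Classical in
/-- The signed fillings with a letter that is too small for its row cancel. -/
theorem sum_superRel_eq_zero (a : mu.cells → ℕ) (ha : ∃ c, a c < c.1.1) :
    ∑ s : Finset mu.cells, (-1) ^ #s * t ^ #sᶜ *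
      relWeight position pairFactor (superRel a s fun _ _ => True) = 0 := by
  -- The sign of `u` is flipped, where `u` holds the least of the letters that are too small and is
  -- the first such cell in reading order. Then every earlier cell holds a larger absolute value,
  -- and no later cell with a nontrivial factor holds a smaller one, since it would be too small for
  -- its row as well.
  obtain ⟨c₀, hc₀⟩ := ha
  obtain ⟨c₁, hc₁, hmin₁⟩ := exists_min_image ({c | a c < c.1.1} : Finset mu.cells) a
    ⟨c₀, by simpa using hc₀⟩
  obtain ⟨u, hu, hmin₂⟩ := exists_min_image ({c | a c < c.1.1 ∧ a c = a c₁} : Finset mu.cells)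
    position ⟨c₁, by simpa using hc₁⟩
  simp only [mem_filter, mem_univ, true_and] at hc₁ hmin₁ hu hmin₂
  have h1 : ∀ c, position c < position u → a u < a c := by
    intro c hc
    have hrow : u.1.1 ≤ c.1.1 := by
      rw [← precedes_iff] at hc
      unfold Precedes at hc
      omega
    by_contra h
    have h2 : a c < c.1.1 := by omega
    have h3 := hmin₁ c h2
    exact absurd (hmin₂ c ⟨h2, by omega⟩) hc.not_ge
  have h2 : ∀ d, position u < position d → a u ≤ a d ∨ pairFactor u d = 1 := by
    intro d hd
    by_contra! h
    have hrow : u.1.1 ≤ d.1.1 + 1 := by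
      by_contra hrow
      refine h.2 ?_
      rw [pairFactor, if_neg, if_neg]
      · intro h'
        have := h'.1
        omega
      · unfold Attack
        intro h'
        omega
    have := hmin₁ d (by omega)
    omega
  have hun : (univ : Finset (Finset mu.cells)) = (insert u (univ.erase u)).powerset := by
    rw [insert_erase (mem_univ u), powerset_univ]
  rw [hun, sum_powerset_insert (notMem_erase u univ), ← sum_add_distrib]
  refine sum_eq_zero fun s hs => ?_
  have hus : u ∉ s := fun h => notMem_erase u univ (mem_powerset.1 hs h)
  have hsplit : ∀ S : Finset mu.cells,
      relWeight position pairFactor (superRel a S fun _ _ => True) =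
      (∏ c ∈ univ.erase u, ∏ d ∈ univ.erase u, if position c < position d ∧
        superRel a S (fun _ _ => True) d c then pairFactor c d else 1) *
      ((∏ c, if position c < position u ∧ superRel a S (fun _ _ => True) u c then
        pairFactor c u else 1) *
      ∏ d, if position u < position d ∧ superRel a S (fun _ _ => True) d u then
        pairFactor u d else 1) := fun S =>
    prod_prod_eq_erase _ u (if_neg fun h => lt_irrefl _ h.1)
  have hK : (∏ c ∈ univ.erase u, ∏ d ∈ univ.erase u, if position c < position d ∧
        superRel a (insert u s) (fun _ _ => True) d c then pairFactor c d else 1) =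
      ∏ c ∈ univ.erase u, ∏ d ∈ univ.erase u, if position c < position d ∧
        superRel a s (fun _ _ => True) d c then pairFactor c d else 1 := by
    refine prod_congr rfl fun c hc => prod_congr rfl fun d hd => ?_
    have hc' := ne_of_mem_erase hc
    have hd' := ne_of_mem_erase hd
    simp only [superRel, mem_insert, hc', hd', false_or]
  have hA : (∏ c, if position c < position u ∧ superRel a s (fun _ _ => True) u c then
      pairFactor c u else 1) = q ^ u.1.2 * t ^ leg u := by
    rw [← prod_pairFactor_before]
    refine prod_congr rfl fun c _ => ?_
    by_cases hc : position c < position u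
    · have : superRel a s (fun _ _ => True) u c := by
        unfold superRel
        by_cases hcs : c ∈ s <;> simp [hcs, hus, h1 c hc]
      simp [hc, this]
    · simp [hc]
  have hB : (∏ d, if position u < position d ∧ superRel a s (fun _ _ => True) d u then
      pairFactor u d else 1) = 1 := by
    refine prod_eq_one fun d _ => ?_
    by_cases hd : position u < position d
    · rcases h2 d hd with h | h
      · refine if_neg fun h' => ?_
        have := h'.2
        unfold superRel at this
        rw [if_neg hus] at this
        omega
      · rw [h, ite_self]
    · exact if_neg fun h => hd h.1
  have hA' : (∏ c, if position c < position u ∧ superRel a (insert u s) (fun _ _ => True) u c then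
      pairFactor c u else 1) = 1 := by
    refine prod_eq_one fun c _ => if_neg fun h => ?_
    have h3 := h1 c h.1
    have h4 := h.2
    unfold superRel at h4
    simp only [mem_insert_self, forall_const, not_true, false_and, and_true] at h4
    split_ifs at h4
    omega
  have hB' : (∏ d, if position u < position d ∧ superRel a (insert u s) (fun _ _ => True) d u then
      pairFactor u d else 1) = q ^ u.1.2 * t ^ (leg u + 1) := by
    rw [← prod_pairFactor_after u (by omega)]
    refine prod_congr rfl fun d _ => ?_
    by_cases hd : position u < position d
    · rcases h2 d hd with h | h
      · have : superRel a (insert u s) (fun _ _ => True) d u := by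
          unfold superRel
          rw [if_pos (mem_insert_self _ _)]
          intro _
          rw [and_true]
          omega
        simp [hd, this]
      · rw [h, ite_self, ite_self]
    · simp [hd]
  have hcard : #sᶜ = #(insert u s)ᶜ + 1 := by
    rw [compl_insert, card_erase_of_mem (mem_compl.2 hus), Nat.sub_add_cancel]
    exact card_pos.2 ⟨u, mem_compl.2 hus⟩
  -- A positive `u` is in inversion with every earlier cell, a negative one with every later cell,
  -- up to factors `1`. The two terms differ only by the sign.
  rw [hsplit, hsplit, hK, hA, hB, hA', hB', card_insert_of_notMem hus, hcard]
  ring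

open Classical in
/-- The signed fillings whose absolute values are the row indices. -/
theorem sum_superRel_row (mu : YoungDiagram) :
    ∑ s : Finset mu.cells, (-1) ^ #s * t ^ #sᶜ *
      relWeight position pairFactor (superRel (fun c => c.1.1) s fun _ _ => True) =
      ∏ c : mu.cells, (t ^ (leg c + 1) - q ^ arm c) := by
  have h1 : ∀ s : Finset mu.cells,
      relWeight position pairFactor (superRel (fun c => c.1.1) s fun _ _ => True) =
      (∏ c ∈ s, q ^ arm c) * ∏ c ∈ sᶜ, t ^ leg c := by
    intro s
    have h2 : ∀ c d : mu.cells, (if position c < position d ∧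
        superRel (fun c => c.1.1) s (fun _ _ => True) d c then pairFactor c d else 1) =
        (if c ∈ s then if d.1.1 = c.1.1 ∧ c.1.2 < d.1.2 then pairFactor c d else 1 else 1) *
        (if d ∈ sᶜ then if d.1.1 < c.1.1 then pairFactor c d else 1 else 1) := by
      intro c d
      have hp := precedes_iff c d
      unfold Precedes at hp
      unfold superRel
      simp only [← hp, mem_compl]
      rcases lt_trichotomy d.1.1 c.1.1 with h | h | h
      · by_cases hc : c ∈ s <;> by_cases hd : d ∈ s <;> simp [hc, hd, h, h.ne, h.not_gt, h.ne']
      · by_cases hc : c ∈ s <;> by_cases hd : d ∈ s <;> simp [hc, hd, h]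
      · by_cases hc : c ∈ s <;> by_cases hd : d ∈ s <;> simp [h.not_gt, h.ne, h.ne']
    rw [relWeight]
    simp_rw [h2, prod_mul_distrib]
    congr 1
    · rw [← prod_subset (subset_univ s) (fun c _ hc => prod_eq_one fun d _ => if_neg hc)]
      refine prod_congr rfl fun c hc => ?_
      rw [← prod_pairFactor_right]
      exact prod_congr rfl fun d _ => if_pos hc
    · rw [prod_comm, ← prod_subset (subset_univ sᶜ) (fun c _ hc => prod_eq_one fun d _ => if_neg hc)]
      refine prod_congr rfl fun c hc => ?_
      rw [← prod_pairFactor_upper]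
      exact prod_congr rfl fun d _ => if_pos hc
  have h3 : ∀ c : mu.cells, t ^ (leg c + 1) - q ^ arm c = -1 * q ^ arm c + t * t ^ leg c := by
    intro c
    ring
  simp_rw [h3]
  rw [Fintype.prod_add]
  refine sum_congr rfl fun s _ => ?_
  rw [h1, prod_mul_distrib, prod_mul_distrib, prod_const, prod_const]
  ring

theorem card_filter_subtype (a : mu.cells → ℕ) (i : ℕ) :
    #{x ∈ mu.cells | (if h : x ∈ mu.cells then a ⟨x, h⟩ else 0) = i} = #{c | a c = i} := by
  symm
  refine card_bij (fun c _ => c.1) (fun c hc => ?_) (fun c _ d _ h => Subtype.ext h)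
    fun x hx => ?_
  · rw [mem_filter] at hc ⊢
    exact ⟨c.2, by rw [dif_pos c.2]; exact hc.2⟩
  · rw [mem_filter] at hx
    refine ⟨⟨x, hx.1⟩, ?_, rfl⟩
    rw [mem_filter]
    have := hx.2
    rw [dif_pos hx.1] at this
    exact ⟨mem_univ _, this⟩

variable {F : MvPolynomial ℕ QT}

/-- After the cancellation all absolute values are at least the row index, and counting cells by
rows bounds the partial sums of `e`. -/
theorem coeff_plethysm_macdonaldH_ne_zero
    (hF : MvPolynomial.aeval (fun k => powerSum (k + 1)) F = macdonaldH mu) {e : ℕ →₀ ℕ}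
    (he : MvPowerSeries.coeff e (MvPolynomial.aeval (fun k => alphabetXt (k + 1)) F) ≠ 0) :
    e.degree = mu.card ∧ ∀ k, ∑ i ∈ range k, e i ≤ ∑ i ∈ range k, mu.rowLen i := by
  classical
  rw [coeff_aeval_alphabetXt (coeff_macdonaldH mu) hF] at he
  obtain ⟨a, ha, hne⟩ := exists_ne_zero_of_sum_ne_zero he
  have hrow : ∀ c : mu.cells, c.1.1 ≤ a c := by
    by_contra! h
    exact hne (sum_superRel_eq_zero a h)
  refine ⟨?_, fun k => ?_⟩
  · rw [weightFillings, mem_filter] at ha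
    rw [← ha.2, map_sum]
    simp
  · rw [mem_weightFillings] at ha
    simp_rw [← ha, ← card_filter_subtype]
    exact sum_range_card_le mu _ (fun c hc => by rw [dif_pos hc]; exact hrow ⟨c, hc⟩) k

/-- At the exponent `μ` the bound is attained, so the absolute values are the row indices and only
the signs remain to be summed. -/
theorem coeff_plethysm_macdonaldH_self
    (hF : MvPolynomial.aeval (fun k => powerSum (k + 1)) F = macdonaldH mu) :
    MvPowerSeries.coeff (partsExp mu) (MvPolynomial.aeval (fun k => alphabetXt (k + 1)) F) =
      ∏ c : mu.cells, (t ^ (leg c + 1) - q ^ arm c) := by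
  classical
  rw [coeff_aeval_alphabetXt (coeff_macdonaldH mu) hF, sum_eq_single fun c => c.1.1,
    sum_superRel_row]
  · intro a ha hne
    refine sum_superRel_eq_zero a ?_
    by_contra! h
    refine hne (funext fun c => ?_)
    rw [mem_weightFillings] at ha
    have := eq_row_of_card_eq mu (fun x => if h : x ∈ mu.cells then a ⟨x, h⟩ else 0)
      (fun c hc => by rw [dif_pos hc]; exact h ⟨c, hc⟩)
      (fun i => by rw [card_filter_subtype, ha, partsExp_apply]) c.1 c.2
    simpa using this
  · intro h
    refine absurd ?_ h
    rw [mem_weightFillings]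
    intro k
    rw [partsExp_apply, ← card_filter_subtype, YoungDiagram.rowLen_eq_card, YoungDiagram.row]
    congr 1
    refine filter_congr fun x hx => ?_
    rw [dif_pos hx]

end Cancellation

end Macdonald

namespace Macdonald

/-! ### Supports and leading terms of cumulants -/

section Support

/-- A power series is supported on a set of exponents. -/
def SupportedOn (S : Set (ℕ →₀ ℕ)) (f : PS) : Prop :=
  ∀ e, MvPowerSeries.coeff e f ≠ 0 → e ∈ S

theorem SupportedOn.mul {S T U : Set (ℕ →₀ ℕ)} {f g : PS} (hf : SupportedOn S f)
    (hg : SupportedOn T g) (h : ∀ x ∈ S, ∀ y ∈ T, x + y ∈ U) : SupportedOn U (f * g) := by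
  classical
  intro e he
  rw [MvPowerSeries.coeff_mul] at he
  obtain ⟨x, hx, hne⟩ := exists_ne_zero_of_sum_ne_zero he
  rw [← HasAntidiagonal.mem_antidiagonal.1 hx]
  exact h _ (hf _ (left_ne_zero_of_mul hne)) _ (hg _ (right_ne_zero_of_mul hne))

theorem SupportedOn.sum {ι : Type*} {S : Set (ℕ →₀ ℕ)} {s : Finset ι} {f : ι → PS}
    (h : ∀ i ∈ s, SupportedOn S (f i)) : SupportedOn S (∑ i ∈ s, f i) := by
  intro e he
  rw [map_sum] at he
  obtain ⟨i, hi, hne⟩ := exists_ne_zero_of_sum_ne_zero he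
  exact h i hi e hne

theorem SupportedOn.smul {S : Set (ℕ →₀ ℕ)} {f : PS} (a : QT) (h : SupportedOn S f) :
    SupportedOn S (a • f) := by
  intro e he
  rw [MvPowerSeries.coeff_smul] at he
  exact h e (right_ne_zero_of_mul he)

theorem SupportedOn.prod {ι M : Type*} [DecidableEq ι] [AddCommMonoid M] {S : M → Set (ℕ →₀ ℕ)}
    (h0 : (0 : ℕ →₀ ℕ) ∈ S 0) (hS : ∀ a b, ∀ x ∈ S a, ∀ y ∈ S b, x + y ∈ S (a + b)) (s : Finset ι)
    {f : ι → PS} {β : ι → M} (h : ∀ i ∈ s, SupportedOn (S (β i)) (f i)) :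
    SupportedOn (S (∑ i ∈ s, β i)) (∏ i ∈ s, f i) := by
  classical
  induction s using Finset.induction_on with
  | empty =>
    intro e he
    rw [prod_empty, MvPowerSeries.coeff_one] at he
    have : e = 0 := by
      by_contra h'
      exact he (if_neg h')
    rw [this, sum_empty]
    exact h0
  | insert i s hi ih =>
    rw [prod_insert hi, sum_insert hi]
    exact (h i (mem_insert_self _ _)).mul (ih fun j hj => h j (mem_insert_of_mem hj)) (hS _ _)

theorem intCoeff_mul_eq_smul (n : ℕ) (f : PS) :
    ((-1) ^ (n - 1) * ((n - 1).factorial : PS)) * f =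
      ((-1) ^ (n - 1) * ((n - 1).factorial : QT)) • f := by
  rw [Algebra.smul_def]
  congr 1
  simp

theorem sum_sum_parts {ι M : Type*} [DecidableEq ι] [AddCommMonoid M] {A : Finset ι}
    (π : Finpartition A) (β : ι → M) : ∑ B ∈ π.parts, ∑ j ∈ B, β j = ∑ j ∈ A, β j := by
  conv_rhs => rw [← π.biUnion_parts, sum_biUnion π.supIndep.pairwiseDisjoint]
  rfl

/-- The blocks of a set partition have the same total as `A`, so every summand satisfies the same
bound. Stated for a general additive grading, it serves both degree and dominance. -/
theorem SupportedOn.cumulant {ι M : Type*} [DecidableEq ι] [AddCommMonoid M]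
    {S : M → Set (ℕ →₀ ℕ)} (h0 : (0 : ℕ →₀ ℕ) ∈ S 0)
    (hS : ∀ a b, ∀ x ∈ S a, ∀ y ∈ S b, x + y ∈ S (a + b)) {u : Finset ι → PS} {β : ι → M}
    (h : ∀ B, SupportedOn (S (∑ j ∈ B, β j)) (u B)) (A : Finset ι) :
    SupportedOn (S (∑ j ∈ A, β j)) (cumulant u A) := by
  refine SupportedOn.sum fun π _ => ?_
  rw [intCoeff_mul_eq_smul]
  refine SupportedOn.smul _ ?_
  have := SupportedOn.prod h0 hS π.parts (f := u) (β := fun B => ∑ j ∈ B, β j) fun B _ => h B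
  rwa [sum_sum_parts] at this

/-- The exponents that are smaller than or equal to `b` in the dominance order. -/
def dominanceLower (b : ℕ →₀ ℕ) : Set (ℕ →₀ ℕ) :=
  {e | e.degree = b.degree ∧ ∀ k, ∑ i ∈ range k, e i ≤ ∑ i ∈ range k, b i}

theorem zero_mem_dominanceLower : (0 : ℕ →₀ ℕ) ∈ dominanceLower 0 := ⟨rfl, fun _ => le_rfl⟩

theorem add_mem_dominanceLower (a b : ℕ →₀ ℕ) : ∀ x ∈ dominanceLower a, ∀ y ∈ dominanceLower b,
    x + y ∈ dominanceLower (a + b) := by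
  intro x hx y hy
  refine ⟨by rw [map_add, map_add, hx.1, hy.1], fun k => ?_⟩
  simp only [Finsupp.add_apply, sum_add_distrib]
  exact add_le_add (hx.2 k) (hy.2 k)

/-- If `x + y = a + b` and the partial sums of `x` and `y` are at most those of `a` and `b`, they
are all equal, so only one term contributes. -/
theorem coeff_mul_leading {a b : ℕ →₀ ℕ} {f g : PS} (hf : SupportedOn (dominanceLower a) f)
    (hg : SupportedOn (dominanceLower b) g) : MvPowerSeries.coeff (a + b) (f * g) =
      MvPowerSeries.coeff a f * MvPowerSeries.coeff b g := by
  classical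
  rw [MvPowerSeries.coeff_mul, sum_eq_single (a, b)]
  · rintro ⟨x, y⟩ hxy hne
    rw [HasAntidiagonal.mem_antidiagonal] at hxy
    by_contra h
    have hx := (hf x (left_ne_zero_of_mul h)).2
    have hy := (hg y (right_ne_zero_of_mul h)).2
    simp only at hxy
    have hsum : ∀ k, ∑ i ∈ range k, x i = ∑ i ∈ range k, a i := by
      intro k
      have h1 : ∑ i ∈ range k, (x + y) i = ∑ i ∈ range k, (a + b) i := by rw [hxy]
      simp only [Finsupp.add_apply, sum_add_distrib] at h1
      have := hx k
      have := hy k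
      omega
    have hxa : x = a := by
      ext k
      have h1 := hsum (k + 1)
      rw [sum_range_succ, sum_range_succ, hsum k] at h1
      exact Nat.add_left_cancel h1
    rw [hxa] at hxy
    exact hne (Prod.ext hxa (add_left_cancel hxy))
  · intro h
    rw [HasAntidiagonal.mem_antidiagonal] at h
    exact (h rfl).elim

theorem coeff_prod_leading {ι : Type*} [DecidableEq ι] (s : Finset ι) {f : ι → PS}
    {β : ι → ℕ →₀ ℕ} (h : ∀ i ∈ s, SupportedOn (dominanceLower (β i)) (f i)) :
    MvPowerSeries.coeff (∑ i ∈ s, β i) (∏ i ∈ s, f i) =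
      ∏ i ∈ s, MvPowerSeries.coeff (β i) (f i) := by
  classical
  induction s using Finset.induction_on with
  | empty => simp
  | insert i s hi ih =>
    have h' := fun j hj => h j (mem_insert_of_mem (a := j) (b := i) (s := s) hj)
    rw [prod_insert hi, sum_insert hi, prod_insert hi, coeff_mul_leading (h i (mem_insert_self _ _))
      (SupportedOn.prod zero_mem_dominanceLower add_mem_dominanceLower s h'), ih h']

theorem coeff_cumulant_leading {ι : Type*} [DecidableEq ι] {u : Finset ι → PS}
    {β : ι → ℕ →₀ ℕ} (h : ∀ B, SupportedOn (dominanceLower (∑ j ∈ B, β j)) (u B)) (A : Finset ι) :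
    MvPowerSeries.coeff (∑ j ∈ A, β j) (cumulant u A) =
      cumulant (fun B => MvPowerSeries.coeff (∑ j ∈ B, β j) (u B)) A := by
  rw [cumulant, map_sum, cumulant]
  refine sum_congr rfl fun π _ => ?_
  rw [intCoeff_mul_eq_smul, MvPowerSeries.coeff_smul]
  congr 1
  rw [← coeff_prod_leading π.parts (f := u) (β := fun B => ∑ j ∈ B, β j) fun B _ => h B,
    sum_sum_parts]

end Support

/-! ### Triangularity of the fully colored polynomials -/

section FullyColored

variable (mu : YoungDiagram)

/-- The columns of `μ`. -/
def columns (j : Fin (mu.rowLen 0)) : YoungDiagram := column (mu.colLen j)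

theorem mem_column (k : ℕ) (c : ℕ × ℕ) : c ∈ column k ↔ c.1 < k ∧ c.2 = 0 := by
  rw [← YoungDiagram.mem_cells, column, mem_product, mem_range, mem_singleton]

theorem rowLen_column (k i : ℕ) : (column k).rowLen i = if i < k then 1 else 0 := by
  refine eq_of_forall_lt_iff fun j => ?_
  rw [← YoungDiagram.mem_iff_lt_rowLen, mem_column]
  split_ifs with h
  · simp [h]
  · simp [h]

theorem rowLen_oplus_columns (B : Finset (Fin (mu.rowLen 0))) (i : ℕ) :
    (oplus B (columns mu)).rowLen i = #(B.filter fun j : Fin (mu.rowLen 0) => i < mu.colLen j) := by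
  rw [rowLen_oplus, card_filter]
  exact sum_congr rfl fun j _ => rowLen_column _ _

theorem oplus_columns_univ : oplus univ (columns mu) = mu := by
  refine eq_of_rowLen_eq fun i => ?_
  rw [rowLen_oplus_columns]
  have h : ({j | i < mu.colLen j} : Finset (Fin (mu.rowLen 0))).map Fin.valEmbedding =
      range (mu.rowLen i) := by
    ext x
    simp only [mem_map, mem_filter, mem_univ, true_and, Fin.valEmbedding_apply, mem_range]
    rw [← YoungDiagram.mem_iff_lt_rowLen]
    constructor
    · rintro ⟨j, hj, rfl⟩
      exact YoungDiagram.mem_iff_lt_colLen.2 hj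
    · intro hx
      exact ⟨⟨x, (YoungDiagram.mem_iff_lt_rowLen.1 hx).trans_le (mu.rowLen_anti _ _ (Nat.zero_le i))⟩,
        YoungDiagram.mem_iff_lt_colLen.1 hx, rfl⟩
  rw [← card_range (mu.rowLen i), ← h, card_map]

theorem partsExp_oplus {ι : Type*} (B : Finset ι) (lam : ι → YoungDiagram) :
    partsExp (oplus B lam) = ∑ j ∈ B, partsExp (lam j) := by
  ext i
  rw [partsExp_apply, rowLen_oplus, Finsupp.finsetSum_apply]
  rfl

theorem card_oplus {ι : Type*} (B : Finset ι) (lam : ι → YoungDiagram) :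
    (oplus B lam).card = ∑ j ∈ B, (lam j).card := by
  rw [← degree_partsExp, partsExp_oplus, map_sum]
  simp_rw [degree_partsExp]

theorem fullyColored_eq : fullyColored mu = ((q - 1) ^ (mu.rowLen 0 - 1))⁻¹ •
    cumulant (fun B => macdonaldH (oplus B (columns mu))) univ := rfl

theorem fullyColored_mem : fullyColored mu ∈ SymFun := by
  rw [fullyColored_eq]
  refine SymFun.smul_mem (SymFun.sum_mem fun π _ => ?_) _
  rw [intCoeff_mul_eq_smul]
  exact SymFun.smul_mem (SymFun.prod_mem fun B _ => macdonaldH_mem _) _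

theorem degree_of_coeff_fullyColored {e : ℕ →₀ ℕ}
    (h : MvPowerSeries.coeff e (fullyColored mu) ≠ 0) : e.degree = mu.card := by
  rw [fullyColored_eq] at h
  have h1 := (SupportedOn.cumulant (S := fun n : ℕ => {e | e.degree = n}) (map_zero _)
    (fun a b x hx y hy => by
      rw [Set.mem_ofPred_eq] at hx hy ⊢
      rw [map_add, hx, hy])
    (u := fun B => macdonaldH (oplus B (columns mu))) (β := fun j => (columns mu j).card)
    (fun B e he => by
      rw [Set.mem_ofPred_eq, degree_of_coeff_macdonaldH he, card_oplus]) univ).smul _ e h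
  rw [Set.mem_ofPred_eq, ← card_oplus, oplus_columns_univ] at h1
  exact h1

/-- Cumulants commute with ring homomorphisms, so the cumulant of power sum expressions of the
factors is an expression of `H̄_μ`, and the plethysm can be taken factor by factor. -/
theorem exists_plethysm_fullyColored : ∃ F : MvPolynomial ℕ QT,
    MvPolynomial.aeval (fun k => powerSum (k + 1)) F = fullyColored mu ∧
    SupportedOn (dominanceLower (partsExp mu))
      (MvPolynomial.aeval (fun k => alphabetXt (k + 1)) F) ∧
    MvPowerSeries.coeff (partsExp mu) (MvPolynomial.aeval (fun k => alphabetXt (k + 1)) F) =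
      ((q - 1) ^ (mu.rowLen 0 - 1))⁻¹ * cumulant (fun B =>
        ∏ c : (oplus B (columns mu)).cells, (t ^ (leg c + 1) - q ^ arm c)) univ := by
  choose F hF using fun B => exists_aeval_powerSum (macdonaldH_mem (oplus B (columns mu)))
  have hmap : ∀ φ : MvPolynomial ℕ QT →ₐ[QT] PS,
      φ (((q - 1) ^ (mu.rowLen 0 - 1))⁻¹ • cumulant F univ) =
      ((q - 1) ^ (mu.rowLen 0 - 1))⁻¹ • cumulant (fun B => φ (F B)) univ := by
    intro φ
    rw [map_smul]
    congr 1
    exact (cumulant_map (φ : MvPolynomial ℕ QT →+* PS) F univ).symm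
  have hsupp : ∀ B, SupportedOn (dominanceLower (∑ j ∈ B, partsExp (columns mu j)))
      (MvPolynomial.aeval (fun k => alphabetXt (k + 1)) (F B)) := by
    intro B e he
    rw [← partsExp_oplus]
    obtain ⟨h1, h2⟩ := coeff_plethysm_macdonaldH_ne_zero (hF B) he
    exact ⟨by rw [h1, degree_partsExp], h2⟩
  have hmu : partsExp mu = ∑ j, partsExp (columns mu j) := by
    rw [← partsExp_oplus, oplus_columns_univ]
  refine ⟨((q - 1) ^ (mu.rowLen 0 - 1))⁻¹ • cumulant F univ, ?_, ?_, ?_⟩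
  · rw [hmap, fullyColored_eq]
    simp_rw [hF]
  · rw [hmap, hmu]
    exact (SupportedOn.cumulant zero_mem_dominanceLower add_mem_dominanceLower hsupp univ).smul _
  · rw [hmap, MvPowerSeries.coeff_smul, hmu, coeff_cumulant_leading hsupp]
    congr 2
    funext B
    rw [← partsExp_oplus, coeff_plethysm_macdonaldH_self (hF B)]

end FullyColored

end Macdonald

namespace Macdonald

/-! ### Arm-leg products by columns -/

section Rank

variable {ι : Type*} [LinearOrder ι]

theorem card_filter_lt_strictMonoOn {B : Finset ι} {j j' : ι} (hj : j ∈ B) (h : j < j') :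
    #{k ∈ B | k < j} < #{k ∈ B | k < j'} := by
  refine card_lt_card (Finset.ssubset_iff_subset_ne.2 ⟨fun k hk => ?_, fun h' => ?_⟩)
  · rw [mem_filter] at hk ⊢
    exact ⟨hk.1, hk.2.trans h⟩
  · have : j ∈ ({k ∈ B | k < j} : Finset ι) := h' ▸ mem_filter.2 ⟨hj, h⟩
    exact lt_irrefl _ (mem_filter.1 this).2

theorem exists_card_filter_lt_eq {B : Finset ι} {x : ℕ} (hx : x < #B) :
    ∃ j ∈ B, #{k ∈ B | k < j} = x := by
  have h : B.image (fun j => #{k ∈ B | k < j}) = range #B := by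
    refine eq_of_subset_of_card_le (fun y hy => ?_) ?_
    · obtain ⟨j, hj, rfl⟩ := mem_image.1 hy
      refine mem_range.2 (card_lt_card (filter_ssubset.2 ⟨j, hj, lt_irrefl _⟩))
    · rw [card_range, card_image_of_injOn]
      intro i hi j hj hij
      rcases lt_trichotomy i j with h | h | h
      · exact absurd hij (card_filter_lt_strictMonoOn hi h).ne
      · exact h
      · exact absurd hij (card_filter_lt_strictMonoOn hj h).ne'
  have hx' := mem_range.2 hx
  rw [← h] at hx'
  exact mem_image.1 hx'

variable {h : ι → ℕ}

/-- Column lengths decrease weakly, so the columns longer than `i` form an initial segment of `B`.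
Hence column `j` of the family has its rank in `B` as column index in the diagram. -/
theorem card_filter_lt_lt_iff (hh : Antitone h) {B : Finset ι} {j : ι} (hj : j ∈ B) (i : ℕ) :
    #{k ∈ B | k < j} < #{k ∈ B | i < h k} ↔ i < h j := by
  constructor
  · intro hlt
    by_contra hi
    refine hlt.not_ge (card_le_card fun k hk => ?_)
    rw [mem_filter] at hk ⊢
    refine ⟨hk.1, ?_⟩
    by_contra hkj
    have := hh (not_lt.1 hkj)
    omega
  · intro hi
    refine card_lt_card (Finset.ssubset_iff_subset_ne.2 ⟨fun k hk => ?_, fun h' => ?_⟩)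
    · rw [mem_filter] at hk ⊢
      exact ⟨hk.1, hi.trans_le (hh hk.2.le)⟩
    · have : j ∈ ({k ∈ B | k < j} : Finset ι) := h' ▸ mem_filter.2 ⟨hj, hi⟩
      exact lt_irrefl _ (mem_filter.1 this).2

theorem card_filter_lt_eq (hh : Antitone h) {B : Finset ι} {j : ι} (hj : j ∈ B) {i : ℕ}
    (hi : i < h j) :
    #{k ∈ B | i < h k} = #{k ∈ B | k < j} + 1 + #{k ∈ B | j < k ∧ i < h k} := by
  have h1 := card_filter_add_card_filter_not (s := ({k ∈ B | i < h k} : Finset ι)) (fun k => k < j)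
  have h2 : ({k ∈ ({k ∈ B | i < h k} : Finset ι) | k < j} : Finset ι) = {k ∈ B | k < j} := by
    ext k
    simp only [mem_filter, and_assoc]
    refine and_congr_right fun _ => ⟨fun h' => h'.2, fun h' => ⟨hi.trans_le (hh h'.le), h'⟩⟩
  have h3 : ({k ∈ ({k ∈ B | i < h k} : Finset ι) | ¬ k < j} : Finset ι) =
      insert j {k ∈ B | j < k ∧ i < h k} := by
    ext k
    simp only [mem_filter, mem_insert, not_lt]
    constructor
    · rintro ⟨⟨h4, h5⟩, h6⟩
      rcases h6.eq_or_lt with h7 | h7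
      · exact Or.inl h7.symm
      · exact Or.inr ⟨h4, h7, h5⟩
    · rintro (rfl | ⟨h4, h5, h6⟩)
      · exact ⟨⟨hj, hi⟩, le_rfl⟩
      · exact ⟨⟨h4, h6⟩, h5.le⟩
  rw [h2, h3, card_insert_of_notMem (by simp)] at h1
  omega

end Rank

section ColumnWeight

variable {ι R : Type*} [LinearOrder ι] [CommRing R]

/-- The product of the factors `z ^ (leg + 1) - y ^ arm` over the cells of the diagram with columns
of the lengths `h j`, `j ∈ B`. -/
def columnWeight (y z : R) (h : ι → ℕ) (B : Finset ι) : R :=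
  ∏ j ∈ B, ∏ i ∈ range (h j), (z ^ (h j - i) - y ^ #{k ∈ B | j < k ∧ i < h k})

theorem map_columnWeight {S : Type*} [CommRing S] (f : R →+* S) (y z : R) (h : ι → ℕ)
    (B : Finset ι) : f (columnWeight y z h B) = columnWeight (f y) (f z) h B := by
  simp [columnWeight, map_prod]

/-- The factor of column `j` involves only the later columns. Multiplied out over its cells, it is a
combination of products, over the later columns `k`, of powers of `y`, and these are congruent to
`1` modulo `y - 1`. -/
theorem pow_dvd_cumulant_columnWeight (y z : R) (h : ι → ℕ) {A : Finset ι} (hA : A.Nonempty) :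
    (y - 1) ^ (#A - 1) ∣ cumulant (columnWeight y z h) A := by
  let φ : ι → Finset ι → R := fun j S =>
    ∏ i ∈ range (h j), (z ^ (h j - i) - y ^ #{k ∈ S | i < h k})
  have hφ : columnWeight y z h = fun B => ∏ j ∈ B, φ j {k ∈ B | j < k} := by
    funext B
    simp only [columnWeight, φ, filter_filter]
  rw [hφ]
  refine pow_dvd_cumulant φ (fun j => (range (h j)).powerset)
    (fun j I => (∏ i ∈ I, z ^ (h j - i)) * (-1) ^ #(range (h j) \ I))
    (fun j I k => ∏ i ∈ range (h j) \ I, if i < h k then y else 1) ?_ ?_ A hA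
  · intro j I k
    generalize range (h j) \ I = s
    induction s using Finset.induction_on with
    | empty => simp
    | insert i s hi ih =>
      rw [prod_insert hi]
      have h1 : y - 1 ∣ (if i < h k then y else 1) - 1 := by
        split_ifs
        · exact dvd_rfl
        · simp
      generalize (if i < h k then y else 1) = a at h1
      have : a * (∏ i ∈ s, if i < h k then y else 1) - 1 =
        a * ((∏ i ∈ s, if i < h k then y else 1) - 1) + (a - 1) := by ring
      rw [this]
      exact dvd_add (ih.mul_left _) h1
  · intro j S
    simp only [φ, sub_eq_add_neg]
    rw [prod_add]
    refine sum_congr rfl fun I _ => ?_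
    rw [prod_neg, mul_assoc]
    congr 2
    rw [prod_comm]
    refine prod_congr rfl fun i _ => ?_
    rw [prod_ite, prod_const, prod_const_one, mul_one]

/-- At `z = 0` only minus the arm powers remain. A later column `k` is no longer than column `j`, so
it adds one to the arm of `h k` cells of column `j`. -/
theorem columnWeight_zero {h : ι → ℕ} (hh : Antitone h) (y : R) (B : Finset ι) :
    columnWeight y 0 h B = (∏ j ∈ B, (-1) ^ h j) * pairWeight y h B := by
  have h1 : ∀ j ∈ B, ∏ i ∈ range (h j), ((0 : R) ^ (h j - i) - y ^ #{k ∈ B | j < k ∧ i < h k}) =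
      (-1) ^ h j * ∏ k ∈ B, if j < k then y ^ h k else 1 := by
    intro j hj
    have h2 : ∀ i ∈ range (h j), (0 : R) ^ (h j - i) - y ^ #{k ∈ B | j < k ∧ i < h k} =
        -1 * y ^ #{k ∈ B | j < k ∧ i < h k} := by
      intro i hi
      rw [mem_range] at hi
      rw [zero_pow (by omega)]
      ring
    rw [prod_congr rfl h2, prod_mul_distrib, prod_const, card_range]
    congr 1
    have h3 : ∀ i, y ^ #{k ∈ B | j < k ∧ i < h k} = ∏ k ∈ B, if j < k ∧ i < h k then y else 1 := by
      intro i
      rw [prod_ite, prod_const, prod_const_one, mul_one]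
    simp_rw [h3]
    rw [prod_comm]
    refine prod_congr rfl fun k _ => ?_
    by_cases hjk : j < k
    · simp only [hjk, true_and, if_true]
      rw [prod_ite, prod_const, prod_const_one, mul_one]
      congr 1
      have h4 : ({i ∈ range (h j) | i < h k} : Finset ℕ) = range (h k) := by
        ext i
        rw [mem_filter, mem_range, mem_range]
        have := hh hjk.le
        omega
      rw [h4, card_range]
    · simp [hjk]
  rw [columnWeight, prod_congr rfl h1, prod_mul_distrib, pairWeight]
  congr 1
  rw [prod_comm]
  refine prod_congr rfl fun k _ => ?_
  rw [prod_ite, prod_const, prod_const_one, mul_one, pow_mul]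

theorem cumulant_prod_mul {ι : Type*} [DecidableEq ι] (s : ι → R) (u : Finset ι → R)
    (A : Finset ι) :
    cumulant (fun B => (∏ j ∈ B, s j) * u B) A = (∏ j ∈ A, s j) * cumulant u A := by
  rw [cumulant, cumulant, mul_sum]
  refine sum_congr rfl fun π _ => ?_
  have h : ∏ B ∈ π.parts, ∏ j ∈ B, s j = ∏ j ∈ A, s j := by
    conv_rhs => rw [← π.biUnion_parts, prod_biUnion π.supIndep.pairwiseDisjoint]
    rfl
  rw [prod_mul_distrib, h]
  ring

theorem aeval_int_eq_eval₂ (y : R) (P : Polynomial ℤ) :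
    Polynomial.aeval y P = P.eval₂ (Int.castRingHom R) y := rfl

/-- The only set partition has no blocks, and the truncated `0 - 1` is `0`, so its coefficient is
`1`. This is the case of the empty diagram. -/
theorem cumulant_empty {ι : Type*} [DecidableEq ι] (u : Finset ι → R) : cumulant u ∅ = 1 := by
  rw [cumulant_eq_sum_setPartitions, setPartitions_empty]
  simp

theorem cumulant_pairWeight_univ (y : R) (a : ℕ → ℕ) {n : ℕ} (hn : n ≠ 0) :
    cumulant (pairWeight y fun j : Fin n => a j) univ =
      (y - 1) ^ (n - 1) * Polynomial.aeval y (treePoly (n - 1) a) := by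
  obtain ⟨m, rfl⟩ := Nat.exists_eq_succ_of_ne_zero hn
  rw [Nat.succ_sub_one, ← cumulant_pairWeight_range]
  have h1 : (pairWeight y fun j : Fin (m + 1) => a j) =
      fun B => pairWeight y a (B.map Fin.valEmbedding) := by
    funext B
    rw [pairWeight, pairWeight, prod_map]
    refine prod_congr rfl fun k _ => ?_
    rw [filter_map, card_map]
    rfl
  have h2 : (univ : Finset (Fin (m + 1))).map Fin.valEmbedding = range (m + 1) := by
    rw [Fin.map_valEmbedding_univ, Nat.Iio_eq_range]
  rw [Nat.succ_eq_add_one, h1, cumulant_comp_map _ _ (by simp [pairWeight]), h2]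

end ColumnWeight

/-! ### The leading coefficient -/

section LeadingCoefficient

variable (mu : YoungDiagram)

theorem prod_cells_oplus_columns (B : Finset (Fin (mu.rowLen 0))) :
    ∏ c : (oplus B (columns mu)).cells, (t ^ (leg c + 1) - q ^ arm c) =
      columnWeight q t (fun j : Fin (mu.rowLen 0) => mu.colLen j) B := by
  set h : Fin (mu.rowLen 0) → ℕ := fun j => mu.colLen j with hdef
  have hh : Antitone h := fun i j hij => mu.colLen_anti _ _ hij
  have hrow : ∀ i, (oplus B (columns mu)).rowLen i = #{j ∈ B | i < h j} :=
    rowLen_oplus_columns mu B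
  have hmem : ∀ j ∈ B, ∀ i, (i, #{k ∈ B | k < j}) ∈ oplus B (columns mu) ↔ i < h j := by
    intro j hj i
    rw [YoungDiagram.mem_iff_lt_rowLen, hrow, card_filter_lt_lt_iff hh hj]
  have hcol : ∀ j ∈ B, (oplus B (columns mu)).colLen #{k ∈ B | k < j} = h j := by
    intro j hj
    refine eq_of_forall_lt_iff fun i => ?_
    rw [← YoungDiagram.mem_iff_lt_colLen, hmem j hj]
  rw [columnWeight, prod_sigma']
  symm
  refine prod_bij (fun x hx => ⟨(x.2, #{k ∈ B | k < x.1}),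
    (hmem _ (mem_sigma.1 hx).1 _).2 (mem_range.1 (mem_sigma.1 hx).2)⟩) (fun _ _ => mem_univ _)
    ?_ ?_ ?_
  · rintro ⟨j, i⟩ hx ⟨j', i'⟩ hx' heq
    rw [Subtype.mk.injEq, Prod.mk.injEq] at heq
    obtain ⟨rfl, h2⟩ := heq
    have hj := (mem_sigma.1 hx).1
    have hj' := (mem_sigma.1 hx').1
    rcases lt_trichotomy j j' with h3 | h3 | h3
    · exact absurd h2 (card_filter_lt_strictMonoOn hj h3).ne
    · rw [h3]
    · exact absurd h2 (card_filter_lt_strictMonoOn hj' h3).ne'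
  · rintro ⟨⟨i, x⟩, hc⟩ _
    have hx : x < #{j ∈ B | i < h j} := by
      rw [← hrow]
      exact YoungDiagram.mem_iff_lt_rowLen.1 hc
    obtain ⟨j, hj, rfl⟩ := exists_card_filter_lt_eq (hx.trans_le (card_filter_le _ _))
    exact ⟨⟨j, i⟩, mem_sigma.2 ⟨hj, mem_range.2 ((hmem j hj i).1 hc)⟩, rfl⟩
  · rintro ⟨j, i⟩ hx
    have hj := (mem_sigma.1 hx).1
    have hi : i < h j := mem_range.1 (mem_sigma.1 hx).2
    simp only [leg, arm, hrow, hcol j hj]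
    rw [card_filter_lt_eq hh hj hi, Nat.add_sub_cancel_left,
      show h j - (i + 1) + 1 = h j - i by omega]

theorem sum_colLen : ∑ j : Fin (mu.rowLen 0), mu.colLen j = mu.card := by
  conv_rhs => rw [← oplus_columns_univ mu, card_oplus]
  refine sum_congr rfl fun j _ => ?_
  rw [columns, column, YoungDiagram.card, card_product, card_range, card_singleton, mul_one]

/-- A polynomial in `q` and `t` is congruent modulo `t` to its value at `t = 0`. -/
theorem X_dvd_sub_aeval (G : MvPolynomial (Fin 2) ℤ) : MvPolynomial.X 1 ∣ G -
    Polynomial.aeval (MvPolynomial.X 0 : MvPolynomial (Fin 2) ℤ)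
      (MvPolynomial.aeval ![(Polynomial.X : Polynomial ℤ), 0] G) := by
  induction G using MvPolynomial.induction_on with
  | C a => simp
  | add F G hF hG =>
    rw [map_add, map_add, add_sub_add_comm]
    exact dvd_add hF hG
  | mul_X F i hF =>
    rw [map_mul, map_mul, MvPolynomial.aeval_X]
    fin_cases i
    · simp only [Fin.zero_eta, Matrix.cons_val_zero, Polynomial.aeval_X]
      rw [← sub_mul]
      exact hF.mul_right _
    · simp

theorem aeval_q_t_injective :
    Function.Injective (MvPolynomial.aeval ![q, t] : MvPolynomial (Fin 2) ℤ →ₐ[ℤ] QT) := by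
  have h : (MvPolynomial.aeval ![q, t] : MvPolynomial (Fin 2) ℤ →ₐ[ℤ] QT).toRingHom =
      (algebraMap (MvPolynomial (Fin 2) ℚ) QT).comp (MvPolynomial.map (Int.castRingHom ℚ)) := by
    refine MvPolynomial.ringHom_ext (fun a => by simp) fun i => ?_
    fin_cases i <;> simp [q, t]
  have h' : Function.Injective (MvPolynomial.aeval ![q, t] : MvPolynomial (Fin 2) ℤ →ₐ[ℤ] QT).toRingHom := by
    rw [h, RingHom.coe_comp]
    exact (IsFractionRing.injective (MvPolynomial (Fin 2) ℚ) QT).comp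
      (MvPolynomial.map_injective _ Int.cast_injective)
  exact h'

theorem q_sub_one_ne_zero : q - 1 ≠ 0 := by
  have h : MvPolynomial.aeval ![q, t] (MvPolynomial.X 0 - 1 : MvPolynomial (Fin 2) ℤ) = q - 1 := by
    simp
  rw [← h, Ne, map_eq_zero_iff _ aeval_q_t_injective]
  intro h'
  have := congrArg (MvPolynomial.eval fun _ => (0 : ℤ)) h'
  simp at this

theorem leadingCoefficient_spec : ∃ R : MvPolynomial (Fin 2) ℤ,
    ((q - 1) ^ (mu.rowLen 0 - 1))⁻¹ * cumulant (fun B =>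
      ∏ c : (oplus B (columns mu)).cells, (t ^ (leg c + 1) - q ^ arm c)) univ =
    (-1) ^ mu.card * Polynomial.aeval q (treePoly (mu.rowLen 0 - 1) mu.colLen) +
      t * MvPolynomial.aeval ![q, t] R ∧
    ((q - 1) ^ (mu.rowLen 0 - 1))⁻¹ * cumulant (fun B =>
      ∏ c : (oplus B (columns mu)).cells, (t ^ (leg c + 1) - q ^ arm c)) univ ≠ 0 := by
  simp_rw [prod_cells_oplus_columns]
  by_cases h0 : mu.rowLen 0 = 0
  · have hE : IsEmpty (Fin (mu.rowLen 0)) := by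
      rw [h0]
      infer_instance
    have hcard := sum_colLen mu
    rw [univ_eq_empty, sum_empty] at hcard
    refine ⟨0, ?_, ?_⟩
    · rw [univ_eq_empty, cumulant_empty, ← hcard, h0, treePoly_zero]
      simp
    · rw [univ_eq_empty, cumulant_empty, h0]
      simp
  set h : Fin (mu.rowLen 0) → ℕ := fun j => mu.colLen j with hdef
  have hh : Antitone h := fun i j hij => mu.colLen_anti _ _ hij
  have hne : (univ : Finset (Fin (mu.rowLen 0))).Nonempty :=
    ⟨⟨0, Nat.pos_of_ne_zero h0⟩, mem_univ _⟩
  -- The division is done in `ℤ[q,t]`, so that the quotient `G` has integer coefficients and can be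
  -- specialized at `t = 0`.
  obtain ⟨G, hG⟩ := pow_dvd_cumulant_columnWeight
    (MvPolynomial.X 0 : MvPolynomial (Fin 2) ℤ) (MvPolynomial.X 1) h hne
  rw [card_univ, Fintype.card_fin] at hG
  have h1 : ((q - 1) ^ (mu.rowLen 0 - 1))⁻¹ * cumulant (columnWeight q t h) univ =
      MvPolynomial.aeval ![q, t] G := by
    have h2 := congrArg ((MvPolynomial.aeval ![q, t] : MvPolynomial (Fin 2) ℤ →ₐ[ℤ] QT) :
      MvPolynomial (Fin 2) ℤ →+* QT) hG
    rw [← cumulant_map] at h2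
    simp_rw [map_columnWeight] at h2
    simp only [RingHom.coe_coe, MvPolynomial.aeval_X, map_mul, map_pow, map_sub, map_one,
      Matrix.cons_val_zero, Matrix.cons_val_one] at h2
    rw [show columnWeight q t h = fun B => columnWeight q t h B from rfl, h2,
      inv_mul_cancel_left₀ (pow_ne_zero _ q_sub_one_ne_zero)]
  have h3 : MvPolynomial.aeval ![(Polynomial.X : Polynomial ℤ), 0] G =
      (-1) ^ mu.card * treePoly (mu.rowLen 0 - 1) mu.colLen := by
    have h2 := congrArg
      ((MvPolynomial.aeval ![(Polynomial.X : Polynomial ℤ), 0] :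
        MvPolynomial (Fin 2) ℤ →ₐ[ℤ] Polynomial ℤ) : MvPolynomial (Fin 2) ℤ →+* Polynomial ℤ) hG
    rw [← cumulant_map] at h2
    simp_rw [map_columnWeight] at h2
    simp only [RingHom.coe_coe, MvPolynomial.aeval_X, map_mul, map_pow, map_sub, map_one,
      Matrix.cons_val_zero, Matrix.cons_val_one] at h2
    simp_rw [columnWeight_zero hh] at h2
    rw [cumulant_prod_mul, cumulant_pairWeight_univ _ _ h0, prod_pow_eq_pow_sum, sum_colLen,
      aeval_int_eq_eval₂, RingHom.ext_int (Int.castRingHom (Polynomial ℤ)) Polynomial.C,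
      Polynomial.eval₂_C_X] at h2
    refine mul_left_cancel₀ (pow_ne_zero (mu.rowLen 0 - 1)
      (Polynomial.X_sub_C_ne_zero (1 : ℤ))) ?_
    rw [map_one, ← h2]
    ring
  rw [h1]
  obtain ⟨R, hR⟩ := X_dvd_sub_aeval G
  refine ⟨R, ?_, ?_⟩
  · rw [sub_eq_iff_eq_add'] at hR
    rw [h3] at hR
    have h4 := congrArg (MvPolynomial.aeval ![q, t] : MvPolynomial (Fin 2) ℤ →ₐ[ℤ] QT) hR
    rw [h4]
    have h5 : ∀ P : Polynomial ℤ, MvPolynomial.aeval ![q, t]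
        (Polynomial.aeval (MvPolynomial.X 0 : MvPolynomial (Fin 2) ℤ) P) =
        Polynomial.aeval q P := by
      intro P
      rw [← Polynomial.aeval_algHom_apply, MvPolynomial.aeval_X, Matrix.cons_val_zero]
    rw [map_add, h5, map_mul, map_mul, map_pow, map_neg, map_one, MvPolynomial.aeval_X,
      Matrix.cons_val_one, Matrix.cons_val_fin_one]
  -- If `G` vanished, so would its value at `t = 0`, a sign times the tree polynomial; but all
  -- columns have positive length.
  · rw [Ne, map_eq_zero_iff _ aeval_q_t_injective]
    intro hG0
    rw [hG0, map_zero] at h3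
    have h4 := eval_one_treePoly_pos (mu.rowLen 0 - 1) mu.colLen fun j hj => by
      have h5 : (0, j) ∈ mu := YoungDiagram.mem_iff_lt_rowLen.2 (by omega)
      exact YoungDiagram.mem_iff_lt_colLen.1 h5
    rcases mul_eq_zero.1 h3.symm with h5 | h5
    · exact absurd h5 (pow_ne_zero _ (neg_ne_zero.2 one_ne_zero))
    · rw [h5, Polynomial.eval_zero] at h4
      exact lt_irrefl _ h4

end LeadingCoefficient

end Macdonald

namespace Macdonald

/-! ### Basis and Schur expansion -/

section Basis

theorem DominatedBy.antisymm {lam mu : YoungDiagram} (h : DominatedBy lam mu)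
    (h' : DominatedBy mu lam) : lam = mu := by
  rcases h.eq_or_rank_lt with h1 | h1
  · exact h1
  · rcases h'.eq_or_rank_lt with h2 | h2
    · exact h2.symm
    · omega

theorem dominatedBy_of_mem_dominanceLower {lam mu : YoungDiagram}
    (h : partsExp lam ∈ dominanceLower (partsExp mu)) : DominatedBy lam mu :=
  ⟨by rw [← degree_partsExp, ← degree_partsExp, h.1], h.2⟩

theorem finite_dominatedBy (mu : YoungDiagram) : {lam | DominatedBy lam mu}.Finite :=
  (finite_card_le mu.card).subset fun _ h => h.1.le

theorem linearIndependent_fullyColored : LinearIndependent QT fullyColored := by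
  rw [linearIndependent_iff]
  intro c hc
  by_contra hne
  choose F hF hsupp hlead using exists_plethysm_fullyColored
  -- A linear relation survives the plethysm because the latter is independent of the power sum
  -- expression. It is then read off at an index of maximal dominance rank, where only one term
  -- contributes.
  have h1 : MvPolynomial.aeval (fun k => powerSum (k + 1)) (c.sum fun mu a => a • F mu) = 0 := by
    rw [map_finsuppSum]
    simp_rw [map_smul, hF]
    rwa [Finsupp.linearCombination_apply] at hc
  have h2 := aeval_alphabetXt_eq_zero h1
  obtain ⟨mu, hmu, hmax⟩ := exists_max_image c.support dominanceRank
    (Finsupp.support_nonempty_iff.2 hne)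
  have h3 := congrArg (MvPowerSeries.coeff (partsExp mu)) h2
  rw [map_finsuppSum, Finsupp.sum, map_sum, map_zero, sum_eq_single mu] at h3
  · rw [map_smul, MvPowerSeries.coeff_smul] at h3
    rcases mul_eq_zero.1 h3 with h4 | h4
    · exact Finsupp.mem_support_iff.1 hmu h4
    · rw [hlead] at h4
      obtain ⟨R, -, hR⟩ := leadingCoefficient_spec mu
      exact hR h4
  · intro nu hnu hne'
    rw [map_smul, MvPowerSeries.coeff_smul]
    by_contra h4
    have h5 := dominatedBy_of_mem_dominanceLower (hsupp nu _ (right_ne_zero_of_mul h4))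
    rcases h5.eq_or_rank_lt with h6 | h6
    · exact hne' h6.symm
    · exact (hmax nu hnu).not_gt h6
  · exact fun h => absurd hmu h

theorem exists_schur_expansion (U : Finset YoungDiagram)
    (hU : ∀ lam ∈ U, ∀ rho, DominatedBy rho lam → rho ∈ U) {g : PS} (hg : g ∈ SymFun)
    (h : ∀ rho, MvPowerSeries.coeff (partsExp rho) g ≠ 0 → rho ∈ U) :
    ∃ c : YoungDiagram →₀ QT, c.support ⊆ U ∧ g = c.sum fun lam a => a • schur lam :=
  exists_expansion schur schur_mem dominanceRank
    (fun mu => by rw [coeff_schur_self]; exact one_ne_zero) DominatedBy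
    (fun _ _ => dominatedBy_of_coeff_schur) (fun _ _ => DominatedBy.eq_or_rank_lt) U hU g hg h

theorem mem_span_fullyColored {g : PS} (hg : g ∈ SymFun) :
    g ∈ Submodule.span QT (Set.range fullyColored) := by
  classical
  obtain ⟨N, hN⟩ := hg.2
  set U := (finite_card_le N).toFinset with hUdef
  have hmem : ∀ mu, mu ∈ U ↔ mu.card ≤ N := fun mu => Set.Finite.mem_toFinset _
  have hU : ∀ lam ∈ U, ∀ rho, DominatedBy rho lam → rho ∈ U := by
    intro lam hlam rho h
    rw [hmem] at hlam ⊢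
    rwa [h.1]
  have hschur : ∀ f ∈ SymFun, (∀ α : ℕ →₀ ℕ, MvPowerSeries.coeff α f ≠ 0 → α.degree ≤ N) →
      f ∈ Submodule.span QT (U.image schur : Set PS) := by
    intro f hf hfN
    obtain ⟨c, hc, rfl⟩ := exists_schur_expansion U hU hf fun rho h => by
      rw [hmem, ← degree_partsExp]
      exact hfN _ h
    refine Submodule.sum_mem _ fun lam hlam => Submodule.smul_mem _ _ (Submodule.subset_span ?_)
    exact mem_coe.2 (mem_image_of_mem _ (hc hlam))
  have hle : Submodule.span QT (Set.range fun mu : U => fullyColored mu) ≤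
      Submodule.span QT (U.image schur : Set PS) := by
    rw [Submodule.span_le]
    rintro _ ⟨mu, rfl⟩
    refine hschur _ (fullyColored_mem mu) fun α hα => ?_
    rw [degree_of_coeff_fullyColored mu.1 hα]
    exact (hmem _).1 mu.2
  have hrank : Module.finrank QT (Submodule.span QT (Set.range fun mu : U => fullyColored mu)) =
      #U := by
    have h := finrank_span_eq_card (linearIndependent_fullyColored.comp (fun mu : U => mu.1)
      Subtype.val_injective)
    rwa [Fintype.card_coe] at h
  -- The independent elements of degree at most `N` are as many as the Schur functions whose span
  -- contains them, so the two spans coincide.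
  have heq := Submodule.eq_of_le_of_finrank_le hle
    (((finrank_span_finset_le_card _).trans card_image_le).trans hrank.ge)
  have h1 := hschur g hg hN
  rw [← heq] at h1
  refine Submodule.span_mono ?_ h1
  rintro _ ⟨mu, rfl⟩
  exact ⟨mu, rfl⟩

theorem exists_basis_fullyColored : ∃ b : Module.Basis YoungDiagram QT SymFun,
    ∀ mu : YoungDiagram, (b mu : PS) = fullyColored mu := by
  set v : YoungDiagram → SymFun := fun mu => ⟨fullyColored mu, fullyColored_mem mu⟩ with hv
  have hli : LinearIndependent QT v :=
    LinearIndependent.of_comp SymFun.val.toLinearMap linearIndependent_fullyColored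
  have hsp : ⊤ ≤ Submodule.span QT (Set.range v) := by
    rintro ⟨g, hg⟩ -
    have h1 := mem_span_fullyColored hg
    have h2 : Set.range fullyColored = SymFun.val.toLinearMap '' Set.range v := by
      rw [← Set.range_comp]
      rfl
    rw [h2, Submodule.span_image] at h1
    obtain ⟨g', hg', heq⟩ := h1
    have : g' = ⟨g, hg⟩ := Subtype.ext heq
    rwa [← this]
  exact ⟨Module.Basis.mk hli hsp, fun mu => by rw [Module.Basis.mk_apply]⟩

theorem exists_schur_expansion_plethysm (mu : YoungDiagram) : ∃ c : YoungDiagram →₀ QT,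
    (∀ lam : YoungDiagram, c lam ≠ 0 → DominatedBy lam mu) ∧
    IsPlethysm alphabetXt (fullyColored mu) (c.sum fun lam a => a • schur lam) ∧
    c mu = ((q - 1) ^ (mu.rowLen 0 - 1))⁻¹ * cumulant (fun B =>
      ∏ c : (oplus B (columns mu)).cells, (t ^ (leg c + 1) - q ^ arm c)) univ := by
  obtain ⟨F, hF, hsupp, hlead⟩ := exists_plethysm_fullyColored mu
  have hmem : MvPolynomial.aeval (fun k => alphabetXt (k + 1)) F ∈ SymFun := by
    rw [MvPolynomial.aeval_def, MvPolynomial.eval₂_eq]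
    refine SymFun.sum_mem fun d _ => SymFun.mul_mem (SymFun.algebraMap_mem _)
      (SymFun.prod_mem fun i _ => SymFun.pow_mem (SymFun.smul_mem (powerSum_mem _) _) _)
  obtain ⟨c, hc, hsum⟩ := exists_schur_expansion (finite_dominatedBy mu).toFinset
    (fun lam hlam rho h => by
      rw [Set.Finite.mem_toFinset] at hlam ⊢
      exact h.trans hlam) hmem
    (fun rho h => by
      rw [Set.Finite.mem_toFinset]
      exact dominatedBy_of_mem_dominanceLower (hsupp _ h))
  have hdom : ∀ lam : YoungDiagram, c lam ≠ 0 → DominatedBy lam mu := fun lam h =>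
    (Set.Finite.mem_toFinset (finite_dominatedBy mu)).1 (hc (Finsupp.mem_support_iff.2 h))
  refine ⟨c, hdom, ⟨F, hF, hsum⟩, ?_⟩
  -- Only `s_μ` contributes to `x ^ μ`: every other `λ` that occurs is dominated by `μ`, and a
  -- contribution would force `μ` to be dominated by `λ`.
  rw [← hlead, hsum, Finsupp.sum, map_sum, sum_eq_single mu]
  · rw [MvPowerSeries.coeff_smul, coeff_schur_self, mul_one]
  · intro lam hlam hne
    rw [MvPowerSeries.coeff_smul]
    by_contra h
    exact hne ((hdom lam (Finsupp.mem_support_iff.1 hlam)).antisymm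
      (dominatedBy_of_coeff_schur (right_ne_zero_of_mul h)))
  · intro h
    rw [Finsupp.notMem_support_iff.1 h, zero_smul, map_zero]

end Basis

end Macdonald

theorem mainTheorem3 :
    (∃ b : Module.Basis YoungDiagram QT SymFun,
      ∀ mu : YoungDiagram, (b mu : PS) = fullyColored mu) ∧
    ∀ mu : YoungDiagram, ∃ c : YoungDiagram →₀ QT,
      (∀ lam : YoungDiagram, c lam ≠ 0 → DominatedBy lam mu) ∧
      IsPlethysm alphabetXt (fullyColored mu) (c.sum fun lam a => a • schur lam) ∧
      c mu ≠ 0 ∧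
      ∃ R : MvPolynomial (Fin 2) ℤ,
        c mu = (-1) ^ mu.card *
            Polynomial.aeval q (treePoly (mu.rowLen 0 - 1) mu.colLen) +
          t * MvPolynomial.aeval ![q, t] R := by
  refine ⟨exists_basis_fullyColored, fun mu => ?_⟩
  obtain ⟨c, hdom, hple, hlead⟩ := exists_schur_expansion_plethysm mu
  obtain ⟨R, hR, hne⟩ := leadingCoefficient_spec mu
  exact ⟨c, hdom, hple, hlead ▸ hne, R, hlead.trans hR⟩
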